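/- Let $\mathbb{H}$ be the quaternions, $V$ a finitely generated left $\mathbb{H}$-module with its usual (Hausdorff vector space) topology, and $\mathcal{A}$ a finite set of hyperplanes in $V$, i.e. of kernels of non-zero $\mathbb{H}$-linear maps $V\to\mathbb{H}$. Let $X=V\setminus\bigcup_{A\in\mathcal{A}}A$, and let $H^\bullet(\cdot)$ denote the integral singular cohomology ring with the cup product. Let $E(\mathcal{A})=\Lambda_{\mathbb{Z}}(e_A)_{A\in\mathcal{A}}$ be the exterior algebra, with the antiderivation $\partial$ such that $\partial e_A=1$ for all $A$; let $I$ be the two-sided ideal generated by the elements $\partial(e_{A_1}\cdots e_{A_r})$ for all collections of distinct $A_1,\dots,A_r\in\mathcal{A}$ with $\operatorname{codim}(A_1\cap\dots\cap A_r)<r$; and let $O_{\times 3}(\mathcal{A})=E(\mathcal{A})/I$, with the induced $\partial$, graded so that each $e_A$ has degree $3$ (so $\partial$ has degree $-3$). The group $H^3(\mathbb{H}^\times)$ is infinite cyclic. Let $s$ be any generator of it, and let $\rho:\mathbb{H}^\times\times X\to X$ be the action by scalar multiplication. There is exactly one additive map $\partial:H^\bullet(X)\to H^\bullet(X)$ with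 $$\rho^*(x)=1\times x+s\times\partial x\in H^\bullet(\mathbb{H}^\times\times X)\qquad\text{for all }x\in H^\bullet(X),$$ where $\times$ is the cross product. With these differentials, $O_{\times 3}(\mathcal{A})$ and $H^\bullet(X)$ are commutative graded differential algebras with differential of degree $-3$: they are graded and graded commutative, and $\partial$ lowers the degree by $3$, satisfies $\partial^2=0$, and satisfies $\partial(xy)=(\partial x)y+(-1)^{\deg x}x\,\partial y$ for homogeneous $x$. Moreover there is a ring isomorphism $$\varphi:O_{\times 3}(\mathcal{A})\longrightarrow H^\bullet(X)$$ such that $\varphi(e_A)=a^*(s)$ for every $A\in\mathcal{A}$ and every $\mathbb{H}$-linear map $a:V\to\mathbb{H}$ with kernel $A$ (restricted to $a:X\to\mathbb{H}^\times$), such that $\varphi$ maps the degree-$n$ part of $O_{\times 3}(\mathcal{A})$ onto $H^n(X)$ for every $n$, and such that $\varphi\circ\partial=\partial\circ\varphi$. -/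

import Mathlib

open scoped Quaternion DirectSum

noncomputable section

namespace SingularCohomology

universe u v w

/-- A singular `n`-simplex of `X`: a continuous map from the standard `n`-simplex to `X`. -/
abbrev Simplex (X : Type u) [TopologicalSpace X] (n : ℕ) : Type u :=
  C(stdSimplex ℝ (Fin (n + 1)), X)

section Simplices

variable {X : Type u} [TopologicalSpace X]

/-- Precomposition of a singular simplex with the affine map induced by a monotone map
of vertices. -/
def Simplex.precomp {m n : ℕ} (σ : Simplex X n) (θ : Fin (m + 1) →o Fin (n + 1)) :
    Simplex X m :=
  σ.comp ⟨stdSimplex.map θ, stdSimplex.continuous_map θ⟩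

theorem Simplex.precomp_precomp {l m n : ℕ} (σ : Simplex X n)
    (θ : Fin (m + 1) →o Fin (n + 1)) (η : Fin (l + 1) →o Fin (m + 1)) :
    (σ.precomp θ).precomp η = σ.precomp (θ.comp η) := by
  ext x
  simp only [Simplex.precomp, ContinuousMap.comp_apply, ContinuousMap.coe_mk]
  congr 1
  exact stdSimplex.map_comp_apply _ _ _

theorem Simplex.precomp_id {n : ℕ} (σ : Simplex X n) : σ.precomp OrderHom.id = σ := by
  ext x
  simp [Simplex.precomp]

/-- The monotone injection that omits the vertex `i` (for `i ≤ n + 1`). -/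
def faceMap (n i : ℕ) : Fin (n + 1) →o Fin (n + 2) where
  toFun k := if (k : ℕ) < i then k.castSucc else k.succ
  monotone' := by
    intro a b hab
    rw [Fin.le_def] at hab ⊢
    dsimp only
    split_ifs <;> simp <;> omega

/-- The inclusion of the first `p + 1` vertices of an `n`-simplex, where `p + q = n`. -/
def frontMap {p q n : ℕ} (h : p + q = n) : Fin (p + 1) →o Fin (n + 1) where
  toFun k := ⟨k, by omega⟩
  monotone' := fun _ _ hab => hab

/-- The inclusion of the last `q + 1` vertices of an `n`-simplex, where `p + q = n`. -/
def backMap {p q n : ℕ} (h : p + q = n) : Fin (q + 1) →o Fin (n + 1) where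
  toFun k := ⟨p + k, by omega⟩
  monotone' := by
    intro a b hab
    rw [Fin.le_def] at hab ⊢
    simp
    omega

theorem faceMap_val (n i : ℕ) (k : Fin (n + 1)) :
    (faceMap n i k : ℕ) = if (k : ℕ) < i then (k : ℕ) else k + 1 := by
  show ((if (k : ℕ) < i then k.castSucc else k.succ : Fin (n + 2)) : ℕ) = _
  split_ifs <;> simp

theorem frontMap_val {p q n : ℕ} (h : p + q = n) (k : Fin (p + 1)) :
    (frontMap h k : ℕ) = k := rfl

theorem backMap_val {p q n : ℕ} (h : p + q = n) (k : Fin (q + 1)) :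
    (backMap h k : ℕ) = p + k := rfl

/-- The `i`-th face of a singular simplex. -/
def Simplex.face {n : ℕ} (σ : Simplex X (n + 1)) (i : ℕ) : Simplex X n :=
  σ.precomp (faceMap n i)

/-- The front `p`-face of a singular `(p + q)`-simplex. -/
def Simplex.front {p q n : ℕ} (h : p + q = n) (σ : Simplex X n) : Simplex X p :=
  σ.precomp (frontMap h)

/-- The back `q`-face of a singular `(p + q)`-simplex. -/
def Simplex.back {p q n : ℕ} (h : p + q = n) (σ : Simplex X n) : Simplex X q :=
  σ.precomp (backMap h)

end Simplices

/-- Integral singular `n`-cochains of `X`. -/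
abbrev Cochain (X : Type u) [TopologicalSpace X] (n : ℕ) : Type u := Simplex X n → ℤ

section Cochains

variable {X : Type u} [TopologicalSpace X]

/-- The coboundary `(d f)(σ) = ∑ i, (-1)^i f(∂ᵢ σ)`. -/
def d (X : Type u) [TopologicalSpace X] (n : ℕ) : Cochain X n →+ Cochain X (n + 1) where
  toFun f σ := ∑ i ∈ Finset.range (n + 2), (-1) ^ i * f (σ.face i)
  map_zero' := by ext; simp
  map_add' f g := by ext; simp [mul_add, Finset.sum_add_distrib]

theorem d_apply {n : ℕ} (f : Cochain X n) (σ : Simplex X (n + 1)) :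
    d X n f σ = ∑ i ∈ Finset.range (n + 2), (-1) ^ i * f (σ.face i) := rfl

/-- The coboundary squares to zero. -/
theorem d_d {n : ℕ} (f : Cochain X n) : d X (n + 1) (d X n f) = 0 := by
  ext σ
  have key : ∀ i j : ℕ, j < i → (σ.face i).face j = (σ.face j).face (i - 1) := by
    intro i j hij
    simp only [Simplex.face, Simplex.precomp_precomp]
    congr 1
    ext k
    simp only [OrderHom.comp_coe, Function.comp_apply, faceMap_val]
    grind
  simp only [d_apply, Finset.mul_sum, Pi.zero_apply]
  rw [← Finset.sum_product']
  refine Finset.sum_involution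
    (fun x _ => if x.2 < x.1 then (x.2, x.1 - 1) else (x.2 + 1, x.1)) ?_ ?_ ?_ ?_
  · rintro ⟨i, j⟩ _
    by_cases h : j < i
    · obtain ⟨i, rfl⟩ : ∃ m, i = m + 1 := ⟨i - 1, by omega⟩
      simp only [h, if_true, key _ _ h, Nat.add_sub_cancel]
      ring
    · simp only [h, if_false, key (j + 1) i (by omega), Nat.add_sub_cancel]
      ring
  · rintro ⟨i, j⟩ _ _ h
    split_ifs at h <;> simp only [Prod.mk.injEq] at h <;> omega
  · rintro ⟨i, j⟩ hx
    simp only [Finset.mem_product, Finset.mem_range] at hx ⊢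
    split_ifs <;> dsimp only <;> omega
  · rintro ⟨i, j⟩ _
    dsimp only
    by_cases h : j < i
    · have h' : ¬ i - 1 < j := by omega
      rw [if_pos h, if_neg h', Nat.sub_add_cancel (by omega)]
    · have h' : i < j + 1 := by omega
      rw [if_neg h, if_pos h', Nat.add_sub_cancel]

/-- The cup product of cochains: front face times back face. -/
def cup {p q n : ℕ} (h : p + q = n) (f : Cochain X p) (g : Cochain X q) : Cochain X n :=
  fun σ => f (σ.front h) * g (σ.back h)

theorem cup_add {p q n : ℕ} (h : p + q = n) (f : Cochain X p) (g g' : Cochain X q) :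
    cup h f (g + g') = cup h f g + cup h f g' := by
  ext σ; simp [cup, mul_add]

theorem add_cup {p q n : ℕ} (h : p + q = n) (f f' : Cochain X p) (g : Cochain X q) :
    cup h (f + f') g = cup h f g + cup h f' g := by
  ext σ; simp [cup, add_mul]

theorem cup_assoc {p q r m k n : ℕ} (h₁ : p + q = m) (h₂ : m + r = n) (h₃ : q + r = k)
    (h₄ : p + k = n) (f : Cochain X p) (g : Cochain X q) (h : Cochain X r) :
    cup h₂ (cup h₁ f g) h = cup h₄ f (cup h₃ g h) := by
  ext σ
  simp only [cup, Simplex.front, Simplex.back, Simplex.precomp_precomp, mul_assoc]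
  congr 2
  congr 2
  ext k
  simp only [OrderHom.comp_coe, Function.comp_apply, backMap_val]
  omega

/-- The Leibniz rule for the coboundary and the cup product. -/
theorem d_cup {p q n : ℕ} (h : p + q = n) (f : Cochain X p) (g : Cochain X q) :
    d X n (cup h f g) = cup (by omega) (d X p f) g +
      (-1 : ℤ) ^ p • cup (by omega : p + (q + 1) = n + 1) f (d X q g) := by
  ext σ
  subst h
  have h1 : ∀ i ∈ Finset.range (p + 1),
      (-1 : ℤ) ^ i * cup rfl f g (σ.face i) =
        (-1) ^ i * f ((σ.front (by omega : (p + 1) + q = p + q + 1)).face i) *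
          g (σ.back (by omega : (p + 1) + q = p + q + 1)) := by
    intro i hi
    rw [Finset.mem_range] at hi
    simp only [cup, Simplex.front, Simplex.back, Simplex.face, Simplex.precomp_precomp, mul_assoc]
    congr 2
    · congr 2
      ext k
      simp only [OrderHom.comp_coe, Function.comp_apply,
        faceMap_val, frontMap_val]
      grind
    · congr 2
      ext k
      simp only [OrderHom.comp_coe, Function.comp_apply,
        faceMap_val, backMap_val]
      grind
  have h2 : ∀ j ∈ Finset.range (q + 1),
      (-1 : ℤ) ^ (p + 1 + j) * cup rfl f g (σ.face (p + 1 + j)) =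
        (-1) ^ p * (f (σ.front (by omega : p + (q + 1) = p + q + 1)) * ((-1) ^ (j + 1) *
          g ((σ.back (by omega : p + (q + 1) = p + q + 1)).face (j + 1)))) := by
    intro j hj
    simp only [cup, Simplex.front, Simplex.back, Simplex.face, Simplex.precomp_precomp]
    have e1 : (faceMap (p + q) (p + 1 + j)).comp (frontMap (rfl : p + q = p + q)) =
        frontMap (by omega : p + (q + 1) = p + q + 1) := by
      ext k
      simp only [OrderHom.comp_coe, Function.comp_apply,
        faceMap_val, frontMap_val]
      grind
    have e2 : (faceMap (p + q) (p + 1 + j)).comp (backMap (rfl : p + q = p + q)) =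
        (backMap (by omega : p + (q + 1) = p + q + 1)).comp (faceMap q (j + 1)) := by
      ext k
      simp only [OrderHom.comp_coe, Function.comp_apply,
        faceMap_val, backMap_val]
      grind
    rw [e1, e2]
    ring
  have e3 : (σ.front (by omega : (p + 1) + q = p + q + 1)).face (p + 1) =
      σ.front (by omega : p + (q + 1) = p + q + 1) := by
    simp only [Simplex.front, Simplex.face, Simplex.precomp_precomp]
    congr 1
    ext k
    simp only [OrderHom.comp_coe, Function.comp_apply,
      faceMap_val, frontMap_val]
    grind
  have e4 : (σ.back (by omega : p + (q + 1) = p + q + 1)).face 0 =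
      σ.back (by omega : (p + 1) + q = p + q + 1) := by
    simp only [Simplex.back, Simplex.face, Simplex.precomp_precomp]
    congr 1
    ext k
    simp only [OrderHom.comp_coe, Function.comp_apply,
      faceMap_val, backMap_val]
    grind
  rw [d_apply, show p + q + 2 = (p + 1) + (q + 1) by ring, Finset.sum_range_add,
    Finset.sum_congr rfl h1, Finset.sum_congr rfl h2]
  simp only [Pi.add_apply, Pi.smul_apply, smul_eq_mul]
  have c1 : cup (by omega : (p + 1) + q = p + q + 1) (d X p f) g σ =
      (∑ i ∈ Finset.range (p + 1),
        (-1) ^ i * f ((σ.front (by omega : (p + 1) + q = p + q + 1)).face i) *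
          g (σ.back (by omega : (p + 1) + q = p + q + 1))) +
      (-1) ^ (p + 1) * f (σ.front (by omega : p + (q + 1) = p + q + 1)) *
        g (σ.back (by omega : (p + 1) + q = p + q + 1)) := by
    rw [cup, d_apply, Finset.sum_range_succ, add_mul, Finset.sum_mul, e3]
  have c2 : cup (by omega : p + (q + 1) = p + q + 1) f (d X q g) σ =
      (∑ j ∈ Finset.range (q + 1), f (σ.front (by omega : p + (q + 1) = p + q + 1)) *
        ((-1) ^ (j + 1) * g ((σ.back (by omega : p + (q + 1) = p + q + 1)).face (j + 1)))) +
      f (σ.front (by omega : p + (q + 1) = p + q + 1)) *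
        g (σ.back (by omega : (p + 1) + q = p + q + 1)) := by
    rw [cup, d_apply, Finset.sum_range_succ', mul_add, Finset.mul_sum, e4]
    simp
  rw [c1, c2, ← Finset.mul_sum]
  ring

/-- The unit cochain, constant `1` in degree `0`. -/
def unitCochain (X : Type u) [TopologicalSpace X] : Cochain X 0 := fun _ => 1

theorem d_unitCochain : d X 0 (unitCochain X) = 0 := by
  ext σ
  simp [d_apply, unitCochain, Finset.sum_range_succ]

theorem unit_cup {q n : ℕ} (h : 0 + q = n) (g : Cochain X q) :
    GradedMonoid.mk (A := Cochain X) n (cup h (unitCochain X) g) = GradedMonoid.mk q g := by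
  obtain rfl : q = n := by omega
  congr 1
  ext σ
  simp only [cup, unitCochain, one_mul, Simplex.back]
  congr 1
  rw [show backMap h = OrderHom.id from by ext k; simp [backMap_val], Simplex.precomp_id]

theorem cup_unit {p n : ℕ} (h : p + 0 = n) (f : Cochain X p) :
    GradedMonoid.mk (A := Cochain X) n (cup h f (unitCochain X)) = GradedMonoid.mk p f := by
  obtain rfl : p = n := by omega
  congr 1
  ext σ
  simp only [cup, unitCochain, mul_one, Simplex.front]
  congr 1
  rw [show frontMap h = OrderHom.id from by ext k; simp [frontMap_val], Simplex.precomp_id]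

/-- Singular cocycles. -/
def cocycles (X : Type u) [TopologicalSpace X] (n : ℕ) : AddSubgroup (Cochain X n) :=
  (d X n).ker

/-- Singular coboundaries. -/
def coboundaries (X : Type u) [TopologicalSpace X] : (n : ℕ) → AddSubgroup (Cochain X n)
  | 0 => ⊥
  | n + 1 => (d X n).range

theorem mem_cocycles {n : ℕ} {f : Cochain X n} : f ∈ cocycles X n ↔ d X n f = 0 := Iff.rfl

theorem cup_mem_cocycles {p q n : ℕ} (h : p + q = n) {f : Cochain X p} {g : Cochain X q}
    (hf : f ∈ cocycles X p) (hg : g ∈ cocycles X q) : cup h f g ∈ cocycles X n := by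
  rw [mem_cocycles] at *
  rw [d_cup, hf, hg]
  ext σ
  simp [cup]

theorem cup_mem_coboundaries_right {p q n : ℕ} (h : p + q = n) {f : Cochain X p}
    {g : Cochain X q} (hf : f ∈ cocycles X p) (hg : g ∈ coboundaries X q) :
    cup h f g ∈ coboundaries X n := by
  cases q with
  | zero =>
    obtain rfl : g = 0 := hg
    have h0 : cup h f (0 : Cochain X 0) = 0 := by ext σ; simp [cup]
    rw [h0]
    exact zero_mem _
  | succ q =>
    obtain ⟨g, rfl⟩ := hg
    subst h
    refine ⟨(-1 : ℤ) ^ p • cup rfl f g, ?_⟩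
    rw [map_zsmul, d_cup, mem_cocycles.1 hf, smul_add, smul_smul, ← mul_pow]
    ext σ
    simp [cup]

theorem cup_mem_coboundaries_left {p q n : ℕ} (h : p + q = n) {f : Cochain X p}
    {g : Cochain X q} (hf : f ∈ coboundaries X p) (hg : g ∈ cocycles X q) :
    cup h f g ∈ coboundaries X n := by
  cases p with
  | zero =>
    obtain rfl : f = 0 := hf
    have h0 : cup h (0 : Cochain X 0) g = 0 := by ext σ; simp [cup]
    rw [h0]
    exact zero_mem _
  | succ p =>
    obtain ⟨f, rfl⟩ := hf
    obtain rfl : n = p + q + 1 := by omega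
    refine ⟨cup rfl f g, ?_⟩
    rw [d_cup, mem_cocycles.1 hg]
    ext σ
    simp [cup]

end Cochains

/-- The integral singular cohomology group `Hⁿ(X)`: cocycles modulo coboundaries. -/
def Cohomology (X : Type u) [TopologicalSpace X] (n : ℕ) : Type u :=
  cocycles X n ⧸ (coboundaries X n).addSubgroupOf (cocycles X n)

instance (X : Type u) [TopologicalSpace X] (n : ℕ) : AddCommGroup (Cohomology X n) :=
  inferInstanceAs (AddCommGroup (cocycles X n ⧸ (coboundaries X n).addSubgroupOf (cocycles X n)))

section Ring

variable {X : Type u} [TopologicalSpace X]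

/-- The cohomology class of a cocycle. -/
def cls {n : ℕ} : cocycles X n →+ Cohomology X n :=
  QuotientAddGroup.mk' _

theorem cls_surjective {n : ℕ} : Function.Surjective (cls : cocycles X n → Cohomology X n) :=
  QuotientAddGroup.mk'_surjective _

theorem cls_eq_zero {n : ℕ} (f : cocycles X n) : cls f = 0 ↔ (f : Cochain X n) ∈ coboundaries X n :=
  QuotientAddGroup.eq_zero_iff f

/-- The cup product of cocycles, as a bilinear map to cohomology. -/
def cupCocycles {p q n : ℕ} (h : p + q = n) :
    cocycles X p →+ cocycles X q →+ Cohomology X n :=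
  AddMonoidHom.mk' (fun f => AddMonoidHom.mk'
    (fun g => cls ⟨cup h f.1 g.1, cup_mem_cocycles h f.2 g.2⟩)
    (fun g g' => by
      rw [← map_add]
      exact congrArg cls (Subtype.ext (cup_add h f.1 g.1 g'.1))))
    (fun f f' => by
      ext g
      exact (congrArg cls (Subtype.ext (add_cup h f.1 f'.1 g.1))).trans (map_add cls
        ⟨cup h f.1 g.1, cup_mem_cocycles h f.2 g.2⟩ ⟨cup h f'.1 g.1, cup_mem_cocycles h f'.2 g.2⟩))

/-- The cup product `Hᵖ(X) × H^q(X) → H^{p+q}(X)`. -/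
def cupProduct {p q n : ℕ} (h : p + q = n) :
    Cohomology X p →+ Cohomology X q →+ Cohomology X n :=
  QuotientAddGroup.lift _
    (AddMonoidHom.mk' (fun f => QuotientAddGroup.lift _ (cupCocycles h f)
      (fun g hg => (cls_eq_zero _).2 (cup_mem_coboundaries_right h f.2 hg)))
      (fun f f' => by
        refine AddMonoidHom.ext fun b => ?_
        obtain ⟨g, rfl⟩ := cls_surjective b
        exact DFunLike.congr_fun (map_add (cupCocycles h) f f') g))
    (fun f hf => by
      refine AddMonoidHom.ext fun b => ?_
      obtain ⟨g, rfl⟩ := cls_surjective b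
      exact (cls_eq_zero _).2 (cup_mem_coboundaries_left h hf g.2))

theorem cupProduct_cls {p q n : ℕ} (h : p + q = n) (f : cocycles X p) (g : cocycles X q) :
    cupProduct h (cls f) (cls g) = cls ⟨cup h f.1 g.1, cup_mem_cocycles h f.2 g.2⟩ := rfl

/-- The unit class in `H⁰(X)`. -/
def unitClass (X : Type u) [TopologicalSpace X] : Cohomology X 0 :=
  cls ⟨unitCochain X, d_unitCochain⟩

theorem mk_cls_eq {m n : ℕ} {f : cocycles X m} {g : cocycles X n}
    (h : GradedMonoid.mk (A := Cochain X) m f.1 = GradedMonoid.mk n g.1) :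
    GradedMonoid.mk (A := Cohomology X) m (cls f) = GradedMonoid.mk n (cls g) := by
  obtain rfl : m = n := congrArg Sigma.fst h
  have : f = g := Subtype.ext (eq_of_heq (Sigma.mk.inj h).2)
  rw [this]

instance : GradedMonoid.GMul (Cohomology X) where
  mul a b := cupProduct rfl a b

instance : GradedMonoid.GOne (Cohomology X) where
  one := unitClass X

instance : DirectSum.GRing (Cohomology X) where
  mul_zero a := map_zero _
  zero_mul b := DFunLike.congr_fun (map_zero (cupProduct rfl)) b
  mul_add a b c := map_add _ _ _
  add_mul a b c := DFunLike.congr_fun (map_add (cupProduct rfl) a b) c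
  one_mul := by
    rintro ⟨n, a⟩
    obtain ⟨f, rfl⟩ := cls_surjective a
    exact mk_cls_eq (unit_cup _ _)
  mul_one := by
    rintro ⟨n, a⟩
    obtain ⟨f, rfl⟩ := cls_surjective a
    exact mk_cls_eq (cup_unit _ _)
  mul_assoc := by
    rintro ⟨p, a⟩ ⟨q, b⟩ ⟨r, c⟩
    obtain ⟨f, rfl⟩ := cls_surjective a
    obtain ⟨g, rfl⟩ := cls_surjective b
    obtain ⟨k, rfl⟩ := cls_surjective c
    refine mk_cls_eq (f := ⟨cup rfl (cup rfl f.1 g.1) k.1, _⟩)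
      (g := ⟨cup rfl f.1 (cup rfl g.1 k.1), _⟩) ?_
    have e : ∀ {m n : ℕ} (_ : m = n) (x : Cochain X m) (h : p + (q + r) = m),
        x = cup h f.1 (cup rfl g.1 k.1) → ∀ h' : p + (q + r) = n,
        GradedMonoid.mk (A := Cochain X) m x =
          GradedMonoid.mk n (cup h' f.1 (cup rfl g.1 k.1)) := by
      rintro m n rfl x h rfl h'
      rfl
    exact e (add_assoc p q r) _ (add_assoc p q r).symm (cup_assoc _ _ _ _ _ _ _) rfl
  natCast n := n • unitClass X
  natCast_zero := zero_nsmul _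
  natCast_succ n := succ_nsmul _ _
  intCast n := n • unitClass X
  intCast_ofNat n := natCast_zsmul _ _
  intCast_negSucc_ofNat n := negSucc_zsmul _ _

end Ring

/-- The integral singular cohomology ring `H^•(X) = ⨁ₙ Hⁿ(X)` with the cup product. -/
abbrev CohomologyRing (X : Type u) [TopologicalSpace X] : Type u := ⨁ n, Cohomology X n

/-- The homogeneous part of degree `n` of the cohomology ring. -/
def degreePart (X : Type u) [TopologicalSpace X] (n : ℕ) : AddSubgroup (CohomologyRing X) :=
  (DirectSum.of (Cohomology X) n).range

section Functoriality

variable {X : Type u} [TopologicalSpace X] {Y : Type v} [TopologicalSpace Y]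

/-- Pullback of cochains along a continuous map. -/
def pullCochain (F : C(X, Y)) (n : ℕ) : Cochain Y n →+ Cochain X n where
  toFun f σ := f (F.comp σ)
  map_zero' := rfl
  map_add' _ _ := rfl

theorem d_pullCochain (F : C(X, Y)) (n : ℕ) (f : Cochain Y n) :
    d X n (pullCochain F n f) = pullCochain F (n + 1) (d Y n f) := rfl

theorem pullCochain_mem_cocycles (F : C(X, Y)) {n : ℕ} {f : Cochain Y n}
    (hf : f ∈ cocycles Y n) : pullCochain F n f ∈ cocycles X n := by
  rw [mem_cocycles] at *
  rw [d_pullCochain, hf, map_zero]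

theorem pullCochain_mem_coboundaries (F : C(X, Y)) {n : ℕ} {f : Cochain Y n}
    (hf : f ∈ coboundaries Y n) : pullCochain F n f ∈ coboundaries X n := by
  cases n with
  | zero =>
    obtain rfl : f = 0 := hf
    exact zero_mem _
  | succ n =>
    obtain ⟨g, rfl⟩ := hf
    exact ⟨pullCochain F n g, rfl⟩

/-- The map `F^* : Hⁿ(Y) → Hⁿ(X)` induced by a continuous map `F : X → Y`. -/
def pullDegree (F : C(X, Y)) (n : ℕ) : Cohomology Y n →+ Cohomology X n :=
  QuotientAddGroup.map _ _
    (((pullCochain F n).comp (cocycles Y n).subtype).codRestrict (cocycles X n)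
      (fun f => pullCochain_mem_cocycles F f.2))
    (fun _ hf => pullCochain_mem_coboundaries F hf)

/-- The ring homomorphism `F^* : H^•(Y) → H^•(X)` induced by a continuous map `F : X → Y`. -/
def pull (F : C(X, Y)) : CohomologyRing Y →+* CohomologyRing X :=
  DirectSum.toSemiring (fun n => (DirectSum.of (Cohomology X) n).comp (pullDegree F n))
    rfl
    (by
      intro p q a b
      obtain ⟨f, rfl⟩ := cls_surjective a
      obtain ⟨g, rfl⟩ := cls_surjective b
      simp only [AddMonoidHom.comp_apply]
      rw [DirectSum.of_mul_of]
      rfl)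

end Functoriality

end SingularCohomology

section GradedDifferential

/-- A commutative graded differential ring whose differential has degree `-3`: a ring `R` that is
the internal direct sum of additive subgroups `gr n`, with graded commutative multiplication, and
an additive map `D` of degree `-3` with `D ∘ D = 0` that satisfies the graded Leibniz rule. -/
structure IsCGDA {R : Type*} [Ring R] (gr : ℕ → AddSubgroup R) (D : R →+ R) : Prop where
  isInternal : DirectSum.IsInternal gr
  one_mem : (1 : R) ∈ gr 0
  mul_mem : ∀ {m n : ℕ} {x y : R}, x ∈ gr m → y ∈ gr n → x * y ∈ gr (m + n)
  graded_comm : ∀ {m n : ℕ} {x y : R}, x ∈ gr m → y ∈ gr n → x * y = (-1) ^ (m * n) * (y * x)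
  degree : ∀ {n : ℕ} {x : R}, x ∈ gr (n + 3) → D x ∈ gr n
  degree_lt : ∀ {n : ℕ} {x : R}, n < 3 → x ∈ gr n → D x = 0
  square_zero : ∀ x : R, D (D x) = 0
  leibniz : ∀ {n : ℕ} {x y : R}, x ∈ gr n → D (x * y) = D x * y + (-1) ^ n * (x * D y)

end GradedDifferential

namespace QuaternionicArrangement

open SingularCohomology

universe u

section Algebra

variable {V : Type u} [AddCommGroup V] [Module ℍ[ℝ] V]

/-- A (central) hyperplane: the kernel of a non-zero `ℍ`-linear map `V → ℍ`. -/
def IsHyperplane (A : Submodule ℍ[ℝ] V) : Prop :=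
  ∃ a : V →ₗ[ℍ[ℝ]] ℍ[ℝ], a ≠ 0 ∧ LinearMap.ker a = A

/-- The exterior algebra `E(𝒜)` over `ℤ` on generators `e_A`, `A ∈ 𝒜`. -/
abbrev E (𝒜 : Finset (Submodule ℍ[ℝ] V)) : Type u := ExteriorAlgebra ℤ (𝒜 →₀ ℤ)

variable (𝒜 : Finset (Submodule ℍ[ℝ] V))

/-- The differential on `E(𝒜)`: contraction with the functional `e_A ↦ 1`, that is, the
antiderivation `∂` with `∂ e_A = 1` for all `A`. -/
def E.diff : E 𝒜 →ₗ[ℤ] E 𝒜 :=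
  CliffordAlgebra.contractLeft (Q := (0 : QuadraticForm ℤ (𝒜 →₀ ℤ)))
    (Finsupp.linearCombination ℤ (fun _ : 𝒜 => (1 : ℤ)))

/-- The product `e_{A₁} ⋯ e_{Aᵣ}`. -/
def E.monomial {r : ℕ} (A : Fin r → 𝒜) : E 𝒜 :=
  ExteriorAlgebra.ιMulti ℤ r (fun i => Finsupp.single (A i) (1 : ℤ))

/-- The generators `∂(e_{A₁} ⋯ e_{Aᵣ})` of the Orlik–Solomon ideal, for distinct hyperplanes
`A₁, …, Aᵣ ∈ 𝒜` whose intersection has codimension less than `r`. -/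
def osRelations : Set (E 𝒜) :=
  {x | ∃ (r : ℕ) (A : Fin r → 𝒜), Function.Injective A ∧
    Module.finrank ℍ[ℝ] (V ⧸ ⨅ i, (A i : Submodule ℍ[ℝ] V)) < r ∧
    x = E.diff 𝒜 (E.monomial 𝒜 A)}

/-- The Orlik–Solomon ideal. -/
def osIdeal : Ideal (E 𝒜) := (TwoSidedIdeal.span (osRelations 𝒜)).asIdeal

instance : (osIdeal 𝒜).IsTwoSided :=
  inferInstanceAs ((TwoSidedIdeal.span (osRelations 𝒜)).asIdeal.IsTwoSided)

/-- The Orlik–Solomon algebra `O(𝒜) = E(𝒜) / I`. -/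
abbrev OS : Type u := E 𝒜 ⧸ osIdeal 𝒜

theorem E.diff_diff (x : E 𝒜) : E.diff 𝒜 (E.diff 𝒜 x) = 0 :=
  CliffordAlgebra.contractLeft_contractLeft _ x

theorem E.diff_mul (x y : E 𝒜) :
    E.diff 𝒜 (x * y) = E.diff 𝒜 x * y + CliffordAlgebra.involute x * E.diff 𝒜 y := by
  induction x using CliffordAlgebra.left_induction with
  | algebraMap r =>
    rw [E.diff, CliffordAlgebra.contractLeft_algebraMap_mul, CliffordAlgebra.contractLeft_algebraMap,
      AlgHom.commutes, zero_mul, zero_add]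
  | add x z hx hz => rw [add_mul, map_add, hx, hz, map_add, map_add, add_mul, add_mul]; abel
  | ι_mul x v hx =>
    rw [E.diff] at *
    rw [mul_assoc, CliffordAlgebra.contractLeft_ι_mul, hx, CliffordAlgebra.contractLeft_ι_mul,
      map_mul, CliffordAlgebra.involute_ι]
    simp only [sub_mul, mul_add, smul_mul_assoc, neg_mul, mul_assoc]
    abel

theorem E.involute_monomial {r : ℕ} (A : Fin r → 𝒜) :
    CliffordAlgebra.involute (E.monomial 𝒜 A) = (-1 : ℤ) ^ r • E.monomial 𝒜 A := by
  have h := CliffordAlgebra.involute_prod_map_ι (Q := (0 : QuadraticForm ℤ (𝒜 →₀ ℤ)))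
    (List.ofFn fun i => Finsupp.single (A i) (1 : ℤ))
  rw [List.length_ofFn, List.map_ofFn] at h
  exact h

theorem E.involute_diff (x : E 𝒜) :
    CliffordAlgebra.involute (E.diff 𝒜 x) = - E.diff 𝒜 (CliffordAlgebra.involute x) := by
  induction x using CliffordAlgebra.left_induction with
  | algebraMap r =>
    rw [AlgHom.commutes, E.diff, CliffordAlgebra.contractLeft_algebraMap, map_zero, neg_zero]
  | add x z hx hz => rw [map_add, map_add, hx, hz, map_add, map_add, neg_add]
  | ι_mul x v hx =>
    rw [E.diff] at *
    rw [CliffordAlgebra.contractLeft_ι_mul, map_sub, map_smul, map_mul, map_mul, hx,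
      CliffordAlgebra.involute_ι, neg_mul, neg_mul, map_neg, CliffordAlgebra.contractLeft_ι_mul]
    simp

/-- The Orlik–Solomon ideal is stable under `∂`. -/
theorem diff_mem_osIdeal {x : E 𝒜} (hx : x ∈ osIdeal 𝒜) : E.diff 𝒜 x ∈ osIdeal 𝒜 := by
  have hx' : x ∈ TwoSidedIdeal.span (osRelations 𝒜) := TwoSidedIdeal.mem_asIdeal.1 hx
  suffices h : E.diff 𝒜 x ∈ TwoSidedIdeal.span (osRelations 𝒜) ∧
      CliffordAlgebra.involute x ∈ TwoSidedIdeal.span (osRelations 𝒜) from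
    TwoSidedIdeal.mem_asIdeal.2 h.1
  clear hx
  induction hx' using TwoSidedIdeal.span_induction with
  | mem x h =>
    obtain ⟨r, A, hA, hr, rfl⟩ := h
    refine ⟨?_, ?_⟩
    · rw [E.diff_diff]
      exact zero_mem _
    · rw [E.involute_diff, E.involute_monomial, map_smul]
      have hg : E.diff 𝒜 (E.monomial 𝒜 A) ∈ TwoSidedIdeal.span (osRelations 𝒜) :=
        TwoSidedIdeal.subset_span ⟨r, A, hA, hr, rfl⟩
      exact neg_mem (zsmul_mem hg _)
  | zero => simp only [map_zero]; exact ⟨zero_mem _, zero_mem _⟩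
  | add x y hx hy ihx ihy =>
    rw [map_add, map_add]
    exact ⟨add_mem ihx.1 ihy.1, add_mem ihx.2 ihy.2⟩
  | neg x hx ih =>
    rw [map_neg, map_neg]
    exact ⟨neg_mem ih.1, neg_mem ih.2⟩
  | left_absorb a x hx ih =>
    rw [E.diff_mul, map_mul]
    exact ⟨add_mem (TwoSidedIdeal.mul_mem_left _ _ _ hx) (TwoSidedIdeal.mul_mem_left _ _ _ ih.1),
      TwoSidedIdeal.mul_mem_left _ _ _ ih.2⟩
  | right_absorb b x hx ih =>
    rw [E.diff_mul, map_mul]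
    exact ⟨add_mem (TwoSidedIdeal.mul_mem_right _ _ _ ih.1)
      (TwoSidedIdeal.mul_mem_right _ _ _ ih.2), TwoSidedIdeal.mul_mem_right _ _ _ ih.2⟩

/-- The differential `∂` on the Orlik–Solomon algebra, induced by the one on `E(𝒜)`. -/
def OS.diff : OS 𝒜 →+ OS 𝒜 :=
  QuotientAddGroup.map (osIdeal 𝒜).toAddSubgroup (osIdeal 𝒜).toAddSubgroup
    (E.diff 𝒜).toAddMonoidHom (fun _ hx => diff_mem_osIdeal 𝒜 hx)

theorem OS.diff_mk (x : E 𝒜) :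
    OS.diff 𝒜 (Ideal.Quotient.mk (osIdeal 𝒜) x) = Ideal.Quotient.mk (osIdeal 𝒜) (E.diff 𝒜 x) :=
  rfl

/-- The class of the generator `e_A` in the Orlik–Solomon algebra. -/
def OS.gen (A : 𝒜) : OS 𝒜 :=
  Ideal.Quotient.mk (osIdeal 𝒜) (ExteriorAlgebra.ι ℤ (Finsupp.single A (1 : ℤ)))

/-- The grading of `O_{×3}(𝒜)`, with the generators `e_A` in degree `3`: the part of degree `3 k`
is the image of `⋀ᵏ`, and the parts of degree not divisible by `3` vanish. -/
def OS.degreePart (n : ℕ) : AddSubgroup (OS 𝒜) :=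
  ⨆ (k : ℕ) (_ : 3 * k = n),
    (⋀[ℤ]^k (𝒜 →₀ ℤ)).toAddSubgroup.map (Ideal.Quotient.mk (osIdeal 𝒜)).toAddMonoidHom

end Algebra

section Topology

variable {V : Type u} [AddCommGroup V] [Module ℍ[ℝ] V]

/-- The complement `X = V \ ⋃ A` of the arrangement. -/
abbrev HyperplaneComplement (𝒜 : Finset (Submodule ℍ[ℝ] V)) : Type u :=
  {v : V // ∀ A ∈ 𝒜, v ∉ A}

variable [TopologicalSpace V] (𝒜 : Finset (Submodule ℍ[ℝ] V))

/-- The action `ρ : ℍˣ × X → X` by scalar multiplication. -/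
def action [ContinuousSMul ℍ[ℝ] V] : C(ℍ[ℝ]ˣ × HyperplaneComplement 𝒜, HyperplaneComplement 𝒜) where
  toFun p := ⟨(p.1 : ℍ[ℝ]) • (p.2 : V), fun A hA h =>
    p.2.2 A hA ((Submodule.smul_mem_iff A p.1.ne_zero).1 h)⟩
  continuous_toFun := by
    refine Continuous.subtype_mk ?_ _
    exact (Units.continuous_val.comp continuous_fst).smul (continuous_subtype_val.comp continuous_snd)

/-- An `ℍ`-linear form on a finitely generated Hausdorff topological `ℍ`-module is continuous. -/
theorem continuous_form [IsTopologicalAddGroup V] [ContinuousSMul ℍ[ℝ] V] [T2Space V]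
    [Module.Finite ℍ[ℝ] V] (a : V →ₗ[ℍ[ℝ]] ℍ[ℝ]) : Continuous a := by
  let _ : Module ℝ V := Module.compHom V (algebraMap ℝ ℍ[ℝ])
  have : IsScalarTower ℝ ℍ[ℝ] V := ⟨fun r q v => by
    show (r • q) • v = (algebraMap ℝ ℍ[ℝ] r) • q • v
    rw [Algebra.smul_def, mul_smul]⟩
  have : ContinuousSMul ℝ V := ⟨by
    show Continuous fun p : ℝ × V => (algebraMap ℝ ℍ[ℝ] p.1) • p.2
    exact ((continuous_algebraMap ℝ ℍ[ℝ]).comp continuous_fst).smul continuous_snd⟩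
  have : Module.Finite ℝ V := Module.Finite.trans ℍ[ℝ] V
  exact (a.restrictScalars ℝ).continuous_of_finiteDimensional

/-- The map `X → ℍˣ` obtained by restricting a linear form whose kernel belongs to `𝒜`. -/
def formMap [IsTopologicalAddGroup V] [ContinuousSMul ℍ[ℝ] V] [T2Space V]
    [Module.Finite ℍ[ℝ] V] (a : V →ₗ[ℍ[ℝ]] ℍ[ℝ]) (ha : LinearMap.ker a ∈ 𝒜) :
    C(HyperplaneComplement 𝒜, ℍ[ℝ]ˣ) where
  toFun x := Units.mk0 (a x) (fun h => x.2 _ ha (LinearMap.mem_ker.2 h))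
  continuous_toFun := by
    rw [Units.isEmbedding_val₀.continuous_iff]
    exact (continuous_form a).comp continuous_subtype_val

/-- `s` is a generator of the infinite cyclic group `H³(ℍˣ)`. -/
def IsGenerator (s : Cohomology ℍ[ℝ]ˣ 3) : Prop :=
  Function.Bijective (fun n : ℤ => n • s)

/-- The defining equation `ρ^*(x) = 1 ⊗ x + s ⊗ D x` of the differential `D` on `H^•(X)` given by
the action of `ℍˣ`; here `y ⊗ z` stands for the cross product `pr₁^* y ⌣ pr₂^* z` in
`H^•(ℍˣ × X)`. -/
def IsActionDifferential [ContinuousSMul ℍ[ℝ] V] (s : Cohomology ℍ[ℝ]ˣ 3)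
    (D : CohomologyRing (HyperplaneComplement 𝒜) →+ CohomologyRing (HyperplaneComplement 𝒜)) : Prop :=
  ∀ x : CohomologyRing (HyperplaneComplement 𝒜),
    pull (action 𝒜) x =
      pull (ContinuousMap.snd : C(ℍ[ℝ]ˣ × HyperplaneComplement 𝒜, HyperplaneComplement 𝒜)) x +
      pull (ContinuousMap.fst : C(ℍ[ℝ]ˣ × HyperplaneComplement 𝒜, ℍ[ℝ]ˣ))
          (DirectSum.of (Cohomology ℍ[ℝ]ˣ) 3 s) *
        pull (ContinuousMap.snd : C(ℍ[ℝ]ˣ × HyperplaneComplement 𝒜, HyperplaneComplement 𝒜)) (D x)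

end Topology

end QuaternionicArrangement
end

open SingularCohomology QuaternionicArrangement

/-! The proof is deletion–restriction. Remove a hyperplane `H` from `𝒜` to get `𝒜'`, and let `X`,
`X'`, `X''` be the complements of `𝒜`, of `𝒜'`, and of the trace of `𝒜'` on `H`. Then `X'` is the
union of the open set `X` and a tube `ℍ × X''` around `X''`, and these meet in `ℍˣ × X''`.
Mayer–Vietoris for this cover, with the fact that `H^•(ℍˣ × Y)` is free over `H^•(Y)` on `1` and `s`
(`IsSphereClass`), drives an induction on the number of hyperplanes that treats all spaces `V` at
once (`isPresentation`).

Everything about `s` comes from two facts: `s² = 0`, and `s` is primitive for the multiplication of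
`ℍˣ` (`pull_unitsMul`). Hence `f ↦ f^* s` turns products of maps `X → ℍˣ` into sums. Rescaling a
form by a constant does not change its class, and `(f^* s + g^* s)² = 0` makes the classes
anticommute, so the exterior algebra maps to `H^•(X)`.

The Orlik–Solomon relations hold because a dependency among the forms gives units `y_j` with sum
zero. The class of `y_j` minus that of `y_i` is the class of `y_i⁻¹ y_j`, which dies on the open set
where this quotient has negative real part. Since the quotients with `j ≠ i` add up to `-1`, these
sets cover `X`, and a product of classes that die on the members of an open cover is zero. The
factor `∏ (e_j - e_i)` divides the relation `∂(e_1 ⋯ e_r)`.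

Induction step. On `ℍˣ × X''` the class `e_H` becomes `s × 1`, while classes from `X'` have no `s`
component. Surjectivity: subtract `e_H z` to remove the `s` component; what is left extends over the
tube, so it comes from `X'`. Injectivity of `H^•(X') → H^•(X)`: the connecting map vanishes, since
`1 × y` extends to the tube and, by surjectivity for `X''`, `s × z` extends to `X`. Kernel: if `y +
e_H z` maps to zero, then `z` restricts to a relation on `H`. For each such relation `e_H z` is
congruent to an element of `E(𝒜')` modulo the ideal (`liftable_of_map_mem`), which reduces the
question to `𝒜'`.

The differential on cohomology is `∂` transported through the isomorphism. It satisfies the defining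
equation because `a(qx) = q a(x)` gives `ρ^* e_A = 1 × e_A + s × 1`, and both sides of the equation
then agree on products of generators. Graded commutativity of `H^•(X)` is inherited from the
exterior algebra; conversely, directness of the grading of the Orlik–Solomon algebra is inherited
from cohomology. -/

noncomputable section

namespace SingularCohomology

universe u v w

/-! ### Ordered tuple chains and the cone construction -/

/-- Integral chains on the `(n + 1)`-tuples of points of `E`. -/
abbrev TupleChain (E : Type u) (n : ℕ) : Type u := (Fin (n + 1) → E) →₀ ℤ

namespace TupleChain

variable {E : Type u} {F : Type v}

/-- The linear map on tuple chains with prescribed values on tuples. -/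
def lift {n : ℕ} {M : Type*} [AddCommGroup M] (f : (Fin (n + 1) → E) → M) :
    TupleChain E n →ₗ[ℤ] M :=
  Finsupp.linearCombination ℤ f

/-- The chain of a single tuple. -/
def of {n : ℕ} (v : Fin (n + 1) → E) : TupleChain E n := Finsupp.single v 1

@[simp]
theorem lift_of {n : ℕ} {M : Type*} [AddCommGroup M] (f : (Fin (n + 1) → E) → M)
    (v : Fin (n + 1) → E) : lift f (of v) = f v := by
  simp [lift, of]

theorem hom_ext {n : ℕ} {M : Type*} [AddCommGroup M] {f g : TupleChain E n →ₗ[ℤ] M}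
    (h : ∀ v, f (of v) = g (of v)) : f = g :=
  Finsupp.lhom_ext' fun v => LinearMap.ext_ring (h v)

/-- The boundary of tuple chains. -/
def bd (E : Type u) (n : ℕ) : TupleChain E (n + 1) →ₗ[ℤ] TupleChain E n :=
  lift fun v => ∑ i ∈ Finset.range (n + 2), (-1 : ℤ) ^ i • of (v ∘ faceMap n i)

theorem bd_of {n : ℕ} (v : Fin (n + 2) → E) :
    bd E n (of v) = ∑ i ∈ Finset.range (n + 2), (-1 : ℤ) ^ i • of (v ∘ faceMap n i) :=
  lift_of _ _

/-- The chain map induced by a map of points. -/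
def map (φ : E → F) (n : ℕ) : TupleChain E n →ₗ[ℤ] TupleChain F n :=
  lift fun v => of (φ ∘ v)

@[simp]
theorem map_of (φ : E → F) {n : ℕ} (v : Fin (n + 1) → E) : map φ n (of v) = of (φ ∘ v) :=
  lift_of _ _

theorem bd_map (φ : E → F) {n : ℕ} (c : TupleChain E (n + 1)) :
    bd F n (map φ (n + 1) c) = map φ n (bd E n c) := by
  refine LinearMap.congr_fun (f := bd F n ∘ₗ map φ (n + 1)) (g := map φ n ∘ₗ bd E n) ?_ c
  refine hom_ext fun v => ?_
  simp [bd_of, Function.comp_assoc]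

theorem faceMap_comp_faceMap {n i j : ℕ} (hij : j < i) :
    (faceMap (n + 1) i).comp (faceMap n j) = (faceMap (n + 1) j).comp (faceMap n (i - 1)) := by
  ext k
  simp only [OrderHom.comp_coe, Function.comp_apply, faceMap_val]
  grind

theorem bd_bd {n : ℕ} (c : TupleChain E (n + 2)) : bd E n (bd E (n + 1) c) = 0 := by
  refine LinearMap.congr_fun (f := bd E n ∘ₗ bd E (n + 1)) (g := 0) (hom_ext fun v => ?_) c
  have key : ∀ i j : ℕ, j < i → (v ∘ faceMap (n + 1) i) ∘ faceMap n j =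
      (v ∘ faceMap (n + 1) j) ∘ faceMap n (i - 1) := by
    intro i j hij
    have := congrArg DFunLike.coe (faceMap_comp_faceMap (n := n) hij)
    simp only [OrderHom.comp_coe] at this
    rw [Function.comp_assoc, this, Function.comp_assoc]
  simp only [LinearMap.comp_apply, LinearMap.zero_apply, bd_of, map_sum, map_smul, Finset.smul_sum,
    smul_smul]
  rw [← Finset.sum_product']
  refine Finset.sum_involution
    (fun x _ => if x.2 < x.1 then (x.2, x.1 - 1) else (x.2 + 1, x.1)) ?_ ?_ ?_ ?_
  · rintro ⟨i, j⟩ _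
    by_cases h : j < i
    · obtain ⟨i, rfl⟩ : ∃ m, i = m + 1 := ⟨i - 1, by omega⟩
      simp only [h, if_true, key _ _ h, Nat.add_sub_cancel, ← add_smul]
      convert zero_smul ℤ _
      ring
    · simp only [h, if_false, key (j + 1) i (by omega), Nat.add_sub_cancel, ← add_smul]
      convert zero_smul ℤ _
      ring
  · rintro ⟨i, j⟩ _ _ h
    split_ifs at h <;> simp only [Prod.mk.injEq] at h <;> omega
  · rintro ⟨i, j⟩ hx
    simp only [Finset.mem_product, Finset.mem_range] at hx ⊢
    split_ifs <;> dsimp only <;> omega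
  · rintro ⟨i, j⟩ _
    dsimp only
    by_cases h : j < i
    · have h' : ¬ i - 1 < j := by omega
      rw [if_pos h, if_neg h', Nat.sub_add_cancel (by omega)]
    · have h' : i < j + 1 := by omega
      rw [if_neg h, if_pos h', Nat.add_sub_cancel]

/-- The cone on a chain with a given apex. -/
def cone (b : E) (n : ℕ) : TupleChain E n →ₗ[ℤ] TupleChain E (n + 1) :=
  lift fun v => of (Fin.cons b v : Fin (n + 2) → E)

@[simp]
theorem cone_of (b : E) {n : ℕ} (v : Fin (n + 1) → E) :
    cone b n (of v) = of (Fin.cons b v : Fin (n + 2) → E) := lift_of _ _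

theorem map_cone (φ : E → F) (b : E) {n : ℕ} (c : TupleChain E n) :
    map φ (n + 1) (cone b n c) = cone (φ b) n (map φ n c) := by
  refine LinearMap.congr_fun (f := map φ (n + 1) ∘ₗ cone b n) (g := cone (φ b) n ∘ₗ map φ n)
    (hom_ext fun v => ?_) c
  simp only [LinearMap.comp_apply, cone_of, map_of]
  congr 1
  ext k
  refine Fin.cases ?_ (fun k => ?_) k <;> simp

theorem cons_comp_faceMap_zero (b : E) {n : ℕ} (v : Fin (n + 1) → E) :
    (Fin.cons b v : Fin (n + 2) → E) ∘ faceMap n 0 = v := by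
  ext k
  have : faceMap n 0 k = k.succ := by
    ext; simp [faceMap_val]
  simp [this]

theorem cons_comp_faceMap_succ (b : E) {n : ℕ} (v : Fin (n + 2) → E) (i : ℕ) :
    (Fin.cons b v : Fin (n + 3) → E) ∘ faceMap (n + 1) (i + 1) =
      (Fin.cons b (v ∘ faceMap n i) : Fin (n + 2) → E) := by
  ext k
  refine Fin.cases ?_ (fun k => ?_) k
  · have : faceMap (n + 1) (i + 1) 0 = 0 := by
      ext; simp [faceMap_val]
    simp [this]
  · have : faceMap (n + 1) (i + 1) k.succ = (faceMap n i k).succ := by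
      ext
      simp only [faceMap_val, Fin.val_succ]
      split_ifs <;> omega
    simp [this]

/-- The one geometric identity behind subdivision and the prism: a cycle of positive degree is the
boundary of its cone. Degree zero needs the augmentation instead, as in `bd_cone_zero`. -/
theorem bd_cone (b : E) {n : ℕ} (c : TupleChain E (n + 1)) :
    bd E (n + 1) (cone b (n + 1) c) = c - cone b n (bd E n c) := by
  refine LinearMap.congr_fun (f := bd E (n + 1) ∘ₗ cone b (n + 1))
    (g := LinearMap.id - cone b n ∘ₗ bd E n) (hom_ext fun v => ?_) c
  simp only [LinearMap.comp_apply, cone_of, bd_of, LinearMap.sub_apply, LinearMap.id_apply,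
    map_sum, map_smul]
  rw [Finset.sum_range_succ', cons_comp_faceMap_zero]
  simp only [cons_comp_faceMap_succ, pow_succ, mul_neg, mul_one, neg_smul, Finset.sum_neg_distrib,
    pow_zero, one_smul]
  abel

/-- The augmentation of `0`-chains. -/
def aug (E : Type u) : TupleChain E 0 →ₗ[ℤ] ℤ := lift fun _ => 1

@[simp]
theorem aug_of (v : Fin 1 → E) : aug E (of v) = 1 := lift_of _ _

theorem aug_bd (c : TupleChain E 1) : aug E (bd E 0 c) = 0 := by
  refine LinearMap.congr_fun (f := aug E ∘ₗ bd E 0) (g := 0) (hom_ext fun v => ?_) c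
  simp [bd_of, Finset.sum_range_succ]

theorem bd_cone_zero (b : E) (c : TupleChain E 0) :
    bd E 0 (cone b 0 c) = c - aug E c • of (fun _ => b) := by
  refine LinearMap.congr_fun (f := bd E 0 ∘ₗ cone b 0)
    (g := LinearMap.id - (aug E).smulRight (of fun _ => b)) (hom_ext fun v => ?_) c
  simp only [LinearMap.comp_apply, cone_of, bd_of, LinearMap.sub_apply, LinearMap.id_apply,
    Finset.sum_range_succ, Finset.sum_range_zero, cons_comp_faceMap_zero, zero_add,
    LinearMap.smulRight_apply, aug_of]
  have : (Fin.cons b v : Fin 2 → E) ∘ faceMap 0 1 = fun _ => b := by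
    ext k
    have h0 : faceMap 0 1 k = 0 := by
      ext; simp [faceMap_val]
    simp [h0]
  simp [this, sub_eq_add_neg]

/-- The homotopy that contracts a chain map `Φ` by cones with apices `c`. -/
def coneHomotopy (c : ∀ n, (Fin (n + 1) → E) → F) (Φ : ∀ n, TupleChain E n →ₗ[ℤ] TupleChain F n) :
    ∀ n, TupleChain E n →ₗ[ℤ] TupleChain F (n + 1)
  | 0 => lift fun v => cone (c 0 v) 0 (Φ 0 (of v))
  | n + 1 => lift fun v => cone (c (n + 1) v) (n + 1)
      (Φ (n + 1) (of v) - coneHomotopy c Φ n (bd E n (of v)))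

section Homotopy

variable (c : ∀ n, (Fin (n + 1) → E) → F) (Φ : ∀ n, TupleChain E n →ₗ[ℤ] TupleChain F n)

theorem bd_coneHomotopy_zero (hε : ∀ x, aug F (Φ 0 x) = 0) (x : TupleChain E 0) :
    bd F 0 (coneHomotopy c Φ 0 x) = Φ 0 x := by
  refine LinearMap.congr_fun (f := bd F 0 ∘ₗ coneHomotopy c Φ 0) (hom_ext fun v => ?_) x
  simp [coneHomotopy, bd_cone_zero, hε]

/-- Acyclic models in explicit form: the recursion cones off `Φ v - h(∂v)`, which is a cycle once
the identity is known one degree lower. Subdivision and the prism are both instances. -/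
theorem bd_coneHomotopy (hε : ∀ x, aug F (Φ 0 x) = 0)
    (hΦ : ∀ n x, bd F n (Φ (n + 1) x) = Φ n (bd E n x)) (n : ℕ) (x : TupleChain E (n + 1)) :
    bd F (n + 1) (coneHomotopy c Φ (n + 1) x) + coneHomotopy c Φ n (bd E n x) =
      Φ (n + 1) x := by
  suffices h : ∀ v, bd F (n + 1) (coneHomotopy c Φ (n + 1) (of v)) +
      coneHomotopy c Φ n (bd E n (of v)) = Φ (n + 1) (of v) from
    LinearMap.congr_fun (f := bd F (n + 1) ∘ₗ coneHomotopy c Φ (n + 1) +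
      coneHomotopy c Φ n ∘ₗ bd E n) (hom_ext h) x
  intro v
  rw [coneHomotopy, lift_of, bd_cone, map_sub, hΦ]
  -- The identity one degree lower, applied to `∂v` with `∂∂v = 0`. It makes the coned chain a
  -- cycle, so the correction term of `bd_cone` vanishes.
  have h0 : bd F n (coneHomotopy c Φ n (bd E n (of v))) = Φ n (bd E n (of v)) := by
    cases n with
    | zero => exact bd_coneHomotopy_zero c Φ hε _
    | succ n =>
      have := bd_coneHomotopy hε hΦ n (bd E (n + 1) (of v))
      rwa [bd_bd, map_zero, add_zero] at this
  rw [h0, sub_self, map_zero, sub_zero, sub_add_cancel]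

end Homotopy

/-- Cones are natural, so only the apices and `Φ` have to be compatible with the maps of points.
This is what lets the homotopies on a simplex restrict to those on its faces. -/
theorem map_coneHomotopy {E' : Type*} {F' : Type*} (φ : E → E') (ψ : F → F')
    {c : ∀ n, (Fin (n + 1) → E) → F} {Φ : ∀ n, TupleChain E n →ₗ[ℤ] TupleChain F n}
    {c' : ∀ n, (Fin (n + 1) → E') → F'} {Φ' : ∀ n, TupleChain E' n →ₗ[ℤ] TupleChain F' n}
    (hc : ∀ n v, ψ (c n v) = c' n (φ ∘ v))
    (hΦ : ∀ n x, map ψ n (Φ n x) = Φ' n (map φ n x)) (n : ℕ) (x : TupleChain E n) :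
    map ψ (n + 1) (coneHomotopy c Φ n x) = coneHomotopy c' Φ' n (map φ n x) := by
  induction n with
  | zero =>
    refine LinearMap.congr_fun (f := map ψ 1 ∘ₗ coneHomotopy c Φ 0)
      (g := coneHomotopy c' Φ' 0 ∘ₗ map φ 0) (hom_ext fun v => ?_) x
    simp [coneHomotopy, map_cone, hc, hΦ]
  | succ n ih =>
    refine LinearMap.congr_fun (f := map ψ (n + 2) ∘ₗ coneHomotopy c Φ (n + 1))
      (g := coneHomotopy c' Φ' (n + 1) ∘ₗ map φ (n + 1)) (hom_ext fun v => ?_) x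
    simp only [LinearMap.comp_apply, coneHomotopy, lift_of, map_of, map_cone, hc, map_sub, hΦ, ih,
      ← bd_map]

/-- The subdivision operator defined by a choice of a centre for each tuple. -/
def subdiv (b : ∀ n, (Fin (n + 1) → E) → E) : ∀ n, TupleChain E n →ₗ[ℤ] TupleChain E n
  | 0 => LinearMap.id
  | n + 1 => lift fun v => cone (b (n + 1) v) n (subdiv b n (bd E n (of v)))

theorem bd_subdiv (b : ∀ n, (Fin (n + 1) → E) → E) (n : ℕ) (x : TupleChain E (n + 1)) :
    bd E n (subdiv b (n + 1) x) = subdiv b n (bd E n x) := by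
  refine LinearMap.congr_fun (f := bd E n ∘ₗ subdiv b (n + 1))
    (g := subdiv b n ∘ₗ bd E n) (hom_ext fun v => ?_) x
  simp only [LinearMap.comp_apply, subdiv, lift_of]
  cases n with
  | zero => simp [bd_cone_zero, subdiv, aug_bd]
  | succ n => rw [bd_cone, bd_subdiv b n, bd_bd, map_zero, map_zero, sub_zero]

theorem map_subdiv (φ : E → F) {b : ∀ n, (Fin (n + 1) → E) → E}
    {b' : ∀ n, (Fin (n + 1) → F) → F} (hb : ∀ n v, φ (b n v) = b' n (φ ∘ v)) (n : ℕ)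
    (x : TupleChain E n) : map φ n (subdiv b n x) = subdiv b' n (map φ n x) := by
  induction n with
  | zero => rfl
  | succ n ih =>
    refine LinearMap.congr_fun (f := map φ (n + 1) ∘ₗ subdiv b (n + 1))
      (g := subdiv b' (n + 1) ∘ₗ map φ (n + 1)) (hom_ext fun v => ?_) x
    simp only [LinearMap.comp_apply, subdiv, lift_of, map_of, map_cone, hb, ih, ← bd_map]

/-- The homotopy from the identity to the subdivision operator. -/
def subdivHomotopy (b : ∀ n, (Fin (n + 1) → E) → E) :
    ∀ n, TupleChain E n →ₗ[ℤ] TupleChain E (n + 1) :=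
  coneHomotopy b fun n => LinearMap.id - subdiv b n

theorem bd_subdivHomotopy (b : ∀ n, (Fin (n + 1) → E) → E) (n : ℕ) (x : TupleChain E (n + 1)) :
    bd E (n + 1) (subdivHomotopy b (n + 1) x) + subdivHomotopy b n (bd E n x) =
      x - subdiv b (n + 1) x :=
  bd_coneHomotopy b (fun n => LinearMap.id - subdiv b n) (fun x => by simp [subdiv])
    (fun n x => by simp [bd_subdiv]) n x

theorem map_subdivHomotopy (φ : E → F) {b : ∀ n, (Fin (n + 1) → E) → E}
    {b' : ∀ n, (Fin (n + 1) → F) → F} (hb : ∀ n v, φ (b n v) = b' n (φ ∘ v)) (n : ℕ)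
    (x : TupleChain E n) :
    map φ (n + 1) (subdivHomotopy b n x) = subdivHomotopy b' n (map φ n x) :=
  map_coneHomotopy φ φ hb (fun n x => by simp [map_subdiv φ hb]) n x

/-- The prism operator, a homotopy between the inclusions of the bottom and top of `E × [0, 1]`. -/
def prism (E : Type u) : ∀ n, TupleChain E n →ₗ[ℤ] TupleChain (unitInterval × E) (n + 1) :=
  -- With its apex on the bottom face over the first vertex, the operator is natural for all maps of
  -- points, not only for affine ones.
  coneHomotopy (fun _ v => (0, v 0)) fun n => map (Prod.mk 1) n - map (Prod.mk 0) n

theorem bd_prism_zero (x : TupleChain E 0) :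
    bd _ 0 (prism E 0 x) = map (Prod.mk 1) 0 x - map (Prod.mk 0) 0 x := by
  refine bd_coneHomotopy_zero _ _ (fun x => ?_) x
  refine LinearMap.congr_fun (f := aug (unitInterval × E) ∘ₗ (map (Prod.mk 1) 0 - map (Prod.mk 0) 0))
    (g := 0) (hom_ext fun v => ?_) x
  simp

theorem bd_prism (n : ℕ) (x : TupleChain E (n + 1)) :
    bd _ (n + 1) (prism E (n + 1) x) + prism E n (bd E n x) =
      map (Prod.mk 1) (n + 1) x - map (Prod.mk 0) (n + 1) x := by
  refine bd_coneHomotopy _ (fun n => map (Prod.mk 1) n - map (Prod.mk 0) n) (fun x => ?_)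
    (fun n x => by simp [bd_map]) n x
  refine LinearMap.congr_fun (f := aug (unitInterval × E) ∘ₗ (map (Prod.mk 1) 0 - map (Prod.mk 0) 0))
    (g := 0) (hom_ext fun v => ?_) x
  simp

theorem map_prism (φ : E → F) (n : ℕ) (x : TupleChain E n) :
    map (Prod.map id φ) (n + 1) (prism E n x) = prism F n (map φ n x) := by
  have h : ∀ (t : unitInterval) (n : ℕ) (x : TupleChain E n),
      map (Prod.map id φ) n (map (Prod.mk t) n x) = map (Prod.mk t) n (map φ n x) := by
    intro t n x
    refine LinearMap.congr_fun (f := map (Prod.map id φ) n ∘ₗ map (Prod.mk t) n)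
      (g := map (Prod.mk t) n ∘ₗ map φ n) (hom_ext fun v => ?_) x
    simp [Function.comp_def]
  exact map_coneHomotopy φ (Prod.map id φ) (fun n v => rfl) (fun n x => by simp [h]) n x

end TupleChain

end SingularCohomology
end

noncomputable section

namespace SingularCohomology

universe u v w

/-! ### Affine singular simplices -/

/-- The standard `n`-simplex. -/
abbrev Std (n : ℕ) : Type := stdSimplex ℝ (Fin (n + 1))

/-- A space with a functorial notion of affine simplices with given vertices. -/
class AffineSimplices (E : Type u) [TopologicalSpace E] where
  aff : ∀ {n : ℕ}, (Fin (n + 1) → E) → Simplex E n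
  aff_precomp : ∀ {m n : ℕ} (w : Fin (n + 1) → E) (θ : Fin (m + 1) →o Fin (n + 1)),
    (aff w).precomp θ = aff (w ∘ θ)

open AffineSimplices

/-- The affine simplex with given vertices in a convex set. -/
def affOfConvex {W : Type u} [AddCommGroup W] [Module ℝ W] [TopologicalSpace W] [ContinuousAdd W]
    [ContinuousSMul ℝ W] {K : Set W} (hK : Convex ℝ K) {n : ℕ} (w : Fin (n + 1) → K) :
    Simplex K n where
  toFun t := ⟨∑ i, t i • (w i : W), hK.sum_mem (fun i _ => t.2.1 i) t.2.2 fun i _ => (w i).2⟩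
  continuous_toFun := by
    refine Continuous.subtype_mk (continuous_finsetSum _ fun i _ => Continuous.smul ?_ continuous_const) _
    exact (continuous_apply i).comp continuous_subtype_val

theorem sum_map_smul {W : Type u} [AddCommGroup W] [Module ℝ W] {m n : ℕ}
    (θ : Fin (m + 1) → Fin (n + 1)) (t : Std m) (w : Fin (n + 1) → W) :
    ∑ j, (stdSimplex.map θ t) j • w j = ∑ i, t i • w (θ i) := by
  simp only [stdSimplex.map_coe, FunOnFinite.linearMap_apply_apply, Finset.sum_smul]
  rw [← Finset.sum_fiberwise Finset.univ θ]
  refine Finset.sum_congr rfl fun j _ => ?_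
  refine Finset.sum_congr (by ext; simp) fun i hi => ?_
  simp only [Finset.mem_filter, Finset.mem_univ, true_and] at hi
  rw [hi]

/-- The affine simplices of a convex set. -/
abbrev affineSimplicesOfConvex {W : Type u} [AddCommGroup W] [Module ℝ W] [TopologicalSpace W]
    [ContinuousAdd W] [ContinuousSMul ℝ W] {K : Set W} (hK : Convex ℝ K) : AffineSimplices K where
  aff := affOfConvex hK
  aff_precomp w θ := by
    ext t
    exact sum_map_smul θ t fun i => (w i : W)

instance (m : ℕ) : AffineSimplices (Std m) :=
  affineSimplicesOfConvex (convex_stdSimplex ℝ (Fin (m + 1)))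

instance : AffineSimplices unitInterval :=
  affineSimplicesOfConvex (convex_Icc (0 : ℝ) 1)

instance {E : Type u} {F : Type v} [TopologicalSpace E] [TopologicalSpace F] [AffineSimplices E]
    [AffineSimplices F] : AffineSimplices (E × F) where
  aff w := (aff (Prod.fst ∘ w)).prodMk (aff (Prod.snd ∘ w))
  aff_precomp w θ := by
    have h1 := aff_precomp (Prod.fst ∘ w) θ
    have h2 := aff_precomp (Prod.snd ∘ w) θ
    ext t
    · exact congrArg (fun f => f t) h1
    · exact congrArg (fun f => f t) h2

theorem aff_std_apply {m n : ℕ} (w : Fin (n + 1) → Std m) (t : Std n) :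
    (aff w t : Fin (m + 1) → ℝ) = ∑ i, t i • (w i : Fin (m + 1) → ℝ) := rfl

theorem aff_unitInterval_apply {n : ℕ} (w : Fin (n + 1) → unitInterval) (t : Std n) :
    (aff w t : ℝ) = ∑ i, t i • (w i : ℝ) := rfl

theorem aff_const_unitInterval {n : ℕ} (r : unitInterval) (t : Std n) :
    aff (fun _ : Fin (n + 1) => r) t = r := by
  ext
  rw [aff_unitInterval_apply, ← Finset.sum_smul]
  erw [t.2.2]
  simp

/-- The vertices of the standard simplex. -/
def vtx (n : ℕ) : Fin (n + 1) → Std n := fun i => stdSimplex.vertex i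

theorem aff_vtx (n : ℕ) : aff (vtx n) = ContinuousMap.id (Std n) := by
  ext t j
  change (aff (vtx n) t : Fin (n + 1) → ℝ) j = _
  rw [aff_std_apply, Finset.sum_apply]
  simp only [Pi.smul_apply, smul_eq_mul, vtx]
  rw [Finset.sum_eq_single j]
  · change t j * (Pi.single j (1 : ℝ) : Fin (n + 1) → ℝ) j = _
    simp
  · intro i _ hij
    change t i * (Pi.single i (1 : ℝ) : Fin (n + 1) → ℝ) j = _
    simp [hij.symm]
  · simp

theorem aff_apply_vtx {m n : ℕ} (w : Fin (n + 1) → Std m) (i : Fin (n + 1)) :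
    aff w (vtx n i) = w i := by
  ext j
  change (aff w (vtx n i) : Fin (m + 1) → ℝ) j = _
  rw [aff_std_apply, Finset.sum_eq_single i]
  · change ((Pi.single i (1 : ℝ) : Fin (n + 1) → ℝ) i • (w i : Fin (m + 1) → ℝ)) j = w i j
    simp
  · intro k _ hk
    change ((Pi.single i (1 : ℝ) : Fin (n + 1) → ℝ) k • (w k : Fin (m + 1) → ℝ)) = 0
    simp [hk]
  · simp

theorem aff_comp_aff {l m n : ℕ} (u : Fin (m + 1) → Std l) (w : Fin (n + 1) → Std m) :
    (aff u).comp (aff w) = aff (aff u ∘ w) := by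
  ext t : 2
  change (aff u (aff w t) : Fin (l + 1) → ℝ) = (aff (aff u ∘ w) t : Fin (l + 1) → ℝ)
  rw [aff_std_apply, aff_std_apply]
  simp only [aff_std_apply, Finset.sum_apply, Pi.smul_apply, Function.comp_apply, Finset.sum_smul,
    Finset.smul_sum, smul_smul, smul_eq_mul]
  exact Finset.sum_comm

theorem face_eq_comp_aff {X : Type u} [TopologicalSpace X] {n : ℕ} (σ : Simplex X (n + 1)) (i : ℕ) :
    σ.face i = σ.comp (aff (vtx (n + 1) ∘ faceMap n i)) := by
  rw [← aff_precomp, aff_vtx]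
  rfl

/-! ### Evaluation of cochains on tuple chains -/

section Eval

variable {X : Type u} [TopologicalSpace X] {E : Type v} [TopologicalSpace E] [AffineSimplices E]

/-- The value of a cochain on the affine simplices of a space that maps to `X`. -/
def ev (g : C(E, X)) {n : ℕ} (f : Cochain X n) : TupleChain E n →ₗ[ℤ] ℤ :=
  TupleChain.lift fun w => f (g.comp (aff w))

theorem ev_of (g : C(E, X)) {n : ℕ} (f : Cochain X n) (w : Fin (n + 1) → E) :
    ev g f (TupleChain.of w) = f (g.comp (aff w)) := TupleChain.lift_of _ _

/-- This transfers identities between tuple chains to cochains, so the homotopy formulas never have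
to be stated for singular chains. -/
theorem ev_d (g : C(E, X)) {n : ℕ} (f : Cochain X n) (x : TupleChain E (n + 1)) :
    ev g (d X n f) x = ev g f (TupleChain.bd E n x) := by
  refine LinearMap.congr_fun (g := ev g f ∘ₗ TupleChain.bd E n)
    (TupleChain.hom_ext fun v => ?_) x
  simp only [LinearMap.comp_apply, ev_of, TupleChain.bd_of, map_sum, map_smul, d_apply,
    ← aff_precomp, smul_eq_mul]
  rfl

theorem ev_zero (g : C(E, X)) {n : ℕ} (x : TupleChain E n) : ev g (0 : Cochain X n) x = 0 := by
  refine LinearMap.congr_fun (g := 0) (TupleChain.hom_ext fun v => ?_) x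
  simp [ev_of]

theorem ev_comp {F : Type w} [TopologicalSpace F] [AffineSimplices F] (g : C(F, X)) (φ : C(E, F))
    (hφ : ∀ {n : ℕ} (w : Fin (n + 1) → E), φ.comp (aff w) = aff (φ ∘ w)) {n : ℕ}
    (f : Cochain X n) (x : TupleChain E n) :
    ev (g.comp φ) f x = ev g f (TupleChain.map φ n x) := by
  refine LinearMap.congr_fun (g := ev g f ∘ₗ TupleChain.map φ n)
    (TupleChain.hom_ext fun v => ?_) x
  simp only [LinearMap.comp_apply, ev_of, TupleChain.map_of, ContinuousMap.comp_assoc, hφ]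

end Eval

/-! ### Barycentric subdivision and small simplices -/

section Small

variable {X : Type u} [TopologicalSpace X]

/-- The barycentre of the affine simplex with given vertices. -/
def bary (m n : ℕ) (w : Fin (n + 1) → Std m) : Std m := aff w stdSimplex.barycenter

theorem aff_bary {l m : ℕ} (u : Fin (m + 1) → Std l) (n : ℕ) (w : Fin (n + 1) → Std m) :
    aff u (bary m n w) = bary l n (aff u ∘ w) := by
  rw [bary, bary, ← aff_comp_aff]
  rfl

theorem ev_comp_aff {m k n : ℕ} (σ : Simplex X m) (w : Fin (k + 1) → Std m) (f : Cochain X n)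
    (x : TupleChain (Std k) n) :
    ev (σ.comp (aff w)) f x = ev σ f (TupleChain.map (aff w) n x) :=
  ev_comp σ (aff w) (fun u => aff_comp_aff w u) f x

theorem ev_vtx {n : ℕ} (σ : Simplex X n) (f : Cochain X n) :
    ev σ f (TupleChain.of (vtx n)) = f σ := by
  rw [ev_of, aff_vtx, ContinuousMap.comp_id]

/-- A singular simplex is small for a family of sets if it is contained in one of them. -/
def IsSmall {ι : Type*} (U : ι → Set X) {n : ℕ} (σ : Simplex X n) : Prop :=
  ∃ i, ∀ t, σ t ∈ U i

theorem ev_eq_zero_of_small {ι : Type*} {U : ι → Set X} {E : Type v} [TopologicalSpace E]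
    [AffineSimplices E] {g : C(E, X)} (hg : ∃ i, ∀ t, g t ∈ U i) {n : ℕ} {f : Cochain X n}
    (hf : ∀ σ, IsSmall U σ → f σ = 0) (x : TupleChain E n) : ev g f x = 0 := by
  obtain ⟨i, hi⟩ := hg
  refine LinearMap.congr_fun (g := 0) (TupleChain.hom_ext fun v => ?_) x
  rw [ev_of]
  exact hf _ ⟨i, fun t => hi _⟩

theorem lift_mem_of_mem_supported {E : Type v} {n : ℕ} {M : Type*} [AddCommGroup M]
    {s : Set (Fin (n + 1) → E)} {N : Submodule ℤ M} {f : TupleChain E n →ₗ[ℤ] M}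
    (h : ∀ v ∈ s, f (TupleChain.of v) ∈ N) {c : TupleChain E n}
    (hc : c ∈ Finsupp.supported ℤ ℤ s) : f c ∈ N := by
  rw [Finsupp.supported_eq_span_single] at hc
  induction hc using Submodule.span_induction with
  | mem x hx =>
    obtain ⟨v, hv, rfl⟩ := hx
    exact h v hv
  | zero => rw [map_zero]; exact zero_mem _
  | add x y _ _ hx hy => rw [map_add]; exact add_mem hx hy
  | smul a x _ hx => rw [map_smul]; exact N.smul_mem a hx

/-- Tuples of points at distance at most `r` from `x`. -/
def nearTuples {m : ℕ} (x : Std m) (r : ℝ) (n : ℕ) : Set (Fin (n + 1) → Std m) :=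
  {v | ∀ i, dist (v i) x ≤ r}

/-- Tuples of points with mutual distances at most `r`. -/
def meshTuples (m : ℕ) (r : ℝ) (n : ℕ) : Set (Fin (n + 1) → Std m) :=
  {v | ∀ i j, dist (v i) (v j) ≤ r}

theorem of_mem_supported {E : Type v} {n : ℕ} {s : Set (Fin (n + 1) → E)} {v : Fin (n + 1) → E}
    (hv : v ∈ s) : TupleChain.of v ∈ Finsupp.supported ℤ ℤ s :=
  Finsupp.single_mem_supported ℤ 1 hv

theorem bd_mem_supported {E : Type v} {n : ℕ} {s : Set (Fin (n + 1) → E)} {v : Fin (n + 2) → E}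
    (hv : ∀ i, v ∘ faceMap n i ∈ s) :
    TupleChain.bd E n (TupleChain.of v) ∈ Finsupp.supported ℤ ℤ s := by
  rw [TupleChain.bd_of]
  exact Submodule.sum_mem _ fun i _ => Submodule.smul_mem _ _ (of_mem_supported (hv i))

theorem dist_aff_le {m n : ℕ} {x : Std m} {r : ℝ} {v : Fin (n + 1) → Std m}
    (hv : v ∈ nearTuples x r n) (t : Std n) : dist (aff v t) x ≤ r := by
  have h := (convex_closedBall (x : Fin (m + 1) → ℝ) r).sum_mem (t := Finset.univ)
    (w := fun i => t i) (z := fun i => (v i : Fin (m + 1) → ℝ)) (fun i _ => t.2.1 i) t.2.2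
    (fun i _ => hv i)
  exact h

theorem subdiv_mem_near {m : ℕ} {x : Std m} {r : ℝ} (n : ℕ) {c : TupleChain (Std m) n}
    (hc : c ∈ Finsupp.supported ℤ ℤ (nearTuples x r n)) :
    TupleChain.subdiv (bary m) n c ∈ Finsupp.supported ℤ ℤ (nearTuples x r n) := by
  induction n with
  | zero => exact hc
  | succ n ih =>
    refine lift_mem_of_mem_supported (fun v hv => ?_) hc
    rw [TupleChain.subdiv, TupleChain.lift_of]
    refine lift_mem_of_mem_supported (fun u hu => ?_)
      (ih (bd_mem_supported (s := nearTuples x r n) fun i k => hv _))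
    rw [TupleChain.cone_of]
    refine of_mem_supported fun i => ?_
    refine Fin.cases ?_ (fun i => ?_) i
    · exact dist_aff_le hv _
    · exact hu i

/-- `v j` minus the barycentre is the mean of the `n + 1` differences `v j - v i`, and the one with
`i = j` is zero: hence the factor `n / (n + 1)`. -/
theorem dist_bary_le {m n : ℕ} {r : ℝ} {v : Fin (n + 1) → Std m}
    (hv : v ∈ meshTuples m r n) (j : Fin (n + 1)) :
    dist (v j) (bary m n v) ≤ n / (n + 1) * r := by
  have hb : ((bary m n v : Std m) : Fin (m + 1) → ℝ) =
      ∑ i, ((n : ℝ) + 1)⁻¹ • (v i : Fin (m + 1) → ℝ) := by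
    rw [bary, aff_std_apply]
    refine Finset.sum_congr rfl fun i _ => ?_
    congr 1
    change ((Fintype.card (Fin (n + 1)) : ℝ))⁻¹ = _
    rw [Fintype.card_fin]
    push_cast
    rfl
  have hn : (0 : ℝ) < n + 1 := by positivity
  have hv' : ((v j : Std m) : Fin (m + 1) → ℝ) =
      ∑ _i : Fin (n + 1), ((n : ℝ) + 1)⁻¹ • (v j : Fin (m + 1) → ℝ) := by
    rw [Finset.sum_const, Finset.card_univ, Fintype.card_fin, ← Nat.cast_smul_eq_nsmul ℝ, smul_smul]
    push_cast
    rw [mul_inv_cancel₀ hn.ne', one_smul]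
  change dist (v j : Fin (m + 1) → ℝ) (bary m n v : Fin (m + 1) → ℝ) ≤ _
  rw [hb, hv', dist_eq_norm, ← Finset.sum_sub_distrib]
  calc ‖∑ i, (((n : ℝ) + 1)⁻¹ • (v j : Fin (m + 1) → ℝ) - ((n : ℝ) + 1)⁻¹ • (v i : Fin (m + 1) → ℝ))‖
      ≤ ∑ i, ((n : ℝ) + 1)⁻¹ * (if i = j then 0 else r) := by
        refine norm_sum_le_of_le _ fun i _ => ?_
        rw [← smul_sub, norm_smul, Real.norm_of_nonneg (inv_nonneg.2 hn.le), ← dist_eq_norm]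
        refine mul_le_mul_of_nonneg_left ?_ (inv_nonneg.2 hn.le)
        split_ifs with h
        · rw [h, dist_self]
        · exact hv j i
    _ = n / (n + 1) * r := by
        rw [← Finset.mul_sum, Finset.sum_ite, Finset.sum_const_zero, zero_add, Finset.sum_const,
          Finset.filter_ne' , Finset.card_erase_of_mem (Finset.mem_univ _), Finset.card_univ,
          Fintype.card_fin, nsmul_eq_mul]
        simp only [Nat.add_sub_cancel]
        ring

/-- A simplex of the subdivision joins the barycentre to a simplex in the subdivision of a face. The
latter is small by induction, and its vertices stay close to the barycentre because balls are
convex. -/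
theorem subdiv_mem_mesh {m : ℕ} {r : ℝ} (hr : 0 ≤ r) (n : ℕ) {c : TupleChain (Std m) n}
    (hc : c ∈ Finsupp.supported ℤ ℤ (meshTuples m r n)) :
    TupleChain.subdiv (bary m) n c ∈
      Finsupp.supported ℤ ℤ (meshTuples m (n / (n + 1) * r) n) := by
  induction n with
  | zero =>
    refine Finsupp.supported_mono (fun v _ i j => ?_) hc
    rw [Subsingleton.elim (α := Fin 1) i j, dist_self]
    simp
  | succ n ih =>
    refine lift_mem_of_mem_supported (fun v hv => ?_) hc
    rw [TupleChain.subdiv, TupleChain.lift_of]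
    have h1 := ih (bd_mem_supported (s := meshTuples m r n) (v := v) fun i k l => hv _ _)
    have h2 := subdiv_mem_near n (x := bary m (n + 1) v) (bd_mem_supported (v := v)
      (s := nearTuples (bary m (n + 1) v) ((n + 1 : ℕ) / ((n + 1 : ℕ) + 1) * r) n)
      fun i k => dist_bary_le hv _)
    -- The two bounds must hold for the same tuples, so the supports are intersected.
    have h3 := Submodule.mem_inf.2 ⟨h1, h2⟩
    rw [← Finsupp.supported_inter] at h3
    refine lift_mem_of_mem_supported (fun u hu => ?_) h3
    rw [TupleChain.cone_of]
    have hle : (n : ℝ) / (n + 1) * r ≤ (n + 1 : ℕ) / ((n + 1 : ℕ) + 1) * r := by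
      refine mul_le_mul_of_nonneg_right ?_ hr
      rw [div_le_div_iff₀ (by positivity) (by positivity)]
      push_cast
      nlinarith
    refine of_mem_supported fun i j => ?_
    refine Fin.cases ?_ (fun i => ?_) i <;> refine Fin.cases ?_ (fun j => ?_) j
    · simp only [Fin.cons_zero, dist_self]
      positivity
    · simp only [Fin.cons_zero, Fin.cons_succ]
      rw [dist_comm]
      exact hu.2 j
    · simp only [Fin.cons_zero, Fin.cons_succ]
      exact hu.2 i
    · simp only [Fin.cons_succ]
      exact (hu.1 i j).trans hle

/-- The iterated barycentric subdivision of the standard simplex. -/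
def iterSubdiv (n k : ℕ) : TupleChain (Std n) n :=
  (TupleChain.subdiv (bary n) n)^[k] (TupleChain.of (vtx n))

theorem iterSubdiv_succ (n k : ℕ) :
    iterSubdiv n (k + 1) = TupleChain.subdiv (bary n) n (iterSubdiv n k) :=
  Function.iterate_succ_apply' _ _ _

theorem iterSubdiv_mem_mesh (n k : ℕ) :
    iterSubdiv n k ∈ Finsupp.supported ℤ ℤ (meshTuples n (((n : ℝ) / (n + 1)) ^ k) n) := by
  induction k with
  | zero =>
    refine of_mem_supported fun i j => ?_
    rw [pow_zero]
    exact (Metric.dist_le_diam_of_mem (bounded_stdSimplex _) (vtx n i).2 (vtx n j).2).trans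
      diam_stdSimplex_le
  | succ k ih =>
    rw [iterSubdiv_succ, pow_succ']
    exact subdiv_mem_mesh (by positivity) n ih

/-- Lebesgue number of the pulled-back cover of the compact simplex. An affine simplex lies in any
ball around its first vertex that contains all its vertices. -/
theorem exists_isSmall_of_mesh {ι : Type*} {U : ι → Set X} (hU : ∀ i, IsOpen (U i))
    (hcov : ∀ x, ∃ i, x ∈ U i) {n : ℕ} (σ : Simplex X n) :
    ∃ N, ∀ k ≥ N, ∀ w ∈ meshTuples n (((n : ℝ) / (n + 1)) ^ k) n, IsSmall U (σ.comp (aff w)) := by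
  obtain ⟨δ, hδ, h⟩ := lebesgue_number_lemma_of_metric (isCompact_univ (X := Std n))
    (fun i => (hU i).preimage σ.continuous) (fun x _ => Set.mem_iUnion.2 (hcov (σ x)))
  have h0 : (n : ℝ) / (n + 1) < 1 := by
    rw [div_lt_one (by positivity)]
    linarith
  obtain ⟨N, hN⟩ := exists_pow_lt_of_lt_one hδ h0
  refine ⟨N, fun k hk w hw => ?_⟩
  obtain ⟨i, hi⟩ := h (w 0) (Set.mem_univ _)
  refine ⟨i, fun t => hi ?_⟩
  rw [Metric.mem_ball]
  refine (dist_aff_le (fun j => hw j 0) t).trans_lt (lt_of_le_of_lt ?_ hN)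
  exact pow_le_pow_of_le_one (by positivity) h0.le hk

/-- A natural operator does not leave the simplex to which it is applied: its value on an affine
simplex is the image of its value on the standard simplex. It is used both for the subdivision
homotopy and for the identity. -/
theorem ev_homotopy_of_isSmall {ι : Type*} {U : ι → Set X} {n k : ℕ} {f : Cochain X k}
    (hf : ∀ σ, IsSmall U σ → f σ = 0) {σ : Simplex X n} {s : Set (Fin (n + 1) → Std n)}
    (hs : ∀ w ∈ s, IsSmall U (σ.comp (aff w))) (Θ : ∀ m, TupleChain (Std m) n →ₗ[ℤ] TupleChain (Std m) k)
    (hΘ : ∀ w : Fin (n + 1) → Std n, ∀ x,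
      TupleChain.map (aff w) k (Θ n x) = Θ n (TupleChain.map (aff w) n x))
    {c : TupleChain (Std n) n} (hc : c ∈ Finsupp.supported ℤ ℤ s) : ev σ f (Θ n c) = 0 := by
  refine lift_mem_of_mem_supported (N := ⊥) (f := ev σ f ∘ₗ Θ n) (fun w hw => ?_) hc
  have : TupleChain.of w = TupleChain.map (aff w) n (TupleChain.of (vtx n)) := by
    rw [TupleChain.map_of]
    congr 1
    ext1 i
    exact (aff_apply_vtx w i).symm
  rw [LinearMap.comp_apply, this, ← hΘ, ← ev_comp_aff]
  exact ev_eq_zero_of_small (hs w hw) hf _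

theorem map_iterSubdiv {m n : ℕ} (w : Fin (n + 1) → Std m) (k : ℕ) :
    TupleChain.map (aff w) n (iterSubdiv n k) =
      (TupleChain.subdiv (bary m) n)^[k] (TupleChain.of w) := by
  induction k with
  | zero =>
    rw [iterSubdiv, Function.iterate_zero_apply, Function.iterate_zero_apply, TupleChain.map_of]
    congr 1
    ext1 i
    exact aff_apply_vtx w i
  | succ k ih =>
    rw [iterSubdiv_succ, TupleChain.map_subdiv _ (aff_bary w), ih, Function.iterate_succ_apply']

theorem bd_iterate_subdiv {m n : ℕ} (k : ℕ) (x : TupleChain (Std m) (n + 1)) :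
    TupleChain.bd _ n ((TupleChain.subdiv (bary m) (n + 1))^[k] x) =
      (TupleChain.subdiv (bary m) n)^[k] (TupleChain.bd _ n x) := by
  induction k with
  | zero => rfl
  | succ k ih => rw [Function.iterate_succ_apply', Function.iterate_succ_apply',
      TupleChain.bd_subdiv, ih]

theorem iterate_subdiv_eq_pow {m n : ℕ} (k : ℕ) (x : TupleChain (Std m) n) :
    (TupleChain.subdiv (bary m) n)^[k] x = (TupleChain.subdiv (bary m) n ^ k) x := by
  rw [Module.End.pow_apply]

theorem isSmall_zero {X : Type*} [TopologicalSpace X] {ι : Type*} {U : ι → Set X}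
    (hcov : ∀ x, ∃ i, x ∈ U i) (σ : Simplex X 0) : IsSmall U σ := by
  obtain ⟨i, hi⟩ := hcov (σ (vtx 0 0))
  refine ⟨i, fun t => ?_⟩
  have : t = vtx 0 0 := by
    have : Subsingleton (stdSimplex ℝ (Fin 1)) := by
      rw [stdSimplex_unique]
      infer_instance
    exact Subsingleton.elim _ _
  rwa [this]

/-- A cocycle that vanishes on the small simplices of an open cover is the coboundary of a cochain
that vanishes on the small simplices. -/
theorem exists_d_eq_of_vanish_small {ι : Type*} {U : ι → Set X} (hU : ∀ i, IsOpen (U i))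
    (hcov : ∀ x, ∃ i, x ∈ U i) {n : ℕ} {f : Cochain X (n + 1)} (hd : d X (n + 1) f = 0)
    (hf : ∀ σ, IsSmall U σ → f σ = 0) :
    ∃ g : Cochain X n, d X n g = f ∧ ∀ σ, IsSmall U σ → g σ = 0 := by
  set τ : ∀ m, TupleChain (Std m) n →ₗ[ℤ] TupleChain (Std m) (n + 1) :=
    fun m => TupleChain.subdivHomotopy (bary m) n with hτ
  -- The terms `f(τ(Sd^k σ))` vanish for large `k`, with a bound that depends on `σ`; the series
  -- over `k` is therefore a finite sum.
  have hN : ∀ σ : Simplex X n, ∃ N, ∀ k ≥ N, ev σ f (τ n (iterSubdiv n k)) = 0 := by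
    intro σ
    obtain ⟨N, hN⟩ := exists_isSmall_of_mesh hU hcov σ
    exact ⟨N, fun k hk => ev_homotopy_of_isSmall hf (hN k hk) τ
      (fun w x => TupleChain.map_subdivHomotopy _ (aff_bary w) n x) (iterSubdiv_mem_mesh n k)⟩
  choose N hN using hN
  have hsum : ∀ (σ : Simplex X n) (M : ℕ), N σ ≤ M →
      ∑ k ∈ Finset.range (N σ), ev σ f (τ n (iterSubdiv n k)) =
        ∑ k ∈ Finset.range M, ev σ f (τ n (iterSubdiv n k)) := by
    intro σ M hM
    refine Finset.sum_subset (Finset.range_mono hM) fun k _ hk => hN σ k ?_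
    simpa using hk
  -- The primitive is the full series `∑ₖ f(τ(Sd^k σ))`. Since `∂τ + τ∂ = 1 - Sd` and `f` is a
  -- cocycle, its coboundary telescopes to `f(σ)` minus a term that is eventually zero.
  refine ⟨fun σ => ∑ k ∈ Finset.range (N σ), ev σ f (τ n (iterSubdiv n k)), ?_, ?_⟩
  · ext σ
    obtain ⟨M₀, hM₀⟩ := exists_isSmall_of_mesh hU hcov σ
    -- The cutoffs of `σ` and of its faces differ; one common length is needed before the sums can
    -- be exchanged.
    obtain ⟨M, hM, hMi⟩ : ∃ M, M₀ ≤ M ∧ ∀ i ∈ Finset.range (n + 2), N (σ.face i) ≤ M := by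
      refine ⟨M₀ + ∑ i ∈ Finset.range (n + 2), N (σ.face i), by omega, fun i hi => ?_⟩
      exact (Finset.single_le_sum (f := fun i => N (σ.face i)) (fun _ _ => Nat.zero_le _) hi).trans
        (Nat.le_add_left _ _)
    rw [d_apply]
    have h1 : ∀ i ∈ Finset.range (n + 2), (-1 : ℤ) ^ i *
        ∑ k ∈ Finset.range (N (σ.face i)), ev (σ.face i) f (τ n (iterSubdiv n k)) =
        ∑ k ∈ Finset.range M, ev σ f (τ (n + 1) ((TupleChain.subdiv (bary (n + 1)) n ^ k)
          ((-1 : ℤ) ^ i • TupleChain.of (vtx (n + 1) ∘ faceMap n i)))) := by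
      intro i hi
      rw [hsum _ M (hMi i hi), Finset.mul_sum]
      refine Finset.sum_congr rfl fun k _ => ?_
      rw [map_smul, map_smul, map_smul, smul_eq_mul, face_eq_comp_aff, ev_comp_aff, hτ]
      dsimp only
      rw [TupleChain.map_subdivHomotopy _ (aff_bary _), map_iterSubdiv, iterate_subdiv_eq_pow]
    rw [Finset.sum_congr rfl h1, Finset.sum_comm]
    have h2 : ∀ k ∈ Finset.range M, ∑ i ∈ Finset.range (n + 2), ev σ f (τ (n + 1)
        ((TupleChain.subdiv (bary (n + 1)) n ^ k)
          ((-1 : ℤ) ^ i • TupleChain.of (vtx (n + 1) ∘ faceMap n i)))) =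
        ev σ f (iterSubdiv (n + 1) k) - ev σ f (iterSubdiv (n + 1) (k + 1)) := by
      intro k _
      rw [← map_sum, ← map_sum, ← map_sum, ← TupleChain.bd_of, ← iterate_subdiv_eq_pow,
        ← bd_iterate_subdiv, ← map_sub, iterSubdiv_succ]
      have := TupleChain.bd_subdivHomotopy (bary (n + 1)) n (iterSubdiv (n + 1) k)
      rw [← this, map_add, ← ev_d, hd, ev_zero, zero_add]
      rfl
    rw [Finset.sum_congr rfl h2, Finset.sum_range_sub', iterSubdiv, Function.iterate_zero_apply,
      ev_vtx, sub_eq_self]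
    refine ev_homotopy_of_isSmall hf (hM₀ M hM) (fun _ => LinearMap.id) (fun _ _ => rfl)
      (iterSubdiv_mem_mesh (n + 1) M)
  · intro σ hσ
    exact Finset.sum_eq_zero fun k _ => ev_eq_zero_of_small hσ hf _

end Small

end SingularCohomology
end

noncomputable section

namespace SingularCohomology

universe u v w

open AffineSimplices

/-! ### Functoriality and homotopy invariance -/

section Pull

variable {X : Type u} [TopologicalSpace X] {Y : Type v} [TopologicalSpace Y]
  {Z : Type w} [TopologicalSpace Z]

theorem pull_of (F : C(X, Y)) (n : ℕ) (x : Cohomology Y n) :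
    pull F (DirectSum.of (Cohomology Y) n x) = DirectSum.of (Cohomology X) n (pullDegree F n x) :=
  DirectSum.toSemiring_of _ _ _ _ _

theorem pullDegree_cls (F : C(X, Y)) {n : ℕ} (f : cocycles Y n) :
    pullDegree F n (cls f) = cls ⟨pullCochain F n f.1, pullCochain_mem_cocycles F f.2⟩ := rfl

theorem pullDegree_comp (F : C(X, Y)) (G : C(Y, Z)) (n : ℕ) (x : Cohomology Z n) :
    pullDegree (G.comp F) n x = pullDegree F n (pullDegree G n x) := by
  obtain ⟨f, rfl⟩ := cls_surjective x
  rfl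

theorem ringHom_ext_of {R : Type*} [AddCommMonoid R] {f g : CohomologyRing X →+ R}
    (h : ∀ n x, f (DirectSum.of (Cohomology X) n x) = g (DirectSum.of (Cohomology X) n x))
    (x : CohomologyRing X) : f x = g x :=
  DFunLike.congr_fun (DirectSum.addHom_ext h) x

theorem pull_comp (F : C(X, Y)) (G : C(Y, Z)) (x : CohomologyRing Z) :
    pull (G.comp F) x = pull F (pull G x) := by
  refine ringHom_ext_of (f := (pull (G.comp F)).toAddMonoidHom)
    (g := (pull F).toAddMonoidHom.comp (pull G).toAddMonoidHom) (fun n x => ?_) x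
  change pull (G.comp F) _ = pull F (pull G _)
  rw [pull_of, pull_of, pull_of, pullDegree_comp]

theorem pull_id (x : CohomologyRing X) : pull (ContinuousMap.id X) x = x := by
  refine ringHom_ext_of (f := (pull (ContinuousMap.id X)).toAddMonoidHom)
    (g := AddMonoidHom.id _) (fun n x => ?_) x
  obtain ⟨f, rfl⟩ := cls_surjective x
  exact pull_of _ _ _

theorem pull_apply (F : C(X, Y)) (x : CohomologyRing Y) (n : ℕ) :
    pull F x n = pullDegree F n (x n) := by
  classical
  induction x using DirectSum.induction_on with
  | zero => rw [map_zero, DirectSum.zero_apply, DirectSum.zero_apply, map_zero]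
  | add x y hx hy => rw [map_add, DirectSum.add_apply, DirectSum.add_apply, hx, hy, map_add]
  | of m x =>
    rw [pull_of]
    by_cases h : m = n
    · subst h
      rw [DirectSum.of_eq_same, DirectSum.of_eq_same]
    · rw [DirectSum.of_eq_of_ne _ _ _ (Ne.symm h), DirectSum.of_eq_of_ne _ _ _ (Ne.symm h), map_zero]

/-- A cochain that represents the difference of the pullbacks along homotopic maps. -/
theorem pullCochain_sub_mem_coboundaries {F₀ F₁ : C(X, Y)} (H : F₀.Homotopy F₁) {n : ℕ}
    {f : Cochain Y n} (hf : f ∈ cocycles Y n) :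
    pullCochain F₁ n f - pullCochain F₀ n f ∈ coboundaries X n := by
  set G : ∀ m : ℕ, Simplex X m → C(unitInterval × Std m, Y) := fun m σ =>
    H.toContinuousMap.comp (ContinuousMap.prodMap (ContinuousMap.id _) σ) with hG
  have hends : ∀ (r : unitInterval) {m : ℕ} (σ : Simplex X m) (g : Cochain Y m)
      (F : C(X, Y)) (_ : ∀ x, H (r, x) = F x),
      ev (G m σ) g (TupleChain.map (Prod.mk r) m (TupleChain.of (vtx m))) = g (F.comp σ) := by
    intro r m σ g F hF
    rw [TupleChain.map_of, ev_of]
    congr 1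
    ext t
    change H (aff (fun _ => r) t, σ (aff (vtx m) t)) = _
    rw [aff_const_unitInterval, hF, aff_vtx]
    rfl
  have h1 := fun {m : ℕ} (σ : Simplex X m) (g : Cochain Y m) =>
    hends 1 σ g F₁ (fun x => H.apply_one x)
  have h0 := fun {m : ℕ} (σ : Simplex X m) (g : Cochain Y m) =>
    hends 0 σ g F₀ (fun x => H.apply_zero x)
  rw [mem_cocycles] at hf
  cases n with
  | zero =>
    change _ = _
    ext σ
    change f (F₁.comp σ) - f (F₀.comp σ) = 0
    rw [← h1 σ f, ← h0 σ f, ← map_sub, ← TupleChain.bd_prism_zero, ← ev_d, hf, ev_zero]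
  | succ n =>
    -- The primitive evaluates `f` on the prism over `σ`, mapped to `Y` by the homotopy.
    refine ⟨fun σ => ev (G n σ) f (TupleChain.prism _ n (TupleChain.of (vtx n))), ?_⟩
    ext σ
    change _ = f (F₁.comp σ) - f (F₀.comp σ)
    rw [← h1 σ f, ← h0 σ f, ← map_sub, ← TupleChain.bd_prism, map_add, ← ev_d, hf, ev_zero, zero_add,
      TupleChain.bd_of, map_sum, map_sum, d_apply]
    refine Finset.sum_congr rfl fun i _ => ?_
    rw [map_smul, map_smul, smul_eq_mul]
    congr 1
    set a : Fin (n + 1) → Std (n + 1) := vtx (n + 1) ∘ faceMap n i with ha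
    have hGσ : G n (σ.face i) = (G (n + 1) σ).comp (ContinuousMap.prodMap (ContinuousMap.id _) (aff a)) := by
      rw [face_eq_comp_aff]
      rfl
    rw [hGσ, ev_comp]
    · have hm : TupleChain.of a = TupleChain.map (aff a) n (TupleChain.of (vtx n)) := by
        rw [TupleChain.map_of]
        congr 1
        ext1 k
        exact (aff_apply_vtx a k).symm
      rw [hm, ← TupleChain.map_prism]
      rfl
    · intro k w
      have h2 := aff_comp_aff a (Prod.snd ∘ w)
      ext t : 1
      refine Prod.ext rfl ?_
      exact congrArg (fun f => f t) h2

theorem pull_eq_of_homotopic {F₀ F₁ : C(X, Y)} (H : F₀.Homotopic F₁) : pull F₀ = pull F₁ := by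
  obtain ⟨H⟩ := H
  refine RingHom.ext fun x => ringHom_ext_of (f := (pull F₀).toAddMonoidHom)
    (g := (pull F₁).toAddMonoidHom) (fun n x => ?_) x
  change pull F₀ _ = pull F₁ _
  rw [pull_of, pull_of]
  congr 1
  obtain ⟨f, rfl⟩ := cls_surjective x
  rw [pullDegree_cls, pullDegree_cls, eq_comm, ← sub_eq_zero, ← map_sub, cls_eq_zero]
  exact pullCochain_sub_mem_coboundaries H f.2

theorem pull_bijective {F : C(X, Y)} {G : C(Y, X)} (h : (F.comp G).Homotopic (ContinuousMap.id Y))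
    (h' : (G.comp F).Homotopic (ContinuousMap.id X)) : Function.Bijective (pull F) := by
  refine ⟨fun x y hxy => ?_, fun x => ⟨pull G x, ?_⟩⟩
  · rw [← pull_id x, ← pull_id y, ← pull_eq_of_homotopic h, pull_comp, pull_comp, hxy]
  · rw [← pull_comp, pull_eq_of_homotopic h', pull_id]

theorem pull_homeomorph_bijective (e : X ≃ₜ Y) : Function.Bijective (pull (e : C(X, Y))) := by
  refine pull_bijective (G := (e.symm : C(Y, X))) ?_ ?_
  · rw [Homeomorph.toContinuousMap_comp_symm]
  · rw [Homeomorph.symm_comp_toContinuousMap]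

theorem pull_snd_injective [Nonempty X] :
    Function.Injective (pull (ContinuousMap.snd : C(X × Y, Y))) := by
  obtain ⟨a⟩ := ‹Nonempty X›
  refine Function.LeftInverse.injective
    (g := pull ((ContinuousMap.const Y a).prodMk (ContinuousMap.id Y))) fun y => ?_
  rw [← pull_comp]
  exact pull_id y

theorem pull_snd_bijective [ContractibleSpace X] :
    Function.Bijective (pull (ContinuousMap.snd : C(X × Y, Y))) := by
  obtain ⟨a, ⟨H⟩⟩ := id_nullhomotopic X
  refine pull_bijective (G := (ContinuousMap.const Y a).prodMk (ContinuousMap.id Y)) ?_ ?_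
  · exact ContinuousMap.Homotopic.refl _
  · have := ContinuousMap.Homotopic.prodMap (Nonempty.intro H)
      (ContinuousMap.Homotopic.refl (ContinuousMap.id Y))
    exact this.symm

end Pull

/-! ### Degrees -/

section Degree

variable {X : Type u} [TopologicalSpace X] {Y : Type v} [TopologicalSpace Y]

theorem of_mem_degreePart (n : ℕ) (x : Cohomology X n) :
    DirectSum.of (Cohomology X) n x ∈ degreePart X n := ⟨x, rfl⟩

theorem one_mem_degreePart : (1 : CohomologyRing X) ∈ degreePart X 0 := ⟨unitClass X, rfl⟩

theorem mul_mem_degreePart {m n : ℕ} {x y : CohomologyRing X} (hx : x ∈ degreePart X m)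
    (hy : y ∈ degreePart X n) : x * y ∈ degreePart X (m + n) := by
  obtain ⟨x, rfl⟩ := hx
  obtain ⟨y, rfl⟩ := hy
  exact ⟨_, (DirectSum.of_mul_of _ _).symm⟩

theorem pull_mem_degreePart (F : C(X, Y)) {n : ℕ} {y : CohomologyRing Y}
    (hy : y ∈ degreePart Y n) : pull F y ∈ degreePart X n := by
  obtain ⟨y, rfl⟩ := hy
  exact ⟨_, (pull_of _ _ _).symm⟩

theorem eq_zero_of_mem_degreePart {m n : ℕ} (hmn : m ≠ n) {x : CohomologyRing X}
    (hm : x ∈ degreePart X m) (hn : x ∈ degreePart X n) : x = 0 := by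
  obtain ⟨y, rfl⟩ := hm
  obtain ⟨z, hz⟩ := hn
  have := congrArg (fun x : CohomologyRing X => x m) hz
  simp only [DirectSum.of_eq_same, DirectSum.of_eq_of_ne _ _ _ hmn] at this
  rw [← this, map_zero]

theorem intCast_mem_degreePart (k : ℤ) : (k : CohomologyRing X) ∈ degreePart X 0 := by
  rw [← zsmul_one]
  exact zsmul_mem one_mem_degreePart k

theorem intCast_eq_zero [Nonempty X] {k : ℤ} (h : (k : CohomologyRing X) = 0) : k = 0 := by
  obtain ⟨x⟩ := ‹Nonempty X›
  have h1 : k • DirectSum.of (Cohomology X) 0 (unitClass X) = 0 := by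
    rw [← h, ← zsmul_one]
    rfl
  rw [← map_zsmul, unitClass, ← map_zsmul] at h1
  have h2 := DirectSum.of_injective (β := Cohomology X) 0 (h1.trans (map_zero _).symm)
  have h3 : ((k • (⟨unitCochain X, d_unitCochain⟩ : cocycles X 0) : cocycles X 0) : Cochain X 0) = 0 :=
    (cls_eq_zero _).1 h2
  have h4 := congrFun h3 (ContinuousMap.const _ x)
  simpa [unitCochain] using h4

/-- All simplices of one dimension coincide, so each coboundary is multiplication by an alternating
sum of ones. It equals `1` on degree `n + 1` when `n + 1` is odd, and into degree `n + 1` when `n +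
1` is even. -/
theorem cls_eq_zero_of_subsingleton [Subsingleton X] {n : ℕ} (x : Cohomology X (n + 1)) : x = 0 := by
  obtain ⟨⟨f, hf⟩, rfl⟩ := cls_surjective x
  rw [cls_eq_zero]
  rw [mem_cocycles] at hf
  rcases isEmpty_or_nonempty X with hX | ⟨⟨p⟩⟩
  · refine ⟨0, ?_⟩
    ext σ
    exact hX.elim (σ (vtx _ 0))
  have hconst : ∀ {m : ℕ} (g : Cochain X m) (σ : Simplex X m), g σ = g (ContinuousMap.const _ p) :=
    fun g σ => congrArg g (by ext t; exact Subsingleton.elim _ _)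
  by_cases hn : ¬ Even (n + 1)
  · refine ⟨0, ?_⟩
    ext σ
    have h := congrFun hf (ContinuousMap.const _ p)
    rw [d_apply, Finset.sum_congr rfl fun i _ => by rw [hconst f], ← Finset.sum_mul,
      neg_one_geom_sum, if_neg (by grind), one_mul] at h
    rw [map_zero]
    exact ((hconst f σ).trans h).symm
  · refine ⟨fun _ => f (ContinuousMap.const _ p), ?_⟩
    ext σ
    rw [d_apply, ← Finset.sum_mul, neg_one_geom_sum, if_neg (by grind), one_mul]
    exact (hconst f σ).symm

theorem exists_intCast_of_unique [Unique X] (x : CohomologyRing X) :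
    ∃ k : ℤ, x = (k : CohomologyRing X) := by
  induction x using DirectSum.induction_on with
  | zero => exact ⟨0, by simp⟩
  | add x y hx hy =>
    obtain ⟨k, rfl⟩ := hx
    obtain ⟨l, rfl⟩ := hy
    exact ⟨k + l, by push_cast; rfl⟩
  | of n x =>
    cases n with
    | succ n => exact ⟨0, by rw [cls_eq_zero_of_subsingleton x, map_zero, Int.cast_zero]⟩
    | zero =>
      obtain ⟨f, rfl⟩ := cls_surjective x
      refine ⟨f.1 (ContinuousMap.const _ default), ?_⟩
      rw [← zsmul_one]
      change _ = _ • DirectSum.of (Cohomology X) 0 (unitClass X)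
      rw [← map_zsmul, unitClass, ← map_zsmul]
      congr 2
      ext σ
      have : σ = ContinuousMap.const _ default := by ext t; exact Subsingleton.elim _ _
      rw [this]
      simp [unitCochain]

theorem exists_intCast_of_contractible [ContractibleSpace X] (x : CohomologyRing X) :
    ∃ k : ℤ, x = (k : CohomologyRing X) := by
  obtain ⟨a, ⟨H⟩⟩ := id_nullhomotopic X
  obtain ⟨k, hk⟩ := exists_intCast_of_unique (pull (ContinuousMap.const PUnit.{u + 1} a) x)
  refine ⟨k, ?_⟩
  have h1 : (ContinuousMap.const X a) =
      (ContinuousMap.const PUnit.{u + 1} a).comp (ContinuousMap.const X PUnit.unit) := rfl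
  rw [← pull_id x, pull_eq_of_homotopic ⟨H⟩, h1, pull_comp, hk, map_intCast]

end Degree

end SingularCohomology
end

noncomputable section

namespace SingularCohomology

universe u v w u₁ u₂ u₃ u₄

/-! ### Mayer–Vietoris -/

open Topology in
/-- A cover of `X` by two open subspaces `A`, `B` with intersection `C`, given by embeddings. -/
structure OpenSquare (C : Type u₁) (A : Type u₂) (B : Type u₃) (X : Type u₄) [TopologicalSpace C]
    [TopologicalSpace A] [TopologicalSpace B] [TopologicalSpace X] where
  iA : C(C, A)
  iB : C(C, B)
  jA : C(A, X)
  jB : C(B, X)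
  comm : jA.comp iA = jB.comp iB
  isEmbedding_iA : IsEmbedding iA
  isOpenEmbedding_jA : IsOpenEmbedding jA
  isOpenEmbedding_jB : IsOpenEmbedding jB
  cover : ∀ x, x ∈ Set.range jA ∨ x ∈ Set.range jB
  exists_of_eq : ∀ a b, jA a = jB b → ∃ c, iA c = a ∧ iB c = b

/-! ### Extension of cochains by zero -/

section Cochains

variable {X : Type u} [TopologicalSpace X] {Y : Type v} [TopologicalSpace Y]

theorem exists_comp_eq {j : C(X, Y)} (hj : Topology.IsEmbedding j) {n : ℕ} {σ : Simplex Y n}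
    (h : ∀ t, σ t ∈ Set.range j) : ∃ τ : Simplex X n, j.comp τ = σ := by
  choose f hf using h
  refine ⟨⟨f, ?_⟩, ContinuousMap.ext hf⟩
  rw [hj.continuous_iff]
  exact σ.continuous.congr fun t => (hf t).symm

theorem comp_injective {j : C(X, Y)} (hj : Function.Injective j) {n : ℕ} :
    Function.Injective fun τ : Simplex X n => j.comp τ := fun _ _ h =>
  ContinuousMap.ext fun t => hj (DFunLike.congr_fun h t)

/-- Extension of a cochain by zero along an embedding. -/
def extendCochain (j : C(X, Y)) {n : ℕ} (f : Cochain X n) : Cochain Y n :=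
  Function.extend (fun τ : Simplex X n => j.comp τ) f 0

theorem pullCochain_extendCochain {j : C(X, Y)} (hj : Function.Injective j) {n : ℕ}
    (f : Cochain X n) : pullCochain j n (extendCochain j f) = f :=
  funext fun τ => (comp_injective hj).extend_apply f 0 τ

theorem exists_coboundary_extend {j : C(X, Y)} (hj : Function.Injective j) {n : ℕ}
    {f : Cochain X n} (hf : f ∈ coboundaries X n) :
    ∃ g ∈ coboundaries Y n, pullCochain j n g = f := by
  cases n with
  | zero =>
    obtain rfl : f = 0 := hf
    exact ⟨0, zero_mem _, map_zero _⟩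
  | succ n =>
    obtain ⟨f, rfl⟩ := hf
    refine ⟨d Y n (extendCochain j f), ⟨_, rfl⟩, ?_⟩
    rw [← d_pullCochain, pullCochain_extendCochain hj]

theorem coboundaries_le_cocycles (n : ℕ) : coboundaries X n ≤ cocycles X n := by
  cases n with
  | zero => exact bot_le
  | succ n =>
    rintro _ ⟨f, rfl⟩
    exact d_d f

theorem pullCochain_comp {Z : Type w} [TopologicalSpace Z] (F : C(X, Y)) (G : C(Y, Z)) (n : ℕ)
    (f : Cochain Z n) : pullCochain F n (pullCochain G n f) = pullCochain (G.comp F) n f := rfl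

theorem cup_zero {p q n : ℕ} (h : p + q = n) (f : Cochain X p) : cup h f (0 : Cochain X q) = 0 := by
  ext σ
  simp [cup]

theorem cls_eq_cls {n : ℕ} {f g : cocycles X n} :
    cls f = cls g ↔ (f : Cochain X n) - g ∈ coboundaries X n := by
  rw [← sub_eq_zero, ← map_sub, cls_eq_zero]
  rfl

end Cochains

/-! ### The Mayer–Vietoris sequence of a square -/

namespace OpenSquare

variable {C : Type u₁} {A : Type u₂} {B : Type u₃} {X : Type u₄} [TopologicalSpace C]
    [TopologicalSpace A] [TopologicalSpace B] [TopologicalSpace X] (T : OpenSquare C A B X)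

/-- Exactness in the middle at cochain level: a simplex that lies in both `A` and `B` comes from
`C`, where the two cochains agree. Simplices in neither set get the value zero. -/
theorem exists_glue {n : ℕ} {a : Cochain A n} {b : Cochain B n}
    (h : pullCochain T.iA n a = pullCochain T.iB n b) :
    ∃ c : Cochain X n, pullCochain T.jA n c = a ∧ pullCochain T.jB n c = b := by
  refine ⟨Function.extend (fun τ : Simplex A n => T.jA.comp τ) a (extendCochain T.jB b), ?_, ?_⟩
  · exact funext fun τ => (comp_injective T.isOpenEmbedding_jA.injective).extend_apply _ _ τ
  · ext τ
    change Function.extend _ _ _ (T.jB.comp τ) = _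
    by_cases hτ : ∃ τ' : Simplex A n, T.jA.comp τ' = T.jB.comp τ
    · obtain ⟨τ', hτ'⟩ := hτ
      have hp : ∀ t, ∃ c, T.iA c = τ' t ∧ T.iB c = τ t := fun t =>
        T.exists_of_eq _ _ (DFunLike.congr_fun hτ' t)
      choose f hf using hp
      obtain ⟨ρ, hρ⟩ := exists_comp_eq T.isEmbedding_iA (σ := τ') fun t => ⟨f t, (hf t).1⟩
      have hρB : T.iB.comp ρ = τ := by
        ext1 t
        have : ρ t = f t := T.isEmbedding_iA.injective
          ((DFunLike.congr_fun hρ t).trans (hf t).1.symm)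
        exact (congrArg T.iB this).trans (hf t).2
      rw [← hτ', (comp_injective T.isOpenEmbedding_jA.injective).extend_apply, ← hρ, ← hρB]
      exact congrFun h ρ
    · rw [Function.extend_apply' _ _ _ hτ]
      exact congrFun (pullCochain_extendCochain T.isOpenEmbedding_jB.injective b) τ

/-- The open cover of `X` by the images of `A` and `B`. -/
def sets (i : Bool) : Set X := bif i then Set.range T.jA else Set.range T.jB

theorem isOpen_sets (i : Bool) : IsOpen (T.sets i) := by
  cases i
  · exact T.isOpenEmbedding_jB.isOpen_range
  · exact T.isOpenEmbedding_jA.isOpen_range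

theorem exists_mem_sets (x : X) : ∃ i, x ∈ T.sets i := by
  rcases T.cover x with h | h
  · exact ⟨true, h⟩
  · exact ⟨false, h⟩

theorem isSmall_jA {n : ℕ} (τ : Simplex A n) : IsSmall T.sets (T.jA.comp τ) :=
  ⟨true, fun t => ⟨τ t, rfl⟩⟩

theorem isSmall_jB {n : ℕ} (τ : Simplex B n) : IsSmall T.sets (T.jB.comp τ) :=
  ⟨false, fun t => ⟨τ t, rfl⟩⟩

theorem eq_zero_of_isSmall {n : ℕ} {f : Cochain X n} (hA : pullCochain T.jA n f = 0)
    (hB : pullCochain T.jB n f = 0) (σ : Simplex X n) (hσ : IsSmall T.sets σ) : f σ = 0 := by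
  obtain ⟨i, hi⟩ := hσ
  cases i
  · obtain ⟨τ, rfl⟩ := exists_comp_eq T.isOpenEmbedding_jB.isEmbedding hi
    exact congrFun hB τ
  · obtain ⟨τ, rfl⟩ := exists_comp_eq T.isOpenEmbedding_jA.isEmbedding hi
    exact congrFun hA τ

/-- The small-simplices theorem in the form used below: the cochains that die on both `A` and `B`
form an acyclic complex, so restriction to `A` and `B` loses no cohomological information. -/
theorem exists_d_eq {n : ℕ} {f : Cochain X (n + 1)} (hf : d X (n + 1) f = 0)
    (hA : pullCochain T.jA (n + 1) f = 0) (hB : pullCochain T.jB (n + 1) f = 0) :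
    ∃ g : Cochain X n, d X n g = f ∧ pullCochain T.jA n g = 0 ∧ pullCochain T.jB n g = 0 := by
  obtain ⟨g, hg, h⟩ := exists_d_eq_of_vanish_small T.isOpen_sets T.exists_mem_sets hf
    (T.eq_zero_of_isSmall hA hB)
  exact ⟨g, hg, funext fun τ => h _ (T.isSmall_jA τ), funext fun τ => h _ (T.isSmall_jB τ)⟩

theorem cochain_zero_eq_zero {f : Cochain X 0} (hA : pullCochain T.jA 0 f = 0)
    (hB : pullCochain T.jB 0 f = 0) : f = 0 :=
  funext fun σ => T.eq_zero_of_isSmall hA hB σ (isSmall_zero T.exists_mem_sets σ)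

/-- Glued cochains need not be closed on simplices that lie in neither set. The defect dies on `A`
and `B`, so it has a primitive that does too and can be subtracted. -/
theorem exists_cocycle {n : ℕ} {a : Cochain A n} {b : Cochain B n} (ha : a ∈ cocycles A n)
    (hb : b ∈ cocycles B n) (h : pullCochain T.iA n a = pullCochain T.iB n b) :
    ∃ c ∈ cocycles X n, pullCochain T.jA n c = a ∧ pullCochain T.jB n c = b := by
  obtain ⟨c, hcA, hcB⟩ := T.exists_glue h
  obtain ⟨g, hg, hgA, hgB⟩ := T.exists_d_eq (f := d X n c) (d_d c)
    (by rw [← d_pullCochain, hcA, mem_cocycles.1 ha])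
    (by rw [← d_pullCochain, hcB, mem_cocycles.1 hb])
  refine ⟨c - g, ?_, ?_, ?_⟩
  · rw [mem_cocycles, map_sub, hg, sub_self]
  · rw [map_sub, hcA, hgA, sub_zero]
  · rw [map_sub, hcB, hgB, sub_zero]

theorem exists_cohomology_glue {n : ℕ} (u : Cohomology A n) (v : Cohomology B n)
    (h : pullDegree T.iA n u = pullDegree T.iB n v) :
    ∃ z : Cohomology X n, pullDegree T.jA n z = u ∧ pullDegree T.jB n z = v := by
  obtain ⟨f, rfl⟩ := cls_surjective u
  obtain ⟨g, rfl⟩ := cls_surjective v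
  rw [pullDegree_cls, pullDegree_cls, cls_eq_cls] at h
  obtain ⟨x, hx, hxC⟩ := exists_coboundary_extend T.isEmbedding_iA.injective h
  obtain ⟨c, hc, hcA, hcB⟩ := T.exists_cocycle (a := f.1 - x) (b := g.1)
    (sub_mem f.2 (coboundaries_le_cocycles n hx)) g.2
    (by rw [map_sub, hxC, sub_sub_cancel])
  refine ⟨cls ⟨c, hc⟩, ?_, ?_⟩
  · rw [pullDegree_cls, cls_eq_cls]
    dsimp only
    rw [hcA, sub_sub_cancel_left]
    exact neg_mem hx
  · rw [pullDegree_cls]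
    congr 2

/-- The graph of the connecting homomorphism. -/
def Conn {n : ℕ} (w : Cohomology C n) (z : Cohomology X (n + 1)) : Prop :=
  ∃ (a : Cochain A n) (b : Cochain B n) (ζ : cocycles X (n + 1))
    (hw : pullCochain T.iA n a - pullCochain T.iB n b ∈ cocycles C n),
    pullCochain T.jA (n + 1) ζ.1 = d A n a ∧ pullCochain T.jB (n + 1) ζ.1 = d B n b ∧
      cls ⟨_, hw⟩ = w ∧ cls ζ = z

theorem Conn.add {n : ℕ} {w w' : Cohomology C n} {z z' : Cohomology X (n + 1)} (h : T.Conn w z)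
    (h' : T.Conn w' z') : T.Conn (w + w') (z + z') := by
  obtain ⟨a, b, ζ, hw, hA, hB, rfl, rfl⟩ := h
  obtain ⟨a', b', ζ', hw', hA', hB', rfl, rfl⟩ := h'
  have e : pullCochain T.iA n (a + a') - pullCochain T.iB n (b + b') =
      (pullCochain T.iA n a - pullCochain T.iB n b) +
        (pullCochain T.iA n a' - pullCochain T.iB n b') := by
    rw [map_add, map_add]
    abel
  refine ⟨a + a', b + b', ζ + ζ', e ▸ add_mem hw hw', ?_, ?_, ?_, map_add _ _ _⟩
  · rw [AddSubgroup.coe_add, map_add, map_add, hA, hA']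
  · rw [AddSubgroup.coe_add, map_add, map_add, hB, hB']
  · rw [← map_add]
    exact congrArg cls (Subtype.ext e)

theorem Conn.neg {n : ℕ} {w : Cohomology C n} {z : Cohomology X (n + 1)} (h : T.Conn w z) :
    T.Conn (-w) (-z) := by
  obtain ⟨a, b, ζ, hw, hA, hB, rfl, rfl⟩ := h
  have e : pullCochain T.iA n (-a) - pullCochain T.iB n (-b) =
      -(pullCochain T.iA n a - pullCochain T.iB n b) := by
    rw [map_neg, map_neg]
    abel
  refine ⟨-a, -b, -ζ, e ▸ neg_mem hw, ?_, ?_, ?_, map_neg _ _⟩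
  · rw [AddSubgroup.coe_neg, map_neg, map_neg, hA]
  · rw [AddSubgroup.coe_neg, map_neg, map_neg, hB]
  · rw [← map_neg]
    exact congrArg cls (Subtype.ext e)

/-- A cocycle of `C` is split as its extension by zero to `A` minus zero on `B`; the two
coboundaries agree on `C` and glue. -/
theorem exists_conn {n : ℕ} (w : Cohomology C n) : ∃ z, T.Conn w z := by
  obtain ⟨f, rfl⟩ := cls_surjective w
  have hf := pullCochain_extendCochain T.isEmbedding_iA.injective f.1
  obtain ⟨ζ, hζ, hA, hB⟩ := T.exists_cocycle (a := d A n (extendCochain T.iA f.1)) (b := 0)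
    (d_d _) (zero_mem _) (by rw [← d_pullCochain, hf, map_zero, mem_cocycles.1 f.2])
  have e : pullCochain T.iA n (extendCochain T.iA f.1) - pullCochain T.iB n 0 = f.1 := by
    rw [hf, map_zero, sub_zero]
  refine ⟨cls ⟨ζ, hζ⟩, extendCochain T.iA f.1, 0, ⟨ζ, hζ⟩, ?_, hA, ?_, ?_, rfl⟩
  · rw [e]
    exact f.2
  · rw [map_zero, hB]
  · exact congrArg cls (Subtype.ext e)

/-- If the class on `C` is trivial, a coboundary correction makes `a` and `b` agree on `C`. They
glue to some `η`, and `ζ - dη` dies on `A` and `B`. As the graph is closed under sums and negatives,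
this gives single-valuedness. -/
theorem Conn.eq_zero {n : ℕ} {z : Cohomology X (n + 1)} (h : T.Conn (0 : Cohomology C n) z) :
    z = 0 := by
  obtain ⟨a, b, ζ, hw, hA, hB, h0, rfl⟩ := h
  rw [cls_eq_zero] at h0
  obtain ⟨x, hx, hxC⟩ := exists_coboundary_extend T.isEmbedding_iA.injective h0
  obtain ⟨η, hηA, hηB⟩ := T.exists_glue (a := a - x) (b := b)
    (by rw [map_sub, hxC, sub_sub_cancel])
  obtain ⟨g, hg, -, -⟩ := T.exists_d_eq (f := ζ.1 - d X n η)
    (by rw [map_sub, d_d, mem_cocycles.1 ζ.2, sub_zero])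
    (by rw [map_sub, ← d_pullCochain, hηA, map_sub, hA,
      mem_cocycles.1 (coboundaries_le_cocycles n hx), sub_zero, sub_self])
    (by rw [map_sub, ← d_pullCochain, hηB, hB, sub_self])
  rw [cls_eq_zero]
  exact ⟨g + η, by rw [map_add, hg, sub_add_cancel]⟩

theorem Conn.unique {n : ℕ} {w : Cohomology C n} {z z' : Cohomology X (n + 1)} (h : T.Conn w z)
    (h' : T.Conn w z') : z = z' := by
  have := Conn.add T h (Conn.neg T h')
  rw [add_neg_cancel] at this
  exact add_neg_eq_zero.1 (Conn.eq_zero T this)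

/-- The connecting homomorphism in a fixed degree. -/
def deltaDegree (n : ℕ) : Cohomology C n →+ Cohomology X (n + 1) :=
  AddMonoidHom.mk' (fun w => (T.exists_conn w).choose) fun w w' =>
    Conn.unique T (T.exists_conn (w + w')).choose_spec
      (Conn.add T (T.exists_conn w).choose_spec (T.exists_conn w').choose_spec)

theorem conn_deltaDegree {n : ℕ} (w : Cohomology C n) : T.Conn w (T.deltaDegree n w) :=
  (T.exists_conn w).choose_spec

theorem Conn.deltaDegree_eq {n : ℕ} {w : Cohomology C n} {z : Cohomology X (n + 1)}
    (h : T.Conn w z) : T.deltaDegree n w = z := Conn.unique T (T.conn_deltaDegree w) h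

/-- The connecting homomorphism of the Mayer–Vietoris sequence. -/
def delta : CohomologyRing C →+ CohomologyRing X :=
  DirectSum.toAddMonoid fun n => (DirectSum.of (Cohomology X) (n + 1)).comp (T.deltaDegree n)

theorem delta_of (n : ℕ) (w : Cohomology C n) :
    T.delta (DirectSum.of (Cohomology C) n w) =
      DirectSum.of (Cohomology X) (n + 1) (T.deltaDegree n w) :=
  DirectSum.toAddMonoid_of _ _ _

theorem delta_mem_degreePart {n : ℕ} {w : CohomologyRing C} (hw : w ∈ degreePart C n) :
    T.delta w ∈ degreePart X (n + 1) := by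
  obtain ⟨w, rfl⟩ := hw
  exact ⟨_, (T.delta_of n w).symm⟩

theorem delta_apply (w : CohomologyRing C) (n : ℕ) :
    T.delta w (n + 1) = T.deltaDegree n (w n) := by
  induction w using DirectSum.induction_on with
  | zero => rw [map_zero, DirectSum.zero_apply, DirectSum.zero_apply, map_zero]
  | add x y hx hy => rw [map_add, DirectSum.add_apply, DirectSum.add_apply, hx, hy, map_add]
  | of m x =>
    rw [delta_of]
    by_cases h : m = n
    · subst h
      rw [DirectSum.of_eq_same, DirectSum.of_eq_same]
    · rw [DirectSum.of_eq_of_ne _ _ _ (by omega), DirectSum.of_eq_of_ne _ _ _ (Ne.symm h), map_zero]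

theorem pull_jA_delta (w : CohomologyRing C) : pull T.jA (T.delta w) = 0 := by
  refine ringHom_ext_of (f := (pull T.jA).toAddMonoidHom.comp T.delta) (g := 0) (fun n w => ?_) w
  change pull T.jA (T.delta _) = 0
  obtain ⟨a, b, ζ, hw, hA, hB, -, hz⟩ := T.conn_deltaDegree w
  rw [delta_of, pull_of, ← hz, pullDegree_cls]
  refine (congrArg _ ?_).trans (map_zero _)
  rw [cls_eq_zero]
  exact ⟨a, hA.symm⟩

theorem delta_pull_iA (u : CohomologyRing A) : T.delta (pull T.iA u) = 0 := by
  refine ringHom_ext_of (f := T.delta.comp (pull T.iA).toAddMonoidHom) (g := 0) (fun n u => ?_) u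
  change T.delta (pull T.iA (DirectSum.of (Cohomology A) n u)) = 0
  obtain ⟨f, rfl⟩ := cls_surjective u
  rw [pull_of, delta_of, pullDegree_cls]
  refine (congrArg _ ?_).trans (map_zero _)
  refine Conn.deltaDegree_eq T ⟨f.1, 0, 0, ?_, ?_, ?_, ?_, map_zero _⟩
  · rw [map_zero, sub_zero]
    exact pullCochain_mem_cocycles _ f.2
  · rw [mem_cocycles.1 f.2]
    exact map_zero _
  · rw [map_zero]
    exact map_zero _
  · congr 2
    rw [map_zero, sub_zero]

theorem delta_pull_iB (v : CohomologyRing B) : T.delta (pull T.iB v) = 0 := by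
  refine ringHom_ext_of (f := T.delta.comp (pull T.iB).toAddMonoidHom) (g := 0) (fun n u => ?_) v
  change T.delta (pull T.iB (DirectSum.of (Cohomology B) n u)) = 0
  obtain ⟨f, rfl⟩ := cls_surjective u
  rw [pull_of, delta_of, pullDegree_cls]
  refine (congrArg _ ?_).trans (map_zero _)
  refine Conn.deltaDegree_eq T ⟨0, -f.1, 0, ?_, ?_, ?_, ?_, map_zero _⟩
  · rw [map_zero, zero_sub, map_neg, neg_neg]
    exact pullCochain_mem_cocycles _ f.2
  · rw [map_zero]
    exact map_zero _
  · rw [map_neg, mem_cocycles.1 f.2, neg_zero]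
    exact map_zero _
  · congr 2
    rw [map_zero, zero_sub, map_neg, neg_neg]

theorem exists_of_delta_eq_zero {w : CohomologyRing C} (hw : T.delta w = 0) :
    ∃ u v, w = pull T.iA u + pull T.iB v := by
  classical
  -- Exactness is proved degree by degree and reassembled over the finite support. In degree `n`, a
  -- primitive `η` of `ζ` corrects `a` and `b` to cocycles.
  have key : ∀ n, ∃ u v, DirectSum.of (Cohomology C) n (w n) = pull T.iA u + pull T.iB v := by
    intro n
    have h := T.conn_deltaDegree (w n)
    rw [← delta_apply, hw] at h
    obtain ⟨a, b, ζ, hw, hA, hB, hw', hz⟩ := h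
    obtain ⟨η, hη⟩ := (cls_eq_zero _).1 hz
    refine ⟨DirectSum.of _ n (cls ⟨a - pullCochain T.jA n η, ?_⟩),
      DirectSum.of _ n (-cls ⟨b - pullCochain T.jB n η, ?_⟩), ?_⟩
    · rw [mem_cocycles, map_sub, d_pullCochain, hη, hA, sub_self]
    · rw [mem_cocycles, map_sub, d_pullCochain, hη, hB, sub_self]
    · rw [pull_of, pull_of, ← map_add, map_neg, pullDegree_cls, pullDegree_cls, ← map_neg cls,
        ← map_add cls, ← hw']
      congr 2
      ext1
      simp only [map_sub, AddSubgroup.coe_add, AddSubgroup.coe_neg, pullCochain_comp, T.comm]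
      abel
  choose u v huv using key
  refine ⟨∑ n ∈ DFinsupp.support w, u n, ∑ n ∈ DFinsupp.support w, v n, ?_⟩
  rw [map_sum, map_sum, ← Finset.sum_add_distrib]
  conv_lhs => rw [← DirectSum.sum_support_of w]
  exact Finset.sum_congr rfl fun n _ => huv n

theorem exists_delta_eq {z : CohomologyRing X} (hA : pull T.jA z = 0) (hB : pull T.jB z = 0) :
    ∃ w, T.delta w = z := by
  classical
  have key : ∀ n, ∃ w, T.delta w = DirectSum.of (Cohomology X) n (z n) := by
    intro n
    have hAn := pull_apply T.jA z n
    have hBn := pull_apply T.jB z n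
    rw [hA, DirectSum.zero_apply] at hAn
    rw [hB, DirectSum.zero_apply] at hBn
    obtain ⟨ζ, hζ⟩ := cls_surjective (z n)
    rw [← hζ, pullDegree_cls, eq_comm, cls_eq_zero] at hAn hBn
    cases n with
    | zero =>
      refine ⟨0, ?_⟩
      have : ζ = 0 := Subtype.ext (T.cochain_zero_eq_zero hAn hBn)
      rw [← hζ, this, map_zero, map_zero, map_zero]
    | succ n =>
      obtain ⟨a, ha⟩ := hAn
      obtain ⟨b, hb⟩ := hBn
      have hw : pullCochain T.iA n a - pullCochain T.iB n b ∈ cocycles C n := by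
        rw [mem_cocycles, map_sub, d_pullCochain, d_pullCochain, ha, hb]
        dsimp only
        rw [pullCochain_comp, pullCochain_comp, T.comm, sub_self]
      refine ⟨DirectSum.of _ n (cls ⟨_, hw⟩), ?_⟩
      rw [delta_of]
      congr 1
      exact Conn.deltaDegree_eq T ⟨a, b, ζ, hw, ha.symm, hb.symm, rfl, hζ⟩
  choose w hw using key
  refine ⟨∑ n ∈ DFinsupp.support z, w n, ?_⟩
  rw [map_sum]
  conv_rhs => rw [← DirectSum.sum_support_of z]
  exact Finset.sum_congr rfl fun n _ => hw n

theorem exists_glue_pull {u : CohomologyRing A} {v : CohomologyRing B}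
    (h : pull T.iA u = pull T.iB v) : ∃ z, pull T.jA z = u ∧ pull T.jB z = v := by
  classical
  have key : ∀ n, ∃ z : Cohomology X n, pullDegree T.jA n z = u n ∧ pullDegree T.jB n z = v n := by
    intro n
    refine T.exists_cohomology_glue _ _ ?_
    rw [← pull_apply, h, pull_apply]
  choose z hzA hzB using key
  refine ⟨∑ n ∈ DFinsupp.support u ∪ DFinsupp.support v, DirectSum.of _ n (z n), ?_, ?_⟩
  · rw [map_sum]
    conv_rhs => rw [← DirectSum.sum_support_of u]
    rw [← Finset.sum_subset (Finset.subset_union_left (s₂ := DFinsupp.support v))]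
    · exact Finset.sum_congr rfl fun n _ => by rw [pull_of, hzA]
    · intro n _ hn
      rw [pull_of, hzA, DFinsupp.notMem_support_iff.1 hn, map_zero]
  · rw [map_sum]
    conv_rhs => rw [← DirectSum.sum_support_of v]
    rw [← Finset.sum_subset (Finset.subset_union_right (s₁ := DFinsupp.support u))]
    · exact Finset.sum_congr rfl fun n _ => by rw [pull_of, hzB]
    · intro n _ hn
      rw [pull_of, hzB, DFinsupp.notMem_support_iff.1 hn, map_zero]

/-- The class `x` has one global cocycle `ξ`, so `d(a ⌣ ξ) = da ⌣ ξ`, and likewise for `b`. There is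
no sign because `w` stands on the left. -/
theorem delta_mul (w : CohomologyRing C) (x : CohomologyRing X) :
    T.delta (w * pull (T.jA.comp T.iA) x) = T.delta w * x := by
  induction x using DirectSum.induction_on with
  | zero => simp
  | add x y hx hy => rw [map_add, mul_add, map_add, hx, hy, mul_add]
  | of q x =>
    induction w using DirectSum.induction_on with
    | zero => simp
    | add w w' hw hw' => rw [add_mul, map_add, hw, hw', map_add, add_mul]
    | of p w =>
      obtain ⟨ξ, rfl⟩ := cls_surjective x
      obtain ⟨a, b, ζ, hw, hA, hB, hw', hz⟩ := T.conn_deltaDegree w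
      rw [pull_of, delta_of, DirectSum.of_mul_of, DirectSum.of_mul_of, delta_of, ← hz]
      have hAξ : d A q (pullCochain T.jA q ξ.1) = 0 := by
        rw [d_pullCochain, mem_cocycles.1 ξ.2, map_zero]
      have hBξ : d B q (pullCochain T.jB q ξ.1) = 0 := by
        rw [d_pullCochain, mem_cocycles.1 ξ.2, map_zero]
      have e : pullCochain T.iA (p + q) (cup rfl a (pullCochain T.jA q ξ.1)) -
          pullCochain T.iB (p + q) (cup rfl b (pullCochain T.jB q ξ.1)) =
          cup rfl (pullCochain T.iA p a - pullCochain T.iB p b)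
            (pullCochain (T.jA.comp T.iA) q ξ.1) := by
        have hc : pullCochain (T.jA.comp T.iA) q ξ.1 = pullCochain (T.jB.comp T.iB) q ξ.1 := by
          rw [T.comm]
        rw [sub_eq_add_neg (pullCochain T.iA p a), add_cup]
        nth_rw 2 [hc]
        ext σ
        simp only [Pi.sub_apply, Pi.add_apply, cup, Pi.neg_apply, neg_mul, ← sub_eq_add_neg]
        rfl
      have hconn : T.Conn (n := p + q) (cupProduct rfl w (pullDegree (T.jA.comp T.iA) q (cls ξ)))
          (cupProduct (by omega : (p + 1) + q = p + q + 1) (cls ζ) (cls ξ)) := by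
        refine ⟨cup rfl a (pullCochain T.jA q ξ.1), cup rfl b (pullCochain T.jB q ξ.1),
          ⟨_, cup_mem_cocycles (by omega : (p + 1) + q = p + q + 1) ζ.2 ξ.2⟩, ?_, ?_, ?_, ?_, rfl⟩
        · rw [e]
          exact cup_mem_cocycles _ hw (pullCochain_mem_cocycles _ ξ.2)
        · rw [d_cup, hAξ, cup_zero, smul_zero, add_zero, ← hA]
          rfl
        · rw [d_cup, hBξ, cup_zero, smul_zero, add_zero, ← hB]
          rfl
        · rw [← hw', pullDegree_cls, cupProduct_cls]
          exact congrArg cls (Subtype.ext e)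
      have h1 := Conn.deltaDegree_eq T hconn
      change DirectSum.of (Cohomology X) (p + q + 1) (T.deltaDegree (p + q)
        (cupProduct rfl w (pullDegree (T.jA.comp T.iA) q (cls ξ)))) =
        DirectSum.of (Cohomology X) (p + 1 + q) (cupProduct rfl (cls ζ) (cls ξ))
      rw [h1]
      -- Only the index differs: `p + q + 1` on one side and `p + 1 + q` on the other.
      have h2 : ∀ {m n : ℕ} (hm : (p + 1) + q = m) (hn : (p + 1) + q = n),
          DirectSum.of (Cohomology X) m (cupProduct hm (cls ζ) (cls ξ)) =
            DirectSum.of (Cohomology X) n (cupProduct hn (cls ζ) (cls ξ)) := by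
        rintro m n rfl rfl
        rfl
      exact h2 _ _

theorem pull_delta {C' : Type*} {A' : Type*} {B' : Type*} {X' : Type*} [TopologicalSpace C']
    [TopologicalSpace A'] [TopologicalSpace B'] [TopologicalSpace X'] (T' : OpenSquare C' A' B' X')
    (fC : C(C', C)) (fA : C(A', A)) (fB : C(B', B)) (fX : C(X', X))
    (hiA : fA.comp T'.iA = T.iA.comp fC) (hiB : fB.comp T'.iB = T.iB.comp fC)
    (hjA : fX.comp T'.jA = T.jA.comp fA) (hjB : fX.comp T'.jB = T.jB.comp fB)
    (w : CohomologyRing C) : pull fX (T.delta w) = T'.delta (pull fC w) := by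
  refine ringHom_ext_of (f := (pull fX).toAddMonoidHom.comp T.delta)
    (g := T'.delta.comp (pull fC).toAddMonoidHom) (fun n w => ?_) w
  change pull fX (T.delta (DirectSum.of (Cohomology C) n w)) =
    T'.delta (pull fC (DirectSum.of (Cohomology C) n w))
  obtain ⟨a, b, ζ, hw, hA, hB, hw', hz⟩ := T.conn_deltaDegree w
  rw [delta_of, pull_of, pull_of, delta_of, ← hz, pullDegree_cls]
  congr 1
  symm
  have e : pullCochain T'.iA n (pullCochain fA n a) - pullCochain T'.iB n (pullCochain fB n b) =
      pullCochain fC n (pullCochain T.iA n a - pullCochain T.iB n b) := by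
    rw [map_sub, pullCochain_comp, pullCochain_comp, pullCochain_comp, pullCochain_comp, hiA, hiB]
  refine Conn.deltaDegree_eq T' ⟨pullCochain fA n a, pullCochain fB n b, _, ?_, ?_, ?_, ?_, rfl⟩
  · rw [e]
    exact pullCochain_mem_cocycles _ hw
  · dsimp only
    rw [pullCochain_comp, hjA, ← pullCochain_comp, hA, d_pullCochain]
  · dsimp only
    rw [pullCochain_comp, hjB, ← pullCochain_comp, hB, d_pullCochain]
  · rw [← hw', pullDegree_cls]
    exact congrArg cls (Subtype.ext e)

end OpenSquare

end SingularCohomology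
end

noncomputable section

namespace SingularCohomology

universe u v w u₁ u₂ u₃ u₄

/-! ### Products of classes that vanish on the sets of an open cover -/

section CoverProduct

variable {X : Type u} [TopologicalSpace X]

theorem mem_coboundaries_of_vanish_small {ι : Type*} {U : ι → Set X} (hU : ∀ i, IsOpen (U i))
    (hcov : ∀ x, ∃ i, x ∈ U i) {n : ℕ} {f : Cochain X n} (hd : f ∈ cocycles X n)
    (hf : ∀ σ, IsSmall U σ → f σ = 0) : f ∈ coboundaries X n := by
  cases n with
  | zero => exact funext fun σ => hf σ (isSmall_zero hcov σ)
  | succ n =>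
    obtain ⟨g, hg, -⟩ := exists_d_eq_of_vanish_small hU hcov hd hf
    exact ⟨g, hg⟩

/-- The inclusion of a subspace. -/
def incl (U : Set X) : C(U, X) := ⟨Subtype.val, continuous_subtype_val⟩

/-- This is the lift to relative cohomology: the representative is corrected by a coboundary
extended from `U`. -/
theorem exists_cls_eq_of_pull_incl {U : Set X} {n : ℕ} {x : Cohomology X n}
    (hx : pullDegree (incl U) n x = 0) :
    ∃ f : cocycles X n, cls f = x ∧ ∀ σ : Simplex X n, (∀ t, σ t ∈ U) → f.1 σ = 0 := by
  obtain ⟨f, rfl⟩ := cls_surjective x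
  rw [pullDegree_cls, cls_eq_zero] at hx
  obtain ⟨g, hg, hgf⟩ := exists_coboundary_extend (j := incl U) Subtype.val_injective hx
  refine ⟨⟨f.1 - g, sub_mem f.2 (coboundaries_le_cocycles n hg)⟩, ?_, fun σ hσ => ?_⟩
  · rw [cls_eq_cls]
    dsimp only
    rw [sub_sub_cancel_left]
    exact neg_mem hg
  · obtain ⟨τ, rfl⟩ := exists_comp_eq (j := incl U) (σ := σ) Topology.IsEmbedding.subtypeVal
      (fun t => ⟨⟨σ t, hσ t⟩, rfl⟩)
    have := congrFun hgf τ
    exact sub_eq_zero.2 this.symm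

/-- The relative cup product. With representatives that die on simplices of `U` and of `V`
respectively, the product dies on every simplex in `U` or in `V`; by subdivision it is then a
coboundary on `U ∪ V`. -/
theorem pull_incl_union_cupProduct {U V : Set X} (hU : IsOpen U) (hV : IsOpen V) {p q n : ℕ}
    (h : p + q = n) {x : Cohomology X p} {y : Cohomology X q}
    (hx : pullDegree (incl U) p x = 0) (hy : pullDegree (incl V) q y = 0) :
    pullDegree (incl (U ∪ V)) n (cupProduct h x y) = 0 := by
  obtain ⟨f, rfl, hf⟩ := exists_cls_eq_of_pull_incl hx
  obtain ⟨g, rfl, hg⟩ := exists_cls_eq_of_pull_incl hy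
  rw [cupProduct_cls, pullDegree_cls, cls_eq_zero]
  refine mem_coboundaries_of_vanish_small
    (U := fun i : Bool => (Subtype.val : (U ∪ V : Set X) → X) ⁻¹' (bif i then U else V)) ?_ ?_
    (pullCochain_mem_cocycles _ (cup_mem_cocycles h f.2 g.2)) ?_
  · rintro (_ | _)
    · exact hV.preimage continuous_subtype_val
    · exact hU.preimage continuous_subtype_val
  · rintro ⟨x, hx | hx⟩
    · exact ⟨true, hx⟩
    · exact ⟨false, hx⟩
  · rintro σ ⟨_ | _, hσ⟩
    · change f.1 _ * g.1 _ = 0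
      rw [hg _ fun t => hσ _, mul_zero]
    · change f.1 _ * g.1 _ = 0
      rw [hf _ fun t => hσ _, zero_mul]

theorem pull_incl_union_mul {U V : Set X} (hU : IsOpen U) (hV : IsOpen V)
    {x y : CohomologyRing X} (hx : pull (incl U) x = 0) (hy : pull (incl V) y = 0) :
    pull (incl (U ∪ V)) (x * y) = 0 := by
  classical
  rw [← DirectSum.sum_support_of x, ← DirectSum.sum_support_of y, Finset.sum_mul, map_sum]
  refine Finset.sum_eq_zero fun p _ => ?_
  rw [Finset.mul_sum, map_sum]
  refine Finset.sum_eq_zero fun q _ => ?_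
  rw [DirectSum.of_mul_of, pull_of]
  refine (congrArg _ ?_).trans (map_zero _)
  refine pull_incl_union_cupProduct hU hV rfl ?_ ?_
  · rw [← pull_apply, hx, DirectSum.zero_apply]
  · rw [← pull_apply, hy, DirectSum.zero_apply]

theorem subsingleton_cohomologyRing_of_isEmpty [IsEmpty X] : Subsingleton (CohomologyRing X) := by
  have h : ∀ n, Subsingleton (Cohomology X n) := fun n => by
    refine ⟨fun x y => ?_⟩
    obtain ⟨f, rfl⟩ := cls_surjective x
    obtain ⟨g, rfl⟩ := cls_surjective y
    congr 1
    ext σ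
    exact isEmptyElim (σ (vtx n 0))
  exact ⟨fun x y => DFinsupp.ext fun n => (h n).elim _ _⟩

/-- The Lusternik–Schnirelmann cup-length argument. -/
theorem list_prod_eq_zero_of_cover {ι : Type*} {U : ι → Set X} {x : ι → CohomologyRing X}
    {l : List ι} (hU : ∀ i ∈ l, IsOpen (U i)) (hx : ∀ i ∈ l, pull (incl (U i)) (x i) = 0)
    (hcov : ∀ p, ∃ i ∈ l, p ∈ U i) : (l.map x).prod = 0 := by
  suffices h : pull (incl {p | ∃ i ∈ l, p ∈ U i}) (l.map x).prod = 0 by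
    have hu : {p | ∃ i ∈ l, p ∈ U i} = Set.univ := Set.eq_univ_of_forall hcov
    rw [hu] at h
    exact (pull_homeomorph_bijective (Homeomorph.Set.univ X)).1 (h.trans (map_zero _).symm)
  clear hcov
  -- The induction runs over the union of the listed sets. For the empty list the product is `1`,
  -- which vanishes because the cohomology ring of the empty space is zero.
  suffices h : IsOpen {p | ∃ i ∈ l, p ∈ U i} ∧
      pull (incl {p | ∃ i ∈ l, p ∈ U i}) (l.map x).prod = 0 from h.2
  induction l with
  | nil =>
    have he : {p : X | ∃ i ∈ ([] : List ι), p ∈ U i} = ∅ := by simp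
    rw [he]
    have := subsingleton_cohomologyRing_of_isEmpty (X := (∅ : Set X))
    exact ⟨isOpen_empty, Subsingleton.elim _ _⟩
  | cons a l ih =>
    have he : {p : X | ∃ i ∈ a :: l, p ∈ U i} = U a ∪ {p | ∃ i ∈ l, p ∈ U i} := by
      ext p
      simp
    obtain ⟨h1, h2⟩ := ih (fun i hi => hU i (List.mem_cons_of_mem _ hi))
      (fun i hi => hx i (List.mem_cons_of_mem _ hi))
    rw [he, List.map_cons, List.prod_cons]
    exact ⟨(hU a List.mem_cons_self).union h1,
      pull_incl_union_mul (hU a List.mem_cons_self) h1 (hx a List.mem_cons_self) h2⟩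

end CoverProduct

/-! ### Sphere classes -/

/-- The product of a square with a space. -/
def OpenSquare.prod {C : Type u₁} {A : Type u₂} {B : Type u₃} {X : Type u₄} [TopologicalSpace C]
    [TopologicalSpace A] [TopologicalSpace B] [TopologicalSpace X] (T : OpenSquare C A B X)
    (Y : Type u) [TopologicalSpace Y] : OpenSquare (C × Y) (A × Y) (B × Y) (X × Y) where
  iA := T.iA.prodMap (ContinuousMap.id Y)
  iB := T.iB.prodMap (ContinuousMap.id Y)
  jA := T.jA.prodMap (ContinuousMap.id Y)
  jB := T.jB.prodMap (ContinuousMap.id Y)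
  comm := by
    ext p : 1
    exact Prod.ext (DFunLike.congr_fun T.comm p.1) rfl
  isEmbedding_iA := T.isEmbedding_iA.prodMap Topology.IsEmbedding.id
  isOpenEmbedding_jA := T.isOpenEmbedding_jA.prodMap Topology.IsOpenEmbedding.id
  isOpenEmbedding_jB := T.isOpenEmbedding_jB.prodMap Topology.IsOpenEmbedding.id
  cover := by
    rintro ⟨x, y⟩
    rcases T.cover x with ⟨a, rfl⟩ | ⟨b, rfl⟩
    · exact Or.inl ⟨(a, y), rfl⟩
    · exact Or.inr ⟨(b, y), rfl⟩
  exists_of_eq := by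
    rintro ⟨a, y⟩ ⟨b, y'⟩ h
    obtain ⟨c, rfl, rfl⟩ := T.exists_of_eq a b (congrArg Prod.fst h)
    obtain rfl : y = y' := congrArg Prod.snd h
    exact ⟨(c, y), rfl, rfl⟩

section Sphere

variable {P : Type u₁} [TopologicalSpace P]

/-- The map `(y, z) ↦ 1 × y + s × z` from pairs of classes of `Y` to classes of `P × Y`. -/
def crossMap (s : CohomologyRing P) (Y : Type u) [TopologicalSpace Y] :
    CohomologyRing Y × CohomologyRing Y →+ CohomologyRing (P × Y) :=
  AddMonoidHom.mk' (fun yz => pull (ContinuousMap.snd : C(P × Y, Y)) yz.1 +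
    pull (ContinuousMap.fst : C(P × Y, P)) s * pull (ContinuousMap.snd : C(P × Y, Y)) yz.2)
    fun yz yz' => by
      simp only [Prod.fst_add, Prod.snd_add, map_add, mul_add]
      abel

theorem crossMap_apply (s : CohomologyRing P) {Y : Type u} [TopologicalSpace Y]
    (y z : CohomologyRing Y) :
    crossMap s Y (y, z) = pull (ContinuousMap.snd : C(P × Y, Y)) y +
      pull (ContinuousMap.fst : C(P × Y, P)) s * pull (ContinuousMap.snd : C(P × Y, Y)) z := rfl

/-- A class `s` of `P` such that `H^•(P × Y)` is free over `H^•(Y)` with basis `1`, `s`, for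
every `Y`. -/
def IsSphereClass (s : CohomologyRing P) : Prop :=
  ∀ (Y : Type u) [TopologicalSpace Y], Function.Bijective (crossMap s Y)

theorem IsSphereClass.exists_eq {s : CohomologyRing P} (hs : IsSphereClass.{u} s) {Y : Type u}
    [TopologicalSpace Y] (x : CohomologyRing (P × Y)) :
    ∃ y z, x = pull (ContinuousMap.snd : C(P × Y, Y)) y +
      pull (ContinuousMap.fst : C(P × Y, P)) s * pull (ContinuousMap.snd : C(P × Y, Y)) z := by
  obtain ⟨⟨y, z⟩, h⟩ := (hs Y).2 x
  exact ⟨y, z, h.symm⟩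

theorem IsSphereClass.eq_zero {s : CohomologyRing P} (hs : IsSphereClass.{u} s) {Y : Type u}
    [TopologicalSpace Y] {y z : CohomologyRing Y}
    (h : pull (ContinuousMap.snd : C(P × Y, Y)) y +
      pull (ContinuousMap.fst : C(P × Y, P)) s * pull (ContinuousMap.snd : C(P × Y, Y)) z = 0) :
    y = 0 ∧ z = 0 := by
  have := (hs Y).1 ((crossMap_apply s y z).trans (h.trans (map_zero (crossMap s Y)).symm))
  exact Prod.mk_eq_zero.1 this

theorem isSphereClass_of {s : CohomologyRing P}
    (h1 : ∀ (Y : Type u) [TopologicalSpace Y] (x : CohomologyRing (P × Y)),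
      ∃ y z, x = pull (ContinuousMap.snd : C(P × Y, Y)) y +
      pull (ContinuousMap.fst : C(P × Y, P)) s * pull (ContinuousMap.snd : C(P × Y, Y)) z)
    (h2 : ∀ (Y : Type u) [TopologicalSpace Y] (y z : CohomologyRing Y),
      pull (ContinuousMap.snd : C(P × Y, Y)) y +
      pull (ContinuousMap.fst : C(P × Y, P)) s * pull (ContinuousMap.snd : C(P × Y, Y)) z = 0 →
      y = 0 ∧ z = 0) : IsSphereClass.{u} s := by
  intro Y _
  refine ⟨(injective_iff_map_eq_zero _).2 ?_, fun x => ?_⟩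
  · rintro ⟨y, z⟩ h
    exact Prod.mk_eq_zero.2 (h2 Y y z h)
  · obtain ⟨y, z, h⟩ := h1 Y x
    exact ⟨(y, z), h.symm⟩

theorem IsSphereClass.pull {Q : Type u₂} [TopologicalSpace Q] {s : CohomologyRing P}
    (hs : IsSphereClass.{u} s) {F : C(Q, P)} {G : C(P, Q)}
    (h : (F.comp G).Homotopic (ContinuousMap.id P)) (h' : (G.comp F).Homotopic (ContinuousMap.id Q)) :
    IsSphereClass.{u} (pull F s) := by
  intro Y _
  have hb : Function.Bijective (SingularCohomology.pull (F.prodMap (ContinuousMap.id Y))) :=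
    pull_bijective (G := G.prodMap (ContinuousMap.id Y))
      (h.prodMap (ContinuousMap.Homotopic.refl (ContinuousMap.id Y)))
      (h'.prodMap (ContinuousMap.Homotopic.refl (ContinuousMap.id Y)))
  have e : ⇑(crossMap (SingularCohomology.pull F s) Y) =
      SingularCohomology.pull (F.prodMap (ContinuousMap.id Y)) ∘ crossMap s Y := by
    ext1 ⟨y, z⟩
    rw [Function.comp_apply, crossMap_apply, crossMap_apply, map_add, map_mul, ← pull_comp,
      ← pull_comp, ← pull_comp, ← pull_comp]
    rfl
  rw [e]
  exact hb.comp (hs Y)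

theorem IsSphereClass.neg {s : CohomologyRing P} (hs : IsSphereClass.{u} s) :
    IsSphereClass.{u} (-s) := by
  refine isSphereClass_of (fun Y _ x => ?_) fun Y _ y z h => ?_
  · obtain ⟨y, z, h⟩ := hs.exists_eq x
    exact ⟨y, -z, by rw [h, map_neg, map_neg, neg_mul_neg]⟩
  · rw [map_neg, neg_mul, ← mul_neg, ← map_neg] at h
    obtain ⟨h1, h2⟩ := hs.eq_zero h
    exact ⟨h1, neg_eq_zero.1 h2⟩

variable {C : Type u₁} {A : Type u₂} {B : Type u₃} {X : Type u₄} [TopologicalSpace C]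
    [TopologicalSpace A] [TopologicalSpace B] [TopologicalSpace X]

/-- Suspension. With `A` and `B` contractible, the classes on `A × Y` and `B × Y` are exactly the `1
× y`. The connecting map kills these and sends `s × z` to `δs × z`. -/
theorem IsSphereClass.delta (T : OpenSquare C A B X) [ContractibleSpace A] [ContractibleSpace B]
    [Nonempty C] {s : CohomologyRing C} (hs : IsSphereClass.{u} s) :
    IsSphereClass.{u} (T.delta s) := by
  have hcross : ∀ (Y : Type u) [TopologicalSpace Y] (z : CohomologyRing Y),
      SingularCohomology.pull (ContinuousMap.fst : C(X × Y, X)) (T.delta s) *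
        SingularCohomology.pull (ContinuousMap.snd : C(X × Y, Y)) z =
      (T.prod Y).delta (SingularCohomology.pull (ContinuousMap.fst : C(C × Y, C)) s *
        SingularCohomology.pull (ContinuousMap.snd : C(C × Y, Y)) z) := by
    intro Y _ z
    rw [T.pull_delta (T.prod Y) ContinuousMap.fst ContinuousMap.fst ContinuousMap.fst
      ContinuousMap.fst rfl rfl rfl rfl, ← OpenSquare.delta_mul, ← pull_comp]
    rfl
  have hA : ∀ (Y : Type u) [TopologicalSpace Y] (y : CohomologyRing Y),
      SingularCohomology.pull (T.prod Y).jA (SingularCohomology.pull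
        (ContinuousMap.snd : C(X × Y, Y)) y) =
      SingularCohomology.pull (ContinuousMap.snd : C(A × Y, Y)) y := fun Y _ y =>
    (pull_comp _ _ _).symm
  have hB : ∀ (Y : Type u) [TopologicalSpace Y] (y : CohomologyRing Y),
      SingularCohomology.pull (T.prod Y).jB (SingularCohomology.pull
        (ContinuousMap.snd : C(X × Y, Y)) y) =
      SingularCohomology.pull (ContinuousMap.snd : C(B × Y, Y)) y := fun Y _ y =>
    (pull_comp _ _ _).symm
  have hiA : ∀ (Y : Type u) [TopologicalSpace Y] (y : CohomologyRing Y),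
      SingularCohomology.pull (T.prod Y).iA (SingularCohomology.pull
        (ContinuousMap.snd : C(A × Y, Y)) y) =
      SingularCohomology.pull (ContinuousMap.snd : C(C × Y, Y)) y := fun Y _ y =>
    (pull_comp _ _ _).symm
  have hiB : ∀ (Y : Type u) [TopologicalSpace Y] (y : CohomologyRing Y),
      SingularCohomology.pull (T.prod Y).iB (SingularCohomology.pull
        (ContinuousMap.snd : C(B × Y, Y)) y) =
      SingularCohomology.pull (ContinuousMap.snd : C(C × Y, Y)) y := fun Y _ y =>
    (pull_comp _ _ _).symm
  refine isSphereClass_of (fun Y _ x => ?_) fun Y _ y z h => ?_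
  · obtain ⟨y, hy⟩ := (pull_snd_bijective (X := A) (Y := Y)).2
      (SingularCohomology.pull (T.prod Y).jA x)
    obtain ⟨y', hy'⟩ := (pull_snd_bijective (X := B) (Y := Y)).2
      (SingularCohomology.pull (T.prod Y).jB x)
    -- The restrictions to `A × Y` and `B × Y` agree on `C × Y`, and `H^•(Y)` injects there because
    -- `C` is nonempty.
    obtain rfl : y = y' := by
      apply pull_snd_injective (X := C)
      rw [← hiA, ← hiB, hy, hy', ← pull_comp, ← pull_comp, (T.prod Y).comm]
    obtain ⟨w, hw⟩ := (T.prod Y).exists_delta_eq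
      (z := x - SingularCohomology.pull (ContinuousMap.snd : C(X × Y, Y)) y)
      (by rw [map_sub, hA, hy, sub_self]) (by rw [map_sub, hB, hy', sub_self])
    obtain ⟨y₁, z, rfl⟩ := hs.exists_eq w
    refine ⟨y, z, ?_⟩
    rw [map_add, ← hiA, OpenSquare.delta_pull_iA, zero_add] at hw
    rw [hcross, hw, add_sub_cancel]
  · have hy : y = 0 := by
      have := congrArg (SingularCohomology.pull (T.prod Y).jA) h
      rw [hcross, map_add, OpenSquare.pull_jA_delta, add_zero, hA, map_zero] at this
      exact pull_snd_bijective.1 (this.trans (map_zero _).symm)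
    refine ⟨hy, ?_⟩
    rw [hy, map_zero, zero_add, hcross] at h
    -- Exactness writes `s × z` as a sum of classes from the two contractible sides, hence as some
    -- `1 × y`; freeness on `C × Y` then forces `z = 0`.
    obtain ⟨a, b, hab⟩ := (T.prod Y).exists_of_delta_eq_zero h
    obtain ⟨a, rfl⟩ := pull_snd_bijective.2 a
    obtain ⟨b, rfl⟩ := pull_snd_bijective.2 b
    rw [hiA, hiB, ← map_add, eq_comm, ← sub_eq_zero, sub_eq_add_neg, ← mul_neg, ← map_neg] at hab
    exact neg_eq_zero.1 (hs.eq_zero hab).2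

/-- The zero-sphere: `X` is the disjoint union of two contractible pieces and `s` is the indicator
of the first, so `1 × y + s × z` restricts to `y + z` and `y`. -/
theorem isSphereClass_of_isEmpty (T : OpenSquare C A B X) [IsEmpty C] [ContractibleSpace A]
    [ContractibleSpace B] {s : CohomologyRing X} (hA : pull T.jA s = 1) (hB : pull T.jB s = 0) :
    IsSphereClass.{u} s := by
  have hsA : ∀ (Y : Type u) [TopologicalSpace Y] (y z : CohomologyRing Y),
      pull (T.prod Y).jA (pull (ContinuousMap.snd : C(X × Y, Y)) y +
        pull (ContinuousMap.fst : C(X × Y, X)) s * pull (ContinuousMap.snd : C(X × Y, Y)) z) =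
      pull (ContinuousMap.snd : C(A × Y, Y)) (y + z) := by
    intro Y _ y z
    have : (ContinuousMap.fst : C(X × Y, X)).comp (T.prod Y).jA = T.jA.comp ContinuousMap.fst := rfl
    rw [map_add, map_mul, ← pull_comp, ← pull_comp, ← pull_comp, this, pull_comp _ T.jA, hA,
      map_one, one_mul, map_add]
    rfl
  have hsB : ∀ (Y : Type u) [TopologicalSpace Y] (y z : CohomologyRing Y),
      pull (T.prod Y).jB (pull (ContinuousMap.snd : C(X × Y, Y)) y +
        pull (ContinuousMap.fst : C(X × Y, X)) s * pull (ContinuousMap.snd : C(X × Y, Y)) z) =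
      pull (ContinuousMap.snd : C(B × Y, Y)) y := by
    intro Y _ y z
    have : (ContinuousMap.fst : C(X × Y, X)).comp (T.prod Y).jB = T.jB.comp ContinuousMap.fst := rfl
    rw [map_add, map_mul, ← pull_comp, ← pull_comp, ← pull_comp, this, pull_comp _ T.jB, hB,
      map_zero, zero_mul, add_zero]
    rfl
  refine isSphereClass_of (fun Y _ x => ?_) fun Y _ y z h => ?_
  · obtain ⟨y, hy⟩ := (pull_snd_bijective (X := A) (Y := Y)).2 (pull (T.prod Y).jA x)
    obtain ⟨y', hy'⟩ := (pull_snd_bijective (X := B) (Y := Y)).2 (pull (T.prod Y).jB x)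
    refine ⟨y', y - y', ?_⟩
    rw [← sub_eq_zero]
    obtain ⟨w, hw⟩ := (T.prod Y).exists_delta_eq (z := x - (pull (ContinuousMap.snd : C(X × Y, Y)) y' +
        pull (ContinuousMap.fst : C(X × Y, X)) s * pull (ContinuousMap.snd : C(X × Y, Y)) (y - y')))
      (by rw [map_sub, hsA, add_sub_cancel, hy, sub_self]) (by rw [map_sub, hsB, hy', sub_self])
    have := subsingleton_cohomologyRing_of_isEmpty (X := C × Y)
    rw [← hw, Subsingleton.elim w 0, map_zero]
  · have h1 := congrArg (pull (T.prod Y).jA) h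
    have h2 := congrArg (pull (T.prod Y).jB) h
    rw [hsA, map_zero] at h1
    rw [hsB, map_zero] at h2
    have h3 := pull_snd_bijective.1 (h1.trans (map_zero _).symm)
    have h4 := pull_snd_bijective.1 (h2.trans (map_zero _).symm)
    rw [h4, zero_add] at h3
    exact ⟨h4, h3⟩

end Sphere

end SingularCohomology
end

noncomputable section

namespace SingularCohomology

universe u v w u₁ u₂ u₃ u₄

/-! ### The sphere class of a punctured vector space -/

section Punctured

/-- The inclusion between subtypes. -/
def subtypeIncl {X : Type u} [TopologicalSpace X] {p q : X → Prop} (h : ∀ x, p x → q x) :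
    C({x // p x}, {x // q x}) :=
  ⟨Subtype.map id h, continuous_subtype_val.subtype_mk _⟩

theorem isEmbedding_subtypeIncl {X : Type u} [TopologicalSpace X] {p q : X → Prop}
    (h : ∀ x, p x → q x) : Topology.IsEmbedding (subtypeIncl h) :=
  Topology.IsEmbedding.of_comp (subtypeIncl h).continuous continuous_subtype_val
    Topology.IsEmbedding.subtypeVal

theorem isOpenEmbedding_subtypeIncl {X : Type u} [TopologicalSpace X] {p q : X → Prop}
    (h : ∀ x, p x → q x) (hp : IsOpen {x | p x}) : Topology.IsOpenEmbedding (subtypeIncl h) := by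
  refine ⟨isEmbedding_subtypeIncl h, ?_⟩
  have : Set.range (subtypeIncl h) = Subtype.val ⁻¹' {x | p x} := by
    ext x
    exact ⟨by rintro ⟨y, rfl⟩; exact y.2, fun hx => ⟨⟨x.1, hx⟩, rfl⟩⟩
  rw [this]
  exact hp.preimage continuous_subtype_val

/-- The cover of the punctured line by two half-lines. -/
def lineSquare : OpenSquare Empty {x : ℝ // 0 < x} {x : ℝ // x < 0} {x : ℝ // x ≠ 0} where
  iA := ⟨Empty.elim, by fun_prop⟩
  iB := ⟨Empty.elim, by fun_prop⟩
  jA := subtypeIncl fun _ h => ne_of_gt h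
  jB := subtypeIncl fun _ h => ne_of_lt h
  comm := by
    ext x
    exact x.elim
  isEmbedding_iA := Topology.IsEmbedding.of_subsingleton _
  isOpenEmbedding_jA := isOpenEmbedding_subtypeIncl _ isOpen_Ioi
  isOpenEmbedding_jB := isOpenEmbedding_subtypeIncl _ isOpen_Iio
  cover := by
    rintro ⟨x, hx⟩
    rcases lt_or_gt_of_ne hx with h | h
    · exact Or.inr ⟨⟨x, h⟩, rfl⟩
    · exact Or.inl ⟨⟨x, h⟩, rfl⟩
  exists_of_eq := by
    rintro ⟨a, ha⟩ ⟨b, hb⟩ h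
    have : a = b := congrArg Subtype.val h
    exact absurd (ha.trans (this ▸ hb)) (lt_irrefl _)

/-- The start of the suspensions: the class that is `1` on the positive half-line and `0` on the
negative one. -/
theorem exists_isSphereClass_real :
    ∃ s ∈ degreePart {x : ℝ // x ≠ 0} 0, IsSphereClass.{u} s := by
  obtain ⟨z, hzA, hzB⟩ := lineSquare.exists_cohomology_glue (n := 0) (unitClass _) 0 (by
    have := subsingleton_cohomologyRing_of_isEmpty (X := Empty)
    exact DirectSum.of_injective (β := Cohomology Empty) 0 (Subsingleton.elim _ _))
  have : ContractibleSpace {x : ℝ // 0 < x} :=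
    (convex_Ioi (0 : ℝ)).contractibleSpace ⟨1, Set.mem_Ioi.2 one_pos⟩
  have : ContractibleSpace {x : ℝ // x < 0} :=
    (convex_Iio (0 : ℝ)).contractibleSpace ⟨-1, Set.mem_Iio.2 neg_one_lt_zero⟩
  refine ⟨DirectSum.of _ 0 z, of_mem_degreePart 0 z, isSphereClass_of_isEmpty lineSquare ?_ ?_⟩
  · rw [pull_of, hzA]
    rfl
  · rw [pull_of, hzB, map_zero]

variable (E : Type u₁) [NormedAddCommGroup E] [NormedSpace ℝ E]

/-- The cover of `(E × ℝ) ∖ {0}` by the complements of two opposite half-lines. -/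
def suspensionSquare : OpenSquare {p : E × ℝ // p.1 ≠ 0} {p : E × ℝ // p.1 ≠ 0 ∨ 0 < p.2}
    {p : E × ℝ // p.1 ≠ 0 ∨ p.2 < 0} {p : E × ℝ // p ≠ 0} where
  iA := subtypeIncl fun _ h => Or.inl h
  iB := subtypeIncl fun _ h => Or.inl h
  jA := subtypeIncl fun p h h0 => by
    subst h0
    simp at h
  jB := subtypeIncl fun p h h0 => by
    subst h0
    simp at h
  comm := rfl
  isEmbedding_iA := isEmbedding_subtypeIncl _
  isOpenEmbedding_jA := isOpenEmbedding_subtypeIncl _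
    ((isOpen_ne_fun continuous_fst continuous_const).union
      (isOpen_lt continuous_const continuous_snd))
  isOpenEmbedding_jB := isOpenEmbedding_subtypeIncl _
    ((isOpen_ne_fun continuous_fst continuous_const).union
      (isOpen_lt continuous_snd continuous_const))
  cover := by
    rintro ⟨⟨x, t⟩, h⟩
    by_cases hx : x = 0
    · have ht : t ≠ 0 := fun ht => h (by rw [hx, ht]; rfl)
      rcases lt_or_gt_of_ne ht with h' | h'
      · exact Or.inr ⟨⟨(x, t), Or.inr h'⟩, rfl⟩
      · exact Or.inl ⟨⟨(x, t), Or.inr h'⟩, rfl⟩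
    · exact Or.inl ⟨⟨(x, t), Or.inl hx⟩, rfl⟩
  exists_of_eq := by
    rintro ⟨a, ha⟩ ⟨b, hb⟩ h
    obtain rfl : a = b := congrArg Subtype.val h
    have hn : a.1 ≠ 0 := by
      rcases ha with ha | ha
      · exact ha
      · rcases hb with hb | hb
        · exact hb
        · exact absurd (ha.trans hb) (lt_irrefl _)
    exact ⟨⟨a, hn⟩, rfl, rfl⟩

theorem contractibleSpace_upper : ContractibleSpace {p : E × ℝ // p.1 ≠ 0 ∨ 0 < p.2} := by
  refine StarConvex.contractibleSpace (s := {p : E × ℝ | p.1 ≠ 0 ∨ 0 < p.2})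
    (x := ((0 : E), (1 : ℝ))) ?_ ⟨((0 : E), (1 : ℝ)), Or.inr one_pos⟩
  intro y hy a b ha hb hab
  simp only [Set.mem_ofPred_eq, Prod.fst_add, Prod.smul_fst, smul_zero, zero_add, Prod.snd_add,
    Prod.smul_snd, smul_eq_mul, mul_one]
  rcases hb.eq_or_lt with rfl | hb
  · right
    simp at hab
    simp [hab]
  · rcases hy with hy | hy
    · exact Or.inl (smul_ne_zero hb.ne' hy)
    · exact Or.inr (by positivity)

theorem contractibleSpace_lower : ContractibleSpace {p : E × ℝ // p.1 ≠ 0 ∨ p.2 < 0} := by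
  have := contractibleSpace_upper E
  let e : E × ℝ ≃ₜ E × ℝ := (Homeomorph.refl E).prodCongr (Homeomorph.neg ℝ)
  have e' : {p : E × ℝ // p.1 ≠ 0 ∨ p.2 < 0} ≃ₜ {p : E × ℝ // p.1 ≠ 0 ∨ 0 < p.2} :=
    e.subtype fun p => by
      change _ ↔ p.1 ≠ 0 ∨ 0 < -p.2
      rw [neg_pos]
  exact e'.contractibleSpace

variable {E}

/-- Passing from a punctured vector space `E` to `E × ℝ`. -/
theorem exists_isSphereClass_prod_real [Nontrivial E] {n : ℕ}
    (h : ∃ s ∈ degreePart {x : E // x ≠ 0} n, IsSphereClass.{u} s) :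
    ∃ s ∈ degreePart {p : E × ℝ // p ≠ 0} (n + 1), IsSphereClass.{u} s := by
  obtain ⟨s, hsn, hs⟩ := h
  let F : C({p : E × ℝ // p.1 ≠ 0}, {x : E // x ≠ 0}) :=
    ⟨fun p => ⟨p.1.1, p.2⟩, by fun_prop⟩
  let G : C({x : E // x ≠ 0}, {p : E × ℝ // p.1 ≠ 0}) :=
    ⟨fun x => ⟨(x.1, 0), x.2⟩, by fun_prop⟩
  have hFG : (F.comp G).Homotopic (ContinuousMap.id _) := ContinuousMap.Homotopic.refl _
  -- The homotopy scales the real coordinate linearly and never touches the nonzero component in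
  -- `E`.
  have hGF : (G.comp F).Homotopic (ContinuousMap.id _) :=
    ⟨{ toFun := fun x => ⟨(x.2.1.1, (x.1 : ℝ) * x.2.1.2), x.2.2⟩
       continuous_toFun := by fun_prop
       map_zero_left := fun p => by
         ext
         · rfl
         · simp [G, F]
       map_one_left := fun p => by
         ext
         · rfl
         · simp }⟩
  have := contractibleSpace_upper E
  have := contractibleSpace_lower E
  have : Nonempty {p : E × ℝ // p.1 ≠ 0} := by
    obtain ⟨x, hx⟩ := exists_ne (0 : E)
    exact ⟨⟨(x, 0), hx⟩⟩
  have h1 := hs.pull hFG hGF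
  have h2 := pull_mem_degreePart F hsn
  generalize pull F s = t at h1 h2
  exact ⟨(suspensionSquare E).delta t, OpenSquare.delta_mem_degreePart _ h2,
    IsSphereClass.delta (suspensionSquare E) h1⟩

/-- Three suspensions lead from the punctured line to the punctured `ℝ⁴`, which is `ℍˣ`. -/
theorem exists_isSphereClass_units :
    ∃ s ∈ degreePart ℍ[ℝ]ˣ 3, IsSphereClass.{u} s := by
  have h₁ := exists_isSphereClass_prod_real (E := ℝ) exists_isSphereClass_real.{u}
  have h₂ := exists_isSphereClass_prod_real (E := ℝ × ℝ) h₁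
  obtain ⟨s, hs3, hs⟩ := exists_isSphereClass_prod_real (E := (ℝ × ℝ) × ℝ) h₂
  let l : ℍ[ℝ] ≃L[ℝ] ((ℝ × ℝ) × ℝ) × ℝ := ContinuousLinearEquiv.ofFinrankEq (by
    rw [Quaternion.finrank_eq_four]
    simp)
  let e : ℍ[ℝ]ˣ ≃ₜ {p : ((ℝ × ℝ) × ℝ) × ℝ // p ≠ 0} :=
    unitsHomeomorphNeZero.trans (l.toHomeomorph.subtype fun x => by
      change x ≠ 0 ↔ l x ≠ 0
      simp)
  refine ⟨pull (e : C(_, _)) s, pull_mem_degreePart _ hs3, hs.pull (G := (e.symm : C(_, _))) ?_ ?_⟩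
  · rw [Homeomorph.toContinuousMap_comp_symm]
  · rw [Homeomorph.symm_comp_toContinuousMap]

end Punctured

end SingularCohomology

namespace QuaternionicArrangement

open SingularCohomology

universe u

/-! ### The cohomology of the group of units of the quaternions -/

section Units

/-- A homogeneous sphere class of positive degree `n` generates the cohomology in degree `n`. -/
theorem exists_zsmul_of_isSphereClass {P : Type*} [TopologicalSpace P] {s : CohomologyRing P}
    (hs : IsSphereClass.{u} s) (x : CohomologyRing P) :
    ∃ k m : ℤ, x = (k : CohomologyRing P) + m • s := by
  -- Freeness is applied with a point as second factor, whose cohomology ring is `ℤ`.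
  obtain ⟨y, z, h⟩ := hs.exists_eq (Y := PUnit) (pull ContinuousMap.fst x)
  obtain ⟨k, rfl⟩ := exists_intCast_of_unique y
  obtain ⟨m, rfl⟩ := exists_intCast_of_unique z
  refine ⟨k, m, ?_⟩
  let i : C(P, P × PUnit.{u + 1}) := (ContinuousMap.id P).prodMk (ContinuousMap.const P PUnit.unit)
  have h1 : (ContinuousMap.fst : C(P × PUnit.{u + 1}, P)).comp i = ContinuousMap.id P := rfl
  have h2 := congrArg (pull i) h
  rw [← pull_comp, h1, pull_id] at h2
  rw [h2]
  simp only [map_add, map_mul, map_intCast]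
  rw [← pull_comp, h1, pull_id, ← zsmul_eq_mul']

theorem zsmul_eq_zero_of_isSphereClass {P : Type*} [TopologicalSpace P] {s : CohomologyRing P}
    (hs : IsSphereClass.{u} s) {m : ℤ} (h : m • s = 0) : m = 0 := by
  have h1 := congrArg (pull (ContinuousMap.fst : C(P × PUnit.{u + 1}, P))) h
  rw [map_zsmul, map_zero, zsmul_eq_mul'] at h1
  have h2 := (hs.eq_zero (Y := PUnit) (y := 0) (z := (m : CohomologyRing PUnit.{u + 1}))
    (by rw [map_zero, zero_add, map_intCast, h1])).2
  exact intCast_eq_zero h2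

theorem exists_zsmul_of_mem_degreePart {P : Type*} [TopologicalSpace P] {s : CohomologyRing P}
    (hs : IsSphereClass.{u} s) {n : ℕ} (hn : n ≠ 0) (hsn : s ∈ degreePart P n)
    {x : CohomologyRing P} (hx : x ∈ degreePart P n) : ∃ m : ℤ, x = m • s := by
  obtain ⟨k, m, h⟩ := exists_zsmul_of_isSphereClass hs x
  refine ⟨m, ?_⟩
  rw [← sub_eq_zero]
  refine eq_zero_of_mem_degreePart hn (sub_mem hx (zsmul_mem hsn m)) ?_
  rw [h, add_sub_cancel_right]
  exact intCast_mem_degreePart k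

theorem eq_zero_of_isSphereClass {P : Type*} [TopologicalSpace P] {s : CohomologyRing P}
    (hs : IsSphereClass.{u} s) {n r : ℕ} (hr : r ≠ 0) (hrn : r ≠ n) (hsn : s ∈ degreePart P n)
    {x : CohomologyRing P} (hx : x ∈ degreePart P r) : x = 0 := by
  classical
  obtain ⟨k, m, h⟩ := exists_zsmul_of_isSphereClass hs x
  obtain ⟨x, rfl⟩ := hx
  have hk := intCast_mem_degreePart (X := P) k
  obtain ⟨y, hy⟩ := hk
  obtain ⟨z, hz⟩ := zsmul_mem hsn m
  rw [← hy, ← hz] at h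
  have := congrArg (fun x : CohomologyRing P => x r) h
  simp only [DirectSum.add_apply, DirectSum.of_eq_same, DirectSum.of_eq_of_ne _ _ _ hr,
    DirectSum.of_eq_of_ne _ _ _ hrn, add_zero] at this
  rw [this, map_zero]

theorem exists_isGenerator : ∃ s : Cohomology ℍ[ℝ]ˣ 3, IsGenerator s := by
  obtain ⟨s, ⟨s, rfl⟩, hs⟩ := exists_isSphereClass_units.{0}
  refine ⟨s, fun m n hmn => ?_, fun x => ?_⟩
  · have : (m - n) • DirectSum.of (Cohomology ℍ[ℝ]ˣ) 3 s = 0 := by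
      have hmn' : m • s = n • s := hmn
      rw [← map_zsmul, sub_zsmul, hmn', add_neg_cancel, map_zero]
    exact sub_eq_zero.1 (zsmul_eq_zero_of_isSphereClass hs this)
  · obtain ⟨m, hm⟩ := exists_zsmul_of_mem_degreePart hs (by norm_num) (of_mem_degreePart 3 s)
      (of_mem_degreePart 3 x)
    rw [← map_zsmul] at hm
    exact ⟨m, (DirectSum.of_injective (β := Cohomology ℍ[ℝ]ˣ) 3 hm).symm⟩

variable {s : Cohomology ℍ[ℝ]ˣ 3}

/-- Any generator is an integer multiple of the constructed class and conversely, so they agree up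
to sign. -/
theorem isSphereClass_of_isGenerator (hs : IsGenerator s) :
    IsSphereClass.{u} (DirectSum.of (Cohomology ℍ[ℝ]ˣ) 3 s) := by
  obtain ⟨t, ht3, ht⟩ := exists_isSphereClass_units.{u}
  obtain ⟨m, hm⟩ := exists_zsmul_of_mem_degreePart ht (by norm_num) ht3 (of_mem_degreePart 3 s)
  obtain ⟨t, rfl⟩ := ht3
  obtain ⟨n, hn⟩ := hs.2 t
  dsimp only at hn
  have h1 : (m * n - 1) • DirectSum.of (Cohomology ℍ[ℝ]ˣ) 3 t = 0 := by
    rw [sub_zsmul, mul_comm, mul_zsmul, ← hm, one_zsmul, ← map_zsmul, hn, add_neg_cancel]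
  have h2 : m * n = 1 := sub_eq_zero.1 (zsmul_eq_zero_of_isSphereClass ht h1)
  rcases Int.eq_one_or_neg_one_of_mul_eq_one h2 with rfl | rfl
  · rw [hm, one_zsmul]
    exact ht
  · rw [hm, neg_zsmul, one_zsmul]
    exact ht.neg

/-- The class `s` as an element of the cohomology ring. -/
abbrev ringClass (s : Cohomology ℍ[ℝ]ˣ 3) : CohomologyRing ℍ[ℝ]ˣ := DirectSum.of (Cohomology ℍ[ℝ]ˣ) 3 s

/-- The cohomology of `ℍˣ` lives in degrees `0` and `3`, and the square has degree `6`. -/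
theorem ringClass_mul_self (hs : IsGenerator s) : ringClass s * ringClass s = 0 :=
  eq_zero_of_isSphereClass (isSphereClass_of_isGenerator.{0} hs) (r := 6) (by norm_num)
    (by norm_num) (of_mem_degreePart 3 s)
    (mul_mem_degreePart (m := 3) (n := 3) (of_mem_degreePart 3 s) (of_mem_degreePart 3 s))

/-- The multiplication of units. -/
def unitsMul : C(ℍ[ℝ]ˣ × ℍ[ℝ]ˣ, ℍ[ℝ]ˣ) := ⟨fun p => p.1 * p.2, continuous_mul⟩

theorem pull_const_ringClass {X : Type*} [TopologicalSpace X] (q : ℍ[ℝ]ˣ) :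
    pull (ContinuousMap.const X q) (ringClass s) = 0 := by
  have h1 : ContinuousMap.const X q =
      (ContinuousMap.const PUnit.{1} q).comp (ContinuousMap.const X PUnit.unit) := rfl
  rw [h1, pull_comp, pull_of, cls_eq_zero_of_subsingleton (pullDegree _ 3 s), map_zero, map_zero]

/-- The generator of `H³(ℍˣ)` is primitive. -/
theorem pull_unitsMul (hs : IsGenerator s) :
    pull unitsMul (ringClass s) =
      pull ContinuousMap.fst (ringClass s) + pull ContinuousMap.snd (ringClass s) := by
  have hS := isSphereClass_of_isGenerator.{0} hs
  have hs3 := of_mem_degreePart 3 s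
  obtain ⟨y, z, h⟩ := hS.exists_eq (pull unitsMul (ringClass s))
  let i₁ : C(ℍ[ℝ]ˣ, ℍ[ℝ]ˣ × ℍ[ℝ]ˣ) := (ContinuousMap.id _).prodMk (ContinuousMap.const _ 1)
  let i₂ : C(ℍ[ℝ]ˣ, ℍ[ℝ]ˣ × ℍ[ℝ]ˣ) := (ContinuousMap.const _ 1).prodMk (ContinuousMap.id _)
  have m₁ : unitsMul.comp i₁ = ContinuousMap.id _ := by
    ext1 x
    exact mul_one x
  have m₂ : unitsMul.comp i₂ = ContinuousMap.id _ := by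
    ext1 x
    exact one_mul x
  have f₁ : ContinuousMap.fst.comp i₁ = ContinuousMap.id _ := rfl
  have f₂ : ContinuousMap.fst.comp i₂ = ContinuousMap.const _ 1 := rfl
  have g₁ : ContinuousMap.snd.comp i₁ = ContinuousMap.const _ 1 := rfl
  have g₂ : ContinuousMap.snd.comp i₂ = ContinuousMap.id _ := rfl
  -- Restriction to `1 × ℍˣ` kills the `s` component and identifies `y` with `s`.
  have hy := congrArg (pull i₂) h
  rw [map_add, map_mul, ← pull_comp, ← pull_comp, ← pull_comp, m₂, f₂, g₂, pull_const_ringClass,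
    zero_mul, add_zero, pull_id, pull_id] at hy
  subst hy
  obtain ⟨k, m, rfl⟩ := exists_zsmul_of_isSphereClass hS z
  -- Restriction to `ℍˣ × 1` detects only the constant part `k` of `z` and shows that `k = 1`.
  have hz := congrArg (pull i₁) h
  have hz' : pull i₁ (pull ContinuousMap.snd ((k : CohomologyRing ℍ[ℝ]ˣ) + m • ringClass s)) = k := by
    rw [← pull_comp, g₁, map_add, map_zsmul, pull_const_ringClass, smul_zero, add_zero, map_intCast]
  rw [map_add (pull i₁), map_mul, hz', ← pull_comp, ← pull_comp, ← pull_comp, m₁, f₁, g₁,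
    pull_const_ringClass, zero_add, pull_id, ← zsmul_eq_mul'] at hz
  have hk : k = 1 := by
    have : (k - 1) • ringClass s = 0 := by
      rw [sub_zsmul, ← hz, one_zsmul, add_neg_cancel]
    exact sub_eq_zero.1 (zsmul_eq_zero_of_isSphereClass hS this)
  subst hk
  -- The remaining term `m (s × s)` has degree `6`, but as a difference of classes of degree `3` it
  -- also has degree `3`.
  have hm : pull (ContinuousMap.fst : C(ℍ[ℝ]ˣ × ℍ[ℝ]ˣ, ℍ[ℝ]ˣ)) (ringClass s) *
      pull ContinuousMap.snd (m • ringClass s) = 0 := by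
    refine eq_zero_of_mem_degreePart (m := 6) (n := 3) (by norm_num)
      (mul_mem_degreePart (m := 3) (n := 3) (pull_mem_degreePart _ hs3) (pull_mem_degreePart _ (zsmul_mem hs3 m))) ?_
    have : pull (ContinuousMap.fst : C(ℍ[ℝ]ˣ × ℍ[ℝ]ˣ, ℍ[ℝ]ˣ)) (ringClass s) *
      pull ContinuousMap.snd (m • ringClass s) = pull unitsMul (ringClass s) -
        pull ContinuousMap.snd (ringClass s) - pull ContinuousMap.fst (ringClass s) := by
      rw [h, Int.cast_one, map_add, map_one, mul_add, mul_one]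
      abel
    rw [this]
    exact sub_mem (sub_mem (pull_mem_degreePart _ hs3) (pull_mem_degreePart _ hs3))
      (pull_mem_degreePart _ hs3)
  rw [h, Int.cast_one, map_add, map_one, mul_add, hm, mul_one, add_zero, add_comm]

variable {X : Type u} [TopologicalSpace X]

theorem pull_ringClass_mul_self (hs : IsGenerator s) (f : C(X, ℍ[ℝ]ˣ)) :
    pull f (ringClass s) * pull f (ringClass s) = 0 := by
  rw [← map_mul, ringClass_mul_self hs, map_zero]

/-- Primitivity of `s` read on maps: `f ↦ f^* s` is a homomorphism from maps into `ℍˣ` to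
cohomology. -/
theorem pull_mul_ringClass (hs : IsGenerator s) (f g : C(X, ℍ[ℝ]ˣ)) :
    pull (f * g) (ringClass s) = pull f (ringClass s) + pull g (ringClass s) := by
  have h : f * g = unitsMul.comp (f.prodMk g) := rfl
  rw [h, pull_comp, pull_unitsMul hs, map_add, ← pull_comp, ← pull_comp]
  rfl

/-- Expand the square of `(f * g)^* s = f^* s + g^* s`, which is zero. This replaces the general
graded commutativity of the cup product. -/
theorem pull_ringClass_anticomm (hs : IsGenerator s) (f g : C(X, ℍ[ℝ]ˣ)) :
    pull f (ringClass s) * pull g (ringClass s) =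
      -(pull g (ringClass s) * pull f (ringClass s)) := by
  have h := pull_ringClass_mul_self hs (f * g)
  rw [pull_mul_ringClass hs, add_mul, mul_add, mul_add, pull_ringClass_mul_self hs,
    pull_ringClass_mul_self hs, zero_add, add_zero] at h
  exact eq_neg_of_add_eq_zero_left h

end Units

end QuaternionicArrangement
end

noncomputable section

namespace QuaternionicArrangement

open SingularCohomology

universe u

/-! ### Generators and monomials of the exterior algebra -/

section Exterior

variable {V : Type u} [AddCommGroup V] [Module ℍ[ℝ] V] (𝒜 : Finset (Submodule ℍ[ℝ] V))

/-- The generator `e_A` of the exterior algebra. -/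
def E.gen (A : 𝒜) : E 𝒜 := ExteriorAlgebra.ι ℤ (Finsupp.single A (1 : ℤ))

variable {𝒜}

theorem E.gen_mul_self (A : 𝒜) : E.gen 𝒜 A * E.gen 𝒜 A = 0 := ExteriorAlgebra.ι_sq_zero _

theorem E.gen_mul_gen (A B : 𝒜) : E.gen 𝒜 A * E.gen 𝒜 B = -(E.gen 𝒜 B * E.gen 𝒜 A) :=
  eq_neg_of_add_eq_zero_left (ExteriorAlgebra.ι_add_mul_swap _ _)

theorem E.diff_gen (A : 𝒜) : E.diff 𝒜 (E.gen 𝒜 A) = 1 := by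
  rw [E.diff, E.gen, ExteriorAlgebra.ι, CliffordAlgebra.contractLeft_ι]
  simp

theorem E.involute_gen (A : 𝒜) : CliffordAlgebra.involute (E.gen 𝒜 A) = -E.gen 𝒜 A :=
  CliffordAlgebra.involute_ι _

theorem E.diff_gen_mul (A : 𝒜) (x : E 𝒜) :
    E.diff 𝒜 (E.gen 𝒜 A * x) = x - E.gen 𝒜 A * E.diff 𝒜 x := by
  rw [E.diff_mul, E.diff_gen, one_mul, E.involute_gen, neg_mul, sub_eq_add_neg]

theorem E.induction {p : E 𝒜 → Prop} (zero : p 0) (one : p 1)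
    (add : ∀ x y, p x → p y → p (x + y)) (neg : ∀ x, p x → p (-x))
    (gen_mul : ∀ A x, p x → p (E.gen 𝒜 A * x)) (x : E 𝒜) : p x := by
  have zsmul : ∀ (n : ℤ) (x : E 𝒜), p x → p (n • x) := by
    intro n x hx
    induction n with
    | zero => rwa [zero_zsmul]
    | succ n ih => rw [add_zsmul, one_zsmul]; exact add _ _ ih hx
    | pred n ih => rw [sub_zsmul, one_zsmul]; exact add _ _ ih (neg _ hx)
  induction x using CliffordAlgebra.left_induction with
  | algebraMap r =>
    rw [Algebra.algebraMap_eq_smul_one]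
    exact zsmul r 1 one
  | add x y hx hy => exact add x y hx hy
  | ι_mul x v hx =>
    induction v using Finsupp.induction_linear with
    | zero =>
      rw [map_zero, zero_mul]
      exact zero
    | add v w hv hw =>
      rw [map_add, add_mul]
      exact add _ _ hv hw
    | single A n =>
      have : (Finsupp.single A n : 𝒜 →₀ ℤ) = n • Finsupp.single A (1 : ℤ) := by simp
      rw [this, map_smul, smul_mul_assoc]
      exact zsmul n _ (gen_mul A x hx)

/-- The product of the generators of a list of hyperplanes. -/
def E.listProd (l : List 𝒜) : E 𝒜 := (l.map (E.gen 𝒜)).prod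

theorem E.monomial_eq_listProd {r : ℕ} (A : Fin r → 𝒜) :
    E.monomial 𝒜 A = E.listProd (List.ofFn A) := by
  rw [E.monomial, ExteriorAlgebra.ιMulti_apply, E.listProd, List.map_ofFn]
  rfl

theorem E.listProd_cons (A : 𝒜) (l : List 𝒜) :
    E.listProd (A :: l) = E.gen 𝒜 A * E.listProd l := by
  simp [E.listProd]

theorem E.listProd_append (l l' : List 𝒜) :
    E.listProd (l ++ l') = E.listProd l * E.listProd l' := by
  simp [E.listProd]

theorem E.listProd_perm {l l' : List 𝒜} (h : l.Perm l') :
    E.listProd l = E.listProd l' ∨ E.listProd l = -E.listProd l' := by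
  induction h with
  | nil => exact Or.inl rfl
  | cons A _ ih =>
    rw [E.listProd_cons, E.listProd_cons]
    rcases ih with ih | ih
    · exact Or.inl (by rw [ih])
    · exact Or.inr (by rw [ih, mul_neg])
  | swap A B l =>
    refine Or.inr ?_
    simp only [E.listProd_cons, ← mul_assoc]
    rw [E.gen_mul_gen B A, neg_mul]
  | trans _ _ ih₁ ih₂ =>
    rcases ih₁ with h₁ | h₁ <;> rcases ih₂ with h₂ | h₂ <;> rw [h₁, h₂] <;> simp

/-- The product of the differences `e_B - e_A` over a list of hyperplanes `B`. -/
def E.diffProd (A : 𝒜) (l : List 𝒜) : E 𝒜 := (l.map fun B => E.gen 𝒜 B - E.gen 𝒜 A).prod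

theorem E.diffProd_cons (A B : 𝒜) (l : List 𝒜) :
    E.diffProd A (B :: l) = (E.gen 𝒜 B - E.gen 𝒜 A) * E.diffProd A l := by
  simp [E.diffProd]

/-- The summands `e_A` disappear one after another: moving the leading `e_A` past `e_B` costs only a
sign, and `e_A² = 0`. -/
theorem E.gen_mul_diffProd (A : 𝒜) (l : List 𝒜) :
    E.gen 𝒜 A * E.diffProd A l = E.gen 𝒜 A * E.listProd l := by
  induction l with
  | nil => rfl
  | cons B l ih =>
    rw [E.diffProd_cons, E.listProd_cons, ← mul_assoc, mul_sub, E.gen_mul_self, sub_zero,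
      ← mul_assoc, E.gen_mul_gen A B, neg_mul, neg_mul, mul_assoc, ih, mul_assoc]

theorem E.diff_diffProd (A : 𝒜) (l : List 𝒜) : E.diff 𝒜 (E.diffProd A l) = 0 := by
  induction l with
  | nil =>
    rw [E.diffProd, List.map_nil, List.prod_nil, E.diff]
    exact CliffordAlgebra.contractLeft_one _ _
  | cons B l ih =>
    rw [E.diffProd_cons, E.diff_mul, ih, mul_zero, add_zero, map_sub, E.diff_gen, E.diff_gen,
      sub_self, zero_mul]

theorem E.involute_diffProd (A : 𝒜) (l : List 𝒜) :
    CliffordAlgebra.involute (E.diffProd A l) = (-1) ^ l.length * E.diffProd A l := by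
  induction l with
  | nil => simp [E.diffProd]
  | cons B l ih =>
    rw [E.diffProd_cons, map_mul, ih, map_sub, E.involute_gen, E.involute_gen, List.length_cons,
      ← neg_sub', pow_succ', neg_one_mul, neg_mul, neg_mul, ← mul_assoc, ← mul_assoc,
      ((Commute.neg_one_right _).pow_right _).eq]

/-- A ring homomorphism that kills the product of the differences `e_B - e_A` kills the
differential of the product of all generators. -/
theorem map_diff_listProd_eq_zero {R : Type*} [Ring R] (ψ : E 𝒜 →+* R) {A : 𝒜} {l l' : List 𝒜}
    (h : ψ (E.diffProd A l) = 0) : ψ (E.diff 𝒜 (E.listProd (A :: (l ++ l')))) = 0 := by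
  -- Write the product as `e_A D L'` with `D` the product of differences. Since `∂D = 0`, the
  -- derivative is `D L'` minus a signed `e_A D ∂L'`, and both terms contain `D`.
  rw [E.listProd_cons, E.listProd_append, ← mul_assoc, ← E.gen_mul_diffProd, mul_assoc,
    E.diff_gen_mul, E.diff_mul, E.diff_diffProd, zero_mul, zero_add, E.involute_diffProd]
  simp [h]

/-- A dependency may involve only the indices in `s` and `i`. A permutation, which changes the
monomial by a sign at most, moves these to the front. -/
theorem map_diff_monomial_eq_zero {R : Type*} [Ring R] (ψ : E 𝒜 →+* R) {r : ℕ} (A : Fin r → 𝒜)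
    {i : Fin r} {s : Finset (Fin r)} (hi : i ∉ s)
    (h : ψ ((s.toList.map fun j => E.gen 𝒜 (A j) - E.gen 𝒜 (A i)).prod) = 0) :
    ψ (E.diff 𝒜 (E.monomial 𝒜 A)) = 0 := by
  classical
  have hp : (List.ofFn A).Perm (A i :: (s.toList.map A ++ (insert i s)ᶜ.toList.map A)) := by
    rw [List.ofFn_eq_map, ← List.map_append, ← List.map_cons]
    refine List.Perm.map A ?_
    refine (List.perm_ext_iff_of_nodup (List.nodup_finRange r) ?_).2 fun j => ?_
    · rw [List.nodup_cons, List.nodup_append]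
      refine ⟨?_, s.nodup_toList, Finset.nodup_toList _, ?_⟩
      · simp [hi]
      · intro a ha b hb hab
        subst hab
        simp only [Finset.mem_toList, Finset.mem_compl, Finset.mem_insert, not_or] at ha hb
        exact hb.2 ha
    · simp only [List.mem_finRange, true_iff, List.mem_cons, List.mem_append, Finset.mem_toList,
        Finset.mem_compl, Finset.mem_insert]
      tauto
  have key := map_diff_listProd_eq_zero ψ (A := A i) (l := s.toList.map A)
    (l' := (insert i s)ᶜ.toList.map A) (by
      rw [E.diffProd, List.map_map]
      exact h)
  rw [E.monomial_eq_listProd]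
  rcases E.listProd_perm hp with h | h <;> rw [h]
  · exact key
  · rw [map_neg, map_neg, key, neg_zero]

end Exterior

/-! ### The classes of the hyperplanes -/

section Classes

variable {V : Type u} [AddCommGroup V] [Module ℍ[ℝ] V]

theorem exists_form_eq_one {a : V →ₗ[ℍ[ℝ]] ℍ[ℝ]} (ha : a ≠ 0) : ∃ v, a v = 1 := by
  obtain ⟨w, hw⟩ : ∃ w, a w ≠ 0 := by
    by_contra! h
    exact ha (LinearMap.ext h)
  exact ⟨(a w)⁻¹ • w, by rw [map_smul, smul_eq_mul, inv_mul_cancel₀ hw]⟩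

/-- The factor is the value of `b` at a vector where `a` is `1`. It stands on the right because the
forms are left linear. -/
theorem exists_mul_eq_of_ker_eq {a b : V →ₗ[ℍ[ℝ]] ℍ[ℝ]} (ha : a ≠ 0)
    (h : LinearMap.ker a = LinearMap.ker b) : ∃ c : ℍ[ℝ]ˣ, ∀ v, b v = a v * c := by
  obtain ⟨v, hv⟩ := exists_form_eq_one ha
  have hb : b v ≠ 0 := fun h0 => by
    have : v ∈ LinearMap.ker a := h ▸ LinearMap.mem_ker.2 h0
    rw [LinearMap.mem_ker, hv] at this
    exact one_ne_zero this
  refine ⟨Units.mk0 _ hb, fun w => ?_⟩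
  have : w - a w • v ∈ LinearMap.ker b := by
    rw [← h, LinearMap.mem_ker, map_sub, map_smul, hv, smul_eq_mul, mul_one, sub_self]
  rw [LinearMap.mem_ker, map_sub, map_smul, sub_eq_zero] at this
  exact this

theorem form_ne_zero_of_mem {𝒜 : Finset (Submodule ℍ[ℝ] V)} (h𝒜 : ∀ A ∈ 𝒜, IsHyperplane A)
    {a : V →ₗ[ℍ[ℝ]] ℍ[ℝ]} (ha : LinearMap.ker a ∈ 𝒜) : a ≠ 0 := by
  rintro rfl
  obtain ⟨b, hb, h⟩ := h𝒜 _ ha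
  rw [LinearMap.ker_zero, LinearMap.ker_eq_top] at h
  exact hb h

/-- A linear form that defines a hyperplane of the arrangement. -/
def form {𝒜 : Finset (Submodule ℍ[ℝ] V)} (h𝒜 : ∀ A ∈ 𝒜, IsHyperplane A) (A : 𝒜) :
    V →ₗ[ℍ[ℝ]] ℍ[ℝ] := (h𝒜 A.1 A.2).choose

theorem ker_form {𝒜 : Finset (Submodule ℍ[ℝ] V)} (h𝒜 : ∀ A ∈ 𝒜, IsHyperplane A) (A : 𝒜) :
    LinearMap.ker (form h𝒜 A) = A :=
  (h𝒜 A.1 A.2).choose_spec.2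

variable [TopologicalSpace V] [IsTopologicalAddGroup V] [ContinuousSMul ℍ[ℝ] V] [T2Space V]
  [Module.Finite ℍ[ℝ] V] {𝒜 : Finset (Submodule ℍ[ℝ] V)} {s : Cohomology ℍ[ℝ]ˣ 3}

/-- Forms with the same kernel differ by a constant unit, and a constant map contributes zero by
additivity: the class depends on the hyperplane alone. -/
theorem pull_formMap_eq (hs : IsGenerator s) {a b : V →ₗ[ℍ[ℝ]] ℍ[ℝ]} (ha0 : a ≠ 0)
    (ha : LinearMap.ker a ∈ 𝒜) (hb : LinearMap.ker b ∈ 𝒜)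
    (h : LinearMap.ker a = LinearMap.ker b) :
    pull (formMap 𝒜 b hb) (ringClass s) = pull (formMap 𝒜 a ha) (ringClass s) := by
  obtain ⟨c, hc⟩ := exists_mul_eq_of_ker_eq ha0 h
  have : formMap 𝒜 b hb = formMap 𝒜 a ha * ContinuousMap.const _ c := by
    ext1 x
    exact Units.ext (hc x)
  rw [this, pull_mul_ringClass hs, pull_const_ringClass, add_zero]

/-- The map `X → ℍˣ` given by the chosen form. -/
def hypMap (h𝒜 : ∀ A ∈ 𝒜, IsHyperplane A) (A : 𝒜) : C(HyperplaneComplement 𝒜, ℍ[ℝ]ˣ) :=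
  formMap 𝒜 (form h𝒜 A) (by rw [ker_form]; exact A.2)

/-- The class of a hyperplane in the cohomology of the complement. -/
def hypClass (h𝒜 : ∀ A ∈ 𝒜, IsHyperplane A) (s : Cohomology ℍ[ℝ]ˣ 3) (A : 𝒜) :
    CohomologyRing (HyperplaneComplement 𝒜) := pull (hypMap h𝒜 A) (ringClass s)

theorem pull_formMap (hs : IsGenerator s) (h𝒜 : ∀ A ∈ 𝒜, IsHyperplane A)
    (a : V →ₗ[ℍ[ℝ]] ℍ[ℝ]) (ha : LinearMap.ker a ∈ 𝒜) :
    pull (formMap 𝒜 a ha) (ringClass s) = hypClass h𝒜 s ⟨LinearMap.ker a, ha⟩ := by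
  symm
  exact pull_formMap_eq hs (form_ne_zero_of_mem h𝒜 ha) ha _ (ker_form h𝒜 ⟨LinearMap.ker a, ha⟩).symm

theorem linearCombination_hypClass_anticomm (hs : IsGenerator s) (h𝒜 : ∀ A ∈ 𝒜, IsHyperplane A)
    (x y : 𝒜 →₀ ℤ) :
    Finsupp.linearCombination ℤ (hypClass h𝒜 s) x * Finsupp.linearCombination ℤ (hypClass h𝒜 s) y =
      -(Finsupp.linearCombination ℤ (hypClass h𝒜 s) y *
        Finsupp.linearCombination ℤ (hypClass h𝒜 s) x) := by
  induction x using Finsupp.induction_linear with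
  | zero => simp
  | add x x' hx hx' => rw [map_add, add_mul, mul_add, hx, hx', neg_add]
  | single A n =>
    induction y using Finsupp.induction_linear with
    | zero => simp
    | add y y' hy hy' => rw [map_add, add_mul, mul_add, hy, hy', neg_add]
    | single B m =>
      rw [Finsupp.linearCombination_single, Finsupp.linearCombination_single, smul_mul_smul_comm,
        smul_mul_smul_comm, hypClass, hypClass, pull_ringClass_anticomm hs, smul_neg, mul_comm]

theorem linearCombination_hypClass_sq (hs : IsGenerator s) (h𝒜 : ∀ A ∈ 𝒜, IsHyperplane A)
    (x : 𝒜 →₀ ℤ) :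
    Finsupp.linearCombination ℤ (hypClass h𝒜 s) x *
      Finsupp.linearCombination ℤ (hypClass h𝒜 s) x = 0 := by
  induction x using Finsupp.induction_linear with
  | zero => simp
  | add x y hx hy =>
    rw [map_add, add_mul, mul_add, mul_add, hx, hy,
      linearCombination_hypClass_anticomm hs h𝒜 x y]
    simp
  | single A n =>
    rw [Finsupp.linearCombination_single, smul_mul_smul_comm, hypClass, pull_ringClass_mul_self hs,
      smul_zero]

/-- The ring homomorphism `E(𝒜) → H^•(X)` that maps `e_A` to the class of `A`. -/
def toCohomology (hs : IsGenerator s) (h𝒜 : ∀ A ∈ 𝒜, IsHyperplane A) :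
    E 𝒜 →+* CohomologyRing (HyperplaneComplement 𝒜) :=
  (ExteriorAlgebra.lift ℤ ⟨Finsupp.linearCombination ℤ (hypClass h𝒜 s),
    linearCombination_hypClass_sq hs h𝒜⟩ : E 𝒜 →ₐ[ℤ] _).toRingHom

theorem toCohomology_gen (hs : IsGenerator s) (h𝒜 : ∀ A ∈ 𝒜, IsHyperplane A) (A : 𝒜) :
    toCohomology hs h𝒜 (E.gen 𝒜 A) = hypClass h𝒜 s A := by
  refine (ExteriorAlgebra.lift_ι_apply ℤ _ _ _).trans ?_
  rw [Finsupp.linearCombination_single, one_smul]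

end Classes

/-! ### The Orlik–Solomon relations in cohomology -/

section Relations

theorem contractibleSpace_re_neg : ContractibleSpace {q : ℍ[ℝ] // q.re < 0} := by
  refine Convex.contractibleSpace (s := {q : ℍ[ℝ] | q.re < 0}) ?_ ⟨-1, by simp⟩
  exact convex_halfSpace_lt (f := fun q : ℍ[ℝ] => q.re) ⟨fun _ _ => rfl, fun _ _ => by simp⟩ 0

/-- The map factors through a convex half-space, where a class of degree `3` is an integer and
therefore zero. -/
theorem pull_ringClass_eq_zero_of_re_neg {X : Type u} [TopologicalSpace X]
    {s : Cohomology ℍ[ℝ]ˣ 3} (f : C(X, ℍ[ℝ]ˣ)) (hf : ∀ x, (f x : ℍ[ℝ]).re < 0) :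
    pull f (ringClass s) = 0 := by
  have := contractibleSpace_re_neg
  let g : C({q : ℍ[ℝ] // q.re < 0}, ℍ[ℝ]ˣ) :=
    ⟨fun q => Units.mk0 q.1 fun h => by
      have := q.2
      rw [h] at this
      simp at this, by
      rw [Units.isEmbedding_val₀.continuous_iff]
      exact continuous_subtype_val⟩
  let f' : C(X, {q : ℍ[ℝ] // q.re < 0}) :=
    ⟨fun x => ⟨f x, hf x⟩, (Units.continuous_val.comp f.continuous).subtype_mk _⟩
  have hfg : f = g.comp f' := by
    ext1 x
    exact Units.ext rfl
  have hg : pull g (ringClass s) = 0 := by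
    obtain ⟨k, hk⟩ := exists_intCast_of_contractible (pull g (ringClass s))
    refine eq_zero_of_mem_degreePart (m := 3) (n := 0) (by norm_num)
      (pull_mem_degreePart g (of_mem_degreePart 3 s)) ?_
    rw [hk]
    exact intCast_mem_degreePart k
  rw [hfg, pull_comp, hg, map_zero]

/-- If units `y i` of a finite family sum to zero, then the product of the differences of their
classes vanishes. -/
theorem prod_pull_sub_eq_zero {X : Type u} [TopologicalSpace X] {s : Cohomology ℍ[ℝ]ˣ 3}
    (hs : IsGenerator s) {ι : Type*} [DecidableEq ι] (y : ι → C(X, ℍ[ℝ]ˣ)) (i : ι) (S : Finset ι)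
    (hsum : ∀ x, (y i x : ℍ[ℝ]) + ∑ j ∈ S, (y j x : ℍ[ℝ]) = 0) :
    (S.toList.map fun j => pull (y j) (ringClass s) - pull (y i) (ringClass s)).prod = 0 := by
  -- Additivity turns the difference of two classes into the class of a quotient.
  have hz : ∀ j, pull (y j) (ringClass s) - pull (y i) (ringClass s) =
      pull ((y i)⁻¹ * y j) (ringClass s) := by
    intro j
    have := pull_mul_ringClass hs (y i) ((y i)⁻¹ * y j)
    rw [mul_inv_cancel_left] at this
    rw [this, add_sub_cancel_left]
  simp only [hz]
  refine list_prod_eq_zero_of_cover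
    (U := fun j => {x | ((((y i)⁻¹ * y j) x : ℍ[ℝ]ˣ) : ℍ[ℝ]).re < 0}) (fun j _ => ?_)
    (fun j _ => ?_) fun x => ?_
  · exact isOpen_lt (Quaternion.continuous_re.comp
      (Units.continuous_val.comp ((y i)⁻¹ * y j).continuous)) continuous_const
  · rw [← pull_comp]
    exact pull_ringClass_eq_zero_of_re_neg _ fun x => x.2
  · by_contra! h
    -- Dividing the relation by `y i` shows that the quotients sum to `-1`, so they cannot all have
    -- nonnegative real part.
    have h1 : ∑ j ∈ S, ((((y i)⁻¹ * y j) x : ℍ[ℝ]ˣ) : ℍ[ℝ]) = -1 := by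
      have h2 := congrArg (fun q => (((y i x)⁻¹ : ℍ[ℝ]ˣ) : ℍ[ℝ]) * q) (hsum x)
      simp only [mul_add, Units.inv_mul, mul_zero, Finset.mul_sum] at h2
      rw [add_comm] at h2
      rw [← eq_neg_of_add_eq_zero_left h2]
      rfl
    have h3 := congrArg (fun q : ℍ[ℝ] => q.re) h1
    have h4 : (∑ j ∈ S, ((((y i)⁻¹ * y j) x : ℍ[ℝ]ˣ) : ℍ[ℝ])).re =
        ∑ j ∈ S, ((((y i)⁻¹ * y j) x : ℍ[ℝ]ˣ) : ℍ[ℝ]).re :=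
      map_sum (⟨⟨fun q => q.re, rfl⟩, fun _ _ => rfl⟩ : ℍ[ℝ] →+ ℝ) _ _
    simp only [h4] at h3
    have h5 : (0 : ℝ) ≤ ∑ j ∈ S, ((((y i)⁻¹ * y j) x : ℍ[ℝ]ˣ) : ℍ[ℝ]).re :=
      Finset.sum_nonneg fun j hj => by simpa using h j (Finset.mem_toList.2 hj)
    rw [h3] at h5
    simp at h5
    linarith

variable {V : Type u} [AddCommGroup V] [Module ℍ[ℝ] V]

/-- The codimension is the rank of `V → ℍʳ`. If it is less than `r`, a nonzero functional on `ℍʳ`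
kills the image, and its values on the standard basis are the right coefficients. -/
theorem exists_relation {r : ℕ} (a : Fin r → V →ₗ[ℍ[ℝ]] ℍ[ℝ])
    (h : Module.finrank ℍ[ℝ] (V ⧸ ⨅ i, LinearMap.ker (a i)) < r) :
    ∃ c : Fin r → ℍ[ℝ], c ≠ 0 ∧ ∀ v, ∑ i, a i v * c i = 0 := by
  classical
  have hker : LinearMap.ker (LinearMap.pi a) = ⨅ i, LinearMap.ker (a i) := LinearMap.ker_pi a
  rw [← hker, (LinearMap.quotKerEquivRange (LinearMap.pi a)).finrank_eq] at h
  have hlt : LinearMap.range (LinearMap.pi a) < ⊤ := by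
    rw [lt_top_iff_ne_top]
    intro htop
    rw [htop, finrank_top, Module.finrank_fin_fun] at h
    exact lt_irrefl _ h
  obtain ⟨f, hf, hfk⟩ := Submodule.exists_le_ker_of_lt_top _ hlt
  refine ⟨fun i => f fun j => if i = j then 1 else 0, fun h0 => hf ?_, fun v => ?_⟩
  · refine LinearMap.ext fun x => ?_
    rw [LinearMap.pi_apply_eq_sum_univ]
    exact Finset.sum_eq_zero fun i _ => by rw [show f (fun j => if i = j then 1 else 0) = 0 from
      congrFun h0 i, smul_zero]
  · have := LinearMap.mem_ker.1 (hfk (LinearMap.mem_range_self (LinearMap.pi a) v))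
    rw [LinearMap.pi_apply_eq_sum_univ] at this
    exact this

variable [TopologicalSpace V] [IsTopologicalAddGroup V] [ContinuousSMul ℍ[ℝ] V] [T2Space V]
  [Module.Finite ℍ[ℝ] V] {𝒜 : Finset (Submodule ℍ[ℝ] V)} {s : Cohomology ℍ[ℝ]ˣ 3}

/-- The terms `a_j c_j` with `c_j ≠ 0` of a linear dependency are units with sum zero, and they have
the same classes as the `a_j`. -/
theorem toCohomology_diff_monomial (hs : IsGenerator s) (h𝒜 : ∀ A ∈ 𝒜, IsHyperplane A) {r : ℕ}
    (A : Fin r → 𝒜)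
    (hr : Module.finrank ℍ[ℝ] (V ⧸ ⨅ i, (A i : Submodule ℍ[ℝ] V)) < r) :
    toCohomology hs h𝒜 (E.diff 𝒜 (E.monomial 𝒜 A)) = 0 := by
  classical
  obtain ⟨c, hc, hsum⟩ := exists_relation (fun i => form h𝒜 (A i)) (by
    rwa [iInf_congr fun i => ker_form h𝒜 (A i)])
  obtain ⟨i, hi⟩ : ∃ i, c i ≠ 0 := Function.ne_iff.1 hc
  let S : Finset (Fin r) := (Finset.univ.filter fun j => c j ≠ 0).erase i
  let y : Fin r → C(HyperplaneComplement 𝒜, ℍ[ℝ]ˣ) := fun j =>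
    hypMap h𝒜 (A j) * ContinuousMap.const _ (if h : c j ≠ 0 then Units.mk0 (c j) h else 1)
  have hy : ∀ j, pull (y j) (ringClass s) = hypClass h𝒜 s (A j) := fun j => by
    rw [pull_mul_ringClass hs, pull_const_ringClass, add_zero]
    rfl
  have hyv : ∀ j x, c j ≠ 0 → (y j x : ℍ[ℝ]) = form h𝒜 (A j) x * c j := by
    intro j x hj
    simp only [y, dif_pos hj]
    rfl
  refine map_diff_monomial_eq_zero _ A (i := i) (s := S) (by simp [S]) ?_
  rw [map_list_prod, List.map_map]
  have := prod_pull_sub_eq_zero hs y i S fun x => by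
    have hfilter : ∑ j with c j ≠ 0, form h𝒜 (A j) x * c j = ∑ j, form h𝒜 (A j) x * c j :=
      Finset.sum_filter_of_ne fun j _ h h0 => h (by rw [h0, mul_zero])
    rw [← hsum x, ← hfilter, ← Finset.add_sum_erase _ _
      (Finset.mem_filter.2 ⟨Finset.mem_univ i, hi⟩), hyv i x hi]
    congr 1
    refine Finset.sum_congr rfl fun j hj => hyv j x ?_
    exact (Finset.mem_filter.1 (Finset.mem_of_mem_erase hj)).2
  simp only [hy] at this
  rw [← this]
  congr 1
  refine List.map_congr_left fun j _ => ?_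
  rw [Function.comp_apply, map_sub, toCohomology_gen, toCohomology_gen]

theorem toCohomology_eq_zero_of_mem (hs : IsGenerator s) (h𝒜 : ∀ A ∈ 𝒜, IsHyperplane A)
    {x : E 𝒜} (hx : x ∈ osIdeal 𝒜) : toCohomology hs h𝒜 x = 0 := by
  have hx' : x ∈ TwoSidedIdeal.span (osRelations 𝒜) := TwoSidedIdeal.mem_asIdeal.1 hx
  have hle : TwoSidedIdeal.span (osRelations 𝒜) ≤ TwoSidedIdeal.ker (toCohomology hs h𝒜) := by
    rw [TwoSidedIdeal.span_le]
    rintro _ ⟨r, A, -, hr, rfl⟩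
    exact (TwoSidedIdeal.mem_ker _).2 (toCohomology_diff_monomial hs h𝒜 A hr)
  exact (TwoSidedIdeal.mem_ker _).1 (hle hx')

end Relations

end QuaternionicArrangement
end

noncomputable section

namespace QuaternionicArrangement

open SingularCohomology

universe u

/-! ### Deletion and restriction: algebra -/

section Map

variable {V : Type*} [AddCommGroup V] [Module ℍ[ℝ] V] {𝒜 : Finset (Submodule ℍ[ℝ] V)}
  {W : Type*} [AddCommGroup W] [Module ℍ[ℝ] W] {ℬ : Finset (Submodule ℍ[ℝ] W)}

/-- The ring homomorphism of exterior algebras induced by a map of hyperplanes. -/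
def E.map (f : 𝒜 → ℬ) : E 𝒜 →+* E ℬ :=
  (ExteriorAlgebra.map (Finsupp.lmapDomain ℤ ℤ f) : E 𝒜 →ₐ[ℤ] E ℬ).toRingHom

theorem E.map_gen (f : 𝒜 → ℬ) (A : 𝒜) : E.map f (E.gen 𝒜 A) = E.gen ℬ (f A) := by
  refine (ExteriorAlgebra.map_apply_ι _ _).trans ?_
  rw [Finsupp.lmapDomain_apply, Finsupp.mapDomain_single]
  rfl

theorem E.diff_one : E.diff 𝒜 1 = 0 := by
  rw [E.diff]
  exact CliffordAlgebra.contractLeft_one _ _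

theorem E.diff_map (f : 𝒜 → ℬ) (x : E 𝒜) : E.diff ℬ (E.map f x) = E.map f (E.diff 𝒜 x) := by
  induction x using E.induction with
  | zero => simp
  | one => rw [map_one, E.diff_one, E.diff_one, map_zero]
  | add x y hx hy => simp only [map_add, hx, hy]
  | neg x hx => simp only [map_neg, hx]
  | gen_mul A x hx => rw [map_mul, E.map_gen, E.diff_gen_mul, E.diff_gen_mul, hx, map_sub, map_mul,
      E.map_gen]

theorem E.map_monomial (f : 𝒜 → ℬ) {r : ℕ} (A : Fin r → 𝒜) :
    E.map f (E.monomial 𝒜 A) = E.monomial ℬ (f ∘ A) := by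
  rw [E.monomial_eq_listProd, E.monomial_eq_listProd, E.listProd, map_list_prod, List.map_map,
    E.listProd, ← List.map_ofFn, List.map_map]
  congr 2
  ext1 A
  exact E.map_gen f A

theorem E.monomial_cons {r : ℕ} (A : 𝒜) (B : Fin r → 𝒜) :
    E.monomial 𝒜 (Fin.cons A B : Fin (r + 1) → 𝒜) = E.gen 𝒜 A * E.monomial 𝒜 B := by
  rw [E.monomial_eq_listProd, E.monomial_eq_listProd, List.ofFn_succ, E.listProd_cons]
  simp

theorem E.diff_monomial_mem {r : ℕ} {A : Fin r → 𝒜} (hA : Function.Injective A)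
    (hr : Module.finrank ℍ[ℝ] (V ⧸ ⨅ i, (A i : Submodule ℍ[ℝ] V)) < r) :
    E.diff 𝒜 (E.monomial 𝒜 A) ∈ osIdeal 𝒜 :=
  TwoSidedIdeal.mem_asIdeal.2 (TwoSidedIdeal.subset_span ⟨r, A, hA, hr, rfl⟩)

end Map

/-! ### Restricted arrangements and lifting of relations -/

section DeletionRestriction

variable {V : Type u} [AddCommGroup V] [Module ℍ[ℝ] V]

/-- The arrangement `𝒜'` is obtained from `𝒜` by deleting `H`. -/
structure IsDeletion (𝒜 𝒜' : Finset (Submodule ℍ[ℝ] V)) (H : Submodule ℍ[ℝ] V) : Prop where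
  mem : H ∈ 𝒜
  notMem : H ∉ 𝒜'
  subset : 𝒜' ⊆ 𝒜
  eq_or_mem : ∀ A ∈ 𝒜, A = H ∨ A ∈ 𝒜'

open Classical in
/-- The restriction of an arrangement to a subspace. -/
def restriction (𝒜 : Finset (Submodule ℍ[ℝ] V)) (H : Submodule ℍ[ℝ] V) :
    Finset (Submodule ℍ[ℝ] H) :=
  𝒜.image (Submodule.comap H.subtype)

/-- The restriction of a hyperplane. -/
def toRestriction (𝒜 : Finset (Submodule ℍ[ℝ] V)) (H : Submodule ℍ[ℝ] V) (A : 𝒜) :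
    restriction 𝒜 H :=
  ⟨Submodule.comap H.subtype A, by classical exact Finset.mem_image_of_mem _ A.2⟩

theorem toRestriction_surjective (𝒜 : Finset (Submodule ℍ[ℝ] V)) (H : Submodule ℍ[ℝ] V) :
    Function.Surjective (toRestriction 𝒜 H) := by
  classical
  rintro ⟨B, hB⟩
  obtain ⟨A, hA, rfl⟩ := Finset.mem_image.1 hB
  exact ⟨⟨A, hA⟩, rfl⟩

/-- Intersecting with `H` costs at most one in codimension; so a family that is dependent on `H`
becomes dependent in `V` once `H` is added to it. -/
theorem finrank_quotient_inf_le [Module.Finite ℍ[ℝ] V] {H : Submodule ℍ[ℝ] V} (hH : IsHyperplane H)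
    (M : Submodule ℍ[ℝ] V) : Module.finrank ℍ[ℝ] (V ⧸ (H ⊓ M)) ≤
      1 + Module.finrank ℍ[ℝ] (H ⧸ Submodule.comap H.subtype M) := by
  obtain ⟨a, -, rfl⟩ := hH
  have h1 := Submodule.finrank_quotient_add_finrank (LinearMap.ker a ⊓ M)
  have h2 := Submodule.finrank_quotient_add_finrank (LinearMap.ker a)
  have h3 := Submodule.finrank_quotient_add_finrank
    (Submodule.comap (LinearMap.ker a).subtype M)
  have h4 := Submodule.finrank_map_subtype_eq (LinearMap.ker a)
    (Submodule.comap (LinearMap.ker a).subtype M)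
  rw [Submodule.map_comap_subtype] at h4
  have h5 : Module.finrank ℍ[ℝ] (V ⧸ LinearMap.ker a) ≤ 1 := by
    rw [(LinearMap.quotKerEquivRange a).finrank_eq]
    exact (Submodule.finrank_le _).trans (Module.finrank_self _).le
  omega

variable {𝒜 𝒜' : Finset (Submodule ℍ[ℝ] V)} {H : Submodule ℍ[ℝ] V}

/-- The inclusion of the deletion. -/
def IsDeletion.incl (h : IsDeletion 𝒜 𝒜' H) (A : 𝒜') : 𝒜 := ⟨A, h.subset A.2⟩

theorem IsDeletion.incl_injective (h : IsDeletion 𝒜 𝒜' H) : Function.Injective h.incl :=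
  fun _ _ hAB => Subtype.ext (congrArg (fun C : 𝒜 => (C : Submodule ℍ[ℝ] V)) hAB)

/-- The exterior algebra is `E(𝒜') + e_H E(𝒜')`. Directness of this sum is not needed. -/
theorem IsDeletion.exists_eq_add (h : IsDeletion 𝒜 𝒜' H) (x : E 𝒜) :
    ∃ y z, x = E.map h.incl y + E.gen 𝒜 ⟨H, h.mem⟩ * E.map h.incl z := by
  induction x using E.induction with
  | zero => exact ⟨0, 0, by simp⟩
  | one => exact ⟨1, 0, by simp⟩
  | add x x' hx hx' =>
    obtain ⟨y, z, rfl⟩ := hx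
    obtain ⟨y', z', rfl⟩ := hx'
    exact ⟨y + y', z + z', by rw [map_add, map_add, mul_add]; abel⟩
  | neg x hx =>
    obtain ⟨y, z, rfl⟩ := hx
    exact ⟨-y, -z, by rw [map_neg, map_neg, mul_neg, neg_add]⟩
  | gen_mul A x hx =>
    obtain ⟨y, z, rfl⟩ := hx
    rcases h.eq_or_mem A.1 A.2 with hA | hA
    · obtain rfl : A = ⟨H, h.mem⟩ := Subtype.ext hA
      exact ⟨0, y, by rw [mul_add, ← mul_assoc, E.gen_mul_self, map_zero, zero_mul, zero_add,
        add_zero]⟩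
    · refine ⟨E.gen 𝒜' ⟨A, hA⟩ * y, -(E.gen 𝒜' ⟨A, hA⟩ * z), ?_⟩
      have hA' : E.map h.incl (E.gen 𝒜' ⟨A, hA⟩) = E.gen 𝒜 A := E.map_gen _ _
      rw [mul_add, map_mul, map_neg, map_mul, hA', ← mul_assoc, E.gen_mul_gen A ⟨H, h.mem⟩]
      simp only [neg_mul, mul_neg, mul_assoc]

theorem IsDeletion.gen_mul_map (h : IsDeletion 𝒜 𝒜' H) (x : E 𝒜') :
    E.gen 𝒜 ⟨H, h.mem⟩ * E.map h.incl x =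
      E.map h.incl (CliffordAlgebra.involute x) * E.gen 𝒜 ⟨H, h.mem⟩ := by
  induction x using E.induction with
  | zero => simp
  | one => simp
  | add x y hx hy => simp only [map_add, add_mul, mul_add, hx, hy]
  | neg x hx => simp only [map_neg, neg_mul, mul_neg, hx]
  | gen_mul A x hx =>
    rw [map_mul, map_mul, map_mul, E.involute_gen, map_neg, E.map_gen, ← mul_assoc,
      E.gen_mul_gen ⟨H, h.mem⟩, neg_mul, mul_assoc, hx]
    simp only [neg_mul, mul_assoc]

/-- Elements `z` such that `e_H z` comes from the deletion modulo the Orlik–Solomon ideal. -/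
def IsDeletion.Liftable (h : IsDeletion 𝒜 𝒜' H) (z : E 𝒜') : Prop :=
  ∃ w, E.gen 𝒜 ⟨H, h.mem⟩ * E.map h.incl z - E.map h.incl w ∈ osIdeal 𝒜

namespace IsDeletion

variable (h : IsDeletion 𝒜 𝒜' H)

theorem Liftable.add {h : IsDeletion 𝒜 𝒜' H} {z z' : E 𝒜'} (hz : h.Liftable z)
    (hz' : h.Liftable z') : h.Liftable (z + z') := by
  obtain ⟨w, hw⟩ := hz
  obtain ⟨w', hw'⟩ := hz'
  refine ⟨w + w', ?_⟩
  rw [map_add, map_add, mul_add, add_sub_add_comm]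
  exact add_mem hw hw'

theorem Liftable.neg {h : IsDeletion 𝒜 𝒜' H} {z : E 𝒜'} (hz : h.Liftable z) :
    h.Liftable (-z) := by
  obtain ⟨w, hw⟩ := hz
  refine ⟨-w, ?_⟩
  rw [map_neg, map_neg, mul_neg, neg_sub_neg, ← neg_sub]
  exact neg_mem hw

theorem liftable_zero : h.Liftable 0 := ⟨0, by simp⟩

theorem Liftable.mul_left {h : IsDeletion 𝒜 𝒜' H} {z : E 𝒜'} (hz : h.Liftable z) (x : E 𝒜') :
    h.Liftable (x * z) := by
  obtain ⟨w, hw⟩ := hz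
  refine ⟨CliffordAlgebra.involute x * w, ?_⟩
  rw [map_mul, map_mul, ← mul_assoc, h.gen_mul_map, mul_assoc, ← mul_sub]
  exact Ideal.mul_mem_left _ _ hw

theorem Liftable.mul_right {h : IsDeletion 𝒜 𝒜' H} {z : E 𝒜'} (hz : h.Liftable z) (x : E 𝒜') :
    h.Liftable (z * x) := by
  obtain ⟨w, hw⟩ := hz
  refine ⟨w * x, ?_⟩
  rw [map_mul, map_mul, ← mul_assoc, ← sub_mul]
  exact Ideal.mul_mem_right _ _ hw

theorem map_mem_osIdeal {x : E 𝒜'} (hx : x ∈ osIdeal 𝒜') : E.map h.incl x ∈ osIdeal 𝒜 := by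
  have hx' : x ∈ TwoSidedIdeal.span (osRelations 𝒜') := TwoSidedIdeal.mem_asIdeal.1 hx
  clear hx
  induction hx' using TwoSidedIdeal.span_induction with
  | mem x hx =>
    obtain ⟨r, B, hB, hr, rfl⟩ := hx
    rw [← E.diff_map, E.map_monomial]
    exact E.diff_monomial_mem (h.incl_injective.comp hB) hr
  | zero => rw [map_zero]; exact zero_mem _
  | add x y _ _ hx hy => rw [map_add]; exact add_mem hx hy
  | neg x _ hx => rw [map_neg]; exact neg_mem hx
  | left_absorb a x _ hx => rw [map_mul]; exact Ideal.mul_mem_left _ _ hx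
  | right_absorb b x _ hx => rw [map_mul]; exact Ideal.mul_mem_right _ _ hx

variable [Module.Finite ℍ[ℝ] V]

/-- Adding `H` to the family gives a relation of `𝒜`, namely `∂(e_H e_A) = e_A - e_H ∂e_A`. The
hyperplanes must be distinct in `𝒜'`, but their traces on `H` may coincide. -/
theorem liftable_diff_monomial (hH : IsHyperplane H) {r : ℕ} {A : Fin r → 𝒜'}
    (hA : Function.Injective A)
    (hr : Module.finrank ℍ[ℝ] (H ⧸ ⨅ i, Submodule.comap H.subtype (A i)) < r) :
    h.Liftable (E.diff 𝒜' (E.monomial 𝒜' A)) := by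
  refine ⟨E.monomial 𝒜' A, ?_⟩
  rw [← E.diff_map, E.map_monomial, ← neg_sub, ← E.diff_gen_mul, ← E.monomial_cons]
  refine neg_mem (E.diff_monomial_mem ?_ ?_)
  · rw [Fin.cons_injective_iff]
    refine ⟨?_, h.incl_injective.comp hA⟩
    rintro ⟨i, hi⟩
    have hi' : (A i : Submodule ℍ[ℝ] V) = H := congrArg (fun C : 𝒜 => (C : Submodule ℍ[ℝ] V)) hi
    exact h.notMem (hi' ▸ (A i).2)
  · have : ⨅ i, (((Fin.cons ⟨H, h.mem⟩ (h.incl ∘ A) : Fin (r + 1) → 𝒜) i : 𝒜) : Submodule ℍ[ℝ] V) =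
        H ⊓ ⨅ i, (A i : Submodule ℍ[ℝ] V) := by
      refine le_antisymm (le_inf (iInf_le _ 0) (le_iInf fun i => iInf_le_of_le i.succ le_rfl)) ?_
      refine le_iInf fun i => Fin.cases inf_le_left (fun i => ?_) i
      exact inf_le_right.trans (iInf_le _ i)
    rw [this]
    refine (finrank_quotient_inf_le hH _).trans_lt ?_
    rw [Submodule.comap_iInf]
    omega

/-- Two hyperplanes with the same trace on `H` form a pair of codimension at most one in `H`, so the
difference of their generators is a case of the preceding lemma. -/
theorem liftable_gen_sub_gen (hH : IsHyperplane H) (h𝒜' : ∀ A ∈ 𝒜', IsHyperplane A) {A B : 𝒜'}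
    (hAB : toRestriction 𝒜' H A = toRestriction 𝒜' H B) :
    h.Liftable (E.gen 𝒜' A - E.gen 𝒜' B) := by
  by_cases hne : A = B
  · rw [hne, sub_self]
    exact h.liftable_zero
  have hd : E.diff 𝒜' (E.monomial 𝒜' ![A, B]) = E.gen 𝒜' B - E.gen 𝒜' A := by
    have : E.monomial 𝒜' ![A, B] = E.gen 𝒜' A * E.gen 𝒜' B := by
      simp [E.monomial_eq_listProd, E.listProd]
    rw [this, E.diff_gen_mul, E.diff_gen, mul_one]
  rw [← neg_sub, ← hd]
  refine (h.liftable_diff_monomial hH ?_ ?_).neg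
  · intro i j hij
    fin_cases i <;> fin_cases j <;> simp_all [eq_comm]
  · have hc : ⨅ i, Submodule.comap H.subtype ((![A, B] i : 𝒜') : Submodule ℍ[ℝ] V) =
        Submodule.comap H.subtype A := by
      have hAB' : Submodule.comap H.subtype (A : Submodule ℍ[ℝ] V) =
        Submodule.comap H.subtype B := congrArg Subtype.val hAB
      refine le_antisymm (iInf_le_of_le 0 le_rfl) (le_iInf fun i => ?_)
      fin_cases i
      · exact le_rfl
      · exact hAB'.le
    obtain ⟨a, -, ha⟩ := h𝒜' A A.2
    have ha' : Submodule.comap H.subtype (A : Submodule ℍ[ℝ] V) =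
        LinearMap.ker (a ∘ₗ H.subtype) := by
      rw [LinearMap.ker_comp, ha]
    rw [hc, ha', (LinearMap.quotKerEquivRange _).finrank_eq]
    exact (Submodule.finrank_le _).trans_lt ((Module.finrank_self _).trans_lt one_lt_two)

/-- Elements that vanish in the Orlik–Solomon algebra of the restriction are liftable. -/
theorem liftable_of_map_mem (hH : IsHyperplane H) (h𝒜' : ∀ A ∈ 𝒜', IsHyperplane A) {z : E 𝒜'}
    (hz : E.map (toRestriction 𝒜' H) z ∈ osIdeal (restriction 𝒜' H)) : h.Liftable z := by
  -- Choose one hyperplane for each trace. Then `z` is the sum of `z - σ(π z)`, which is built from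
  -- differences of generators with equal trace, and `σ(π z)`, which is a lifted relation.
  obtain ⟨σ, hσ⟩ := (toRestriction_surjective 𝒜' H).hasRightInverse
  have h1 : ∀ z, h.Liftable (z - E.map σ (E.map (toRestriction 𝒜' H) z)) := by
    intro z
    induction z using E.induction with
    | zero => simpa using h.liftable_zero
    | one => simpa using h.liftable_zero
    | add x y hx hy =>
      rw [map_add, map_add, add_sub_add_comm]
      exact hx.add hy
    | neg x hx =>
      rw [map_neg, map_neg, neg_sub_neg, ← neg_sub]
      exact hx.neg
    | gen_mul A x hx =>
      have e : E.gen 𝒜' A * x - E.map σ (E.map (toRestriction 𝒜' H) (E.gen 𝒜' A * x)) =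
          (E.gen 𝒜' A - E.gen 𝒜' (σ (toRestriction 𝒜' H A))) * x +
            E.gen 𝒜' (σ (toRestriction 𝒜' H A)) *
              (x - E.map σ (E.map (toRestriction 𝒜' H) x)) := by
        rw [map_mul, map_mul, E.map_gen, E.map_gen, sub_mul, mul_sub]
        abel
      rw [e]
      exact ((h.liftable_gen_sub_gen hH h𝒜' (hσ _).symm).mul_right x).add (hx.mul_left _)
  have h2 : ∀ w ∈ osIdeal (restriction 𝒜' H), h.Liftable (E.map σ w) := by
    intro w hw
    have hw' : w ∈ TwoSidedIdeal.span (osRelations (restriction 𝒜' H)) :=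
      TwoSidedIdeal.mem_asIdeal.1 hw
    clear hw
    induction hw' using TwoSidedIdeal.span_induction with
    | mem x hx =>
      obtain ⟨r, B, hB, hr, rfl⟩ := hx
      rw [← E.diff_map, E.map_monomial]
      refine h.liftable_diff_monomial hH (hσ.injective.comp hB) ?_
      have : ∀ i, Submodule.comap H.subtype ((σ ∘ B) i : Submodule ℍ[ℝ] V) = B i := fun i =>
        congrArg Subtype.val (hσ (B i))
      rwa [iInf_congr this]
    | zero => rw [map_zero]; exact h.liftable_zero
    | add x y _ _ hx hy => rw [map_add]; exact hx.add hy
    | neg x _ hx => rw [map_neg]; exact hx.neg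
    | left_absorb a x _ hx => rw [map_mul]; exact hx.mul_left _
    | right_absorb b x _ hx => rw [map_mul]; exact hx.mul_right _
  rw [← sub_add_cancel z (E.map σ (E.map (toRestriction 𝒜' H) z))]
  exact (h1 z).add (h2 _ hz)

end IsDeletion

end DeletionRestriction

end QuaternionicArrangement
end

noncomputable section

namespace QuaternionicArrangement

open SingularCohomology

universe u

/-! ### Deletion and restriction: topology -/

section Tube

variable {V : Type u} [AddCommGroup V] [Module ℍ[ℝ] V]

/-- A form that vanished on `H` would be a right multiple of the form defining `H`, and `H` would
belong to `𝒜`. -/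
theorem isHyperplane_restriction {𝒜 : Finset (Submodule ℍ[ℝ] V)}
    (h𝒜 : ∀ A ∈ 𝒜, IsHyperplane A) {H : Submodule ℍ[ℝ] V} (hH : IsHyperplane H) (hn : H ∉ 𝒜) :
    ∀ B ∈ restriction 𝒜 H, IsHyperplane B := by
  intro B hB
  obtain ⟨A, hA⟩ := toRestriction_surjective 𝒜 H ⟨B, hB⟩
  have hB' : B = Submodule.comap H.subtype A := congrArg Subtype.val hA.symm
  refine ⟨(form h𝒜 A).comp H.subtype, fun h0 => hn ?_, by rw [LinearMap.ker_comp, ker_form, hB']⟩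
  obtain ⟨a, ha, rfl⟩ := hH
  obtain ⟨v, hv⟩ := exists_form_eq_one ha
  have hle : ∀ w, a w = 0 → form h𝒜 A w = 0 := fun w hw => DFunLike.congr_fun h0 ⟨w, hw⟩
  have hmul : ∀ w, form h𝒜 A w = a w * form h𝒜 A v := by
    intro w
    have := hle (w - a w • v) (by rw [map_sub, map_smul, hv, smul_eq_mul, mul_one, sub_self])
    rwa [map_sub, map_smul, sub_eq_zero, smul_eq_mul] at this
  have hne : form h𝒜 A v ≠ 0 := by
    intro h
    refine form_ne_zero_of_mem h𝒜 (a := form h𝒜 A) (by rw [ker_form]; exact A.2) ?_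
    ext1 w
    rw [hmul, h, mul_zero, LinearMap.zero_apply]
  have : LinearMap.ker a = A := by
    rw [← ker_form h𝒜 A]
    ext w
    rw [LinearMap.mem_ker, LinearMap.mem_ker, hmul, mul_eq_zero, or_iff_left hne]
  rw [this]
  exact A.2

theorem IsDeletion.notMem_of_notMem {H : Submodule ℍ[ℝ] V} {𝒜 𝒜' : Finset (Submodule ℍ[ℝ] V)}
    (h : IsDeletion 𝒜 𝒜' H) {w : V} (hw : w ∉ H) (hw' : ∀ A ∈ 𝒜', w ∉ A) : ∀ A ∈ 𝒜, w ∉ A := by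
  intro A hA
  rcases h.eq_or_mem A hA with rfl | hA'
  exacts [hw, hw' A hA']

variable {𝒜 : Finset (Submodule ℍ[ℝ] V)} (h𝒜 : ∀ A ∈ 𝒜, IsHyperplane A)
  {H : Submodule ℍ[ℝ] V} (v : V)

theorem form_ne_zero_of_restriction (A : 𝒜) (x : HyperplaneComplement (restriction 𝒜 H)) :
    form h𝒜 A (x.1 : V) ≠ 0 := by
  intro h
  refine x.2 _ (toRestriction 𝒜 H A).2 ?_
  show (x.1 : V) ∈ A.1
  rw [← ker_form h𝒜 A]
  exact h

/-- The radius of a tube around the complement of the restriction that avoids the hyperplanes. -/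
def tubeRadius (x : HyperplaneComplement (restriction 𝒜 H)) : ℝ :=
  (1 + ∑ A : 𝒜, ‖form h𝒜 A v‖ / ‖form h𝒜 A (x.1 : V)‖)⁻¹

theorem one_add_sum_pos (x : HyperplaneComplement (restriction 𝒜 H)) :
    0 < 1 + ∑ A : 𝒜, ‖form h𝒜 A v‖ / ‖form h𝒜 A (x.1 : V)‖ :=
  add_pos_of_pos_of_nonneg one_pos (Finset.sum_nonneg fun _ _ => by positivity)

theorem tubeRadius_pos (x : HyperplaneComplement (restriction 𝒜 H)) : 0 < tubeRadius h𝒜 v x :=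
  inv_pos.2 (one_add_sum_pos h𝒜 v x)

/-- The sum dominates every single ratio and stays continuous in `x`; the added `1` makes the
inequality strict and keeps the radius defined for an empty arrangement. -/
theorem tubeRadius_mul_lt (A : 𝒜) (x : HyperplaneComplement (restriction 𝒜 H)) :
    tubeRadius h𝒜 v x * ‖form h𝒜 A v‖ < ‖form h𝒜 A (x.1 : V)‖ := by
  have h0 : 0 < ‖form h𝒜 A (x.1 : V)‖ := norm_pos_iff.2 (form_ne_zero_of_restriction h𝒜 A x)
  have h1 := Finset.single_le_sum (f := fun A : 𝒜 => ‖form h𝒜 A v‖ / ‖form h𝒜 A (x.1 : V)‖)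
    (fun _ _ => by positivity) (Finset.mem_univ A)
  rw [tubeRadius, inv_mul_lt_iff₀ (one_add_sum_pos h𝒜 v x), ← div_lt_iff₀ h0]
  linarith

/-- The tube around the complement of the restriction. -/
def tube (p : ℍ[ℝ] × HyperplaneComplement (restriction 𝒜 H)) : V :=
  -- The homeomorphism of `ℍ` with its open unit ball lets the tube be parametrised by the whole of
  -- `ℍ`.
  (p.2.1 : V) + (tubeRadius h𝒜 v p.2 • (Homeomorph.unitBall p.1 : ℍ[ℝ])) • v

theorem tube_notMem (p : ℍ[ℝ] × HyperplaneComplement (restriction 𝒜 H)) :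
    ∀ A ∈ 𝒜, tube h𝒜 v p ∉ A := by
  intro A hA hp
  obtain ⟨A, rfl⟩ : ∃ B : 𝒜, B.1 = A := ⟨⟨A, hA⟩, rfl⟩
  rw [← ker_form h𝒜 A, LinearMap.mem_ker, tube, map_add, map_smul, smul_eq_mul] at hp
  have h1 := tubeRadius_mul_lt h𝒜 v A p.2
  have h2 : ‖(Homeomorph.unitBall p.1 : ℍ[ℝ])‖ < 1 :=
    mem_ball_zero_iff.1 (Homeomorph.unitBall p.1).2
  have h3 := tubeRadius_pos h𝒜 v p.2
  rw [eq_neg_of_add_eq_zero_left hp, norm_neg, norm_mul, norm_smul, Real.norm_of_nonneg h3.le,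
    mul_right_comm] at h1
  exact absurd h1 (not_lt.2 (mul_le_of_le_one_right (by positivity) h2.le))

theorem form_tube {a : V →ₗ[ℍ[ℝ]] ℍ[ℝ]} {v : V} (hv : a v = 1)
    (p : ℍ[ℝ] × HyperplaneComplement (restriction 𝒜 (LinearMap.ker a))) :
    a (tube h𝒜 v p) = tubeRadius h𝒜 v p.2 • (Homeomorph.unitBall p.1 : ℍ[ℝ]) := by
  rw [tube, map_add, map_smul, hv, LinearMap.mem_ker.1 p.2.1.2, zero_add, smul_eq_mul, mul_one]

theorem form_tube_eq_zero_iff {a : V →ₗ[ℍ[ℝ]] ℍ[ℝ]} {v : V} (hv : a v = 1)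
    (p : ℍ[ℝ] × HyperplaneComplement (restriction 𝒜 (LinearMap.ker a))) :
    a (tube h𝒜 v p) = 0 ↔ p.1 = 0 := by
  rw [form_tube h𝒜 hv, smul_eq_zero, or_iff_right (tubeRadius_pos h𝒜 v p.2).ne',
    Homeomorph.unitBall_apply_coe, OpenPartialHomeomorph.univUnitBall_apply, smul_eq_zero, or_iff_right]
  positivity

theorem tube_zero (x : HyperplaneComplement (restriction 𝒜 H)) : tube h𝒜 v (0, x) = x.1 := by
  rw [tube, Homeomorph.coe_unitBall_apply_zero, smul_zero, zero_smul, add_zero]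

variable [TopologicalSpace V] [IsTopologicalAddGroup V] [ContinuousSMul ℍ[ℝ] V] [T2Space V]
  [Module.Finite ℍ[ℝ] V]

theorem isOpen_complement {𝒜 : Finset (Submodule ℍ[ℝ] V)} (h𝒜 : ∀ A ∈ 𝒜, IsHyperplane A) :
    IsOpen {v : V | ∀ A ∈ 𝒜, v ∉ A} := by
  have : {v : V | ∀ A ∈ 𝒜, v ∉ A} = ⋂ A ∈ 𝒜, {v | v ∉ A} := by
    ext v
    simp
  rw [this]
  refine isOpen_biInter_finset fun A hA => ?_
  obtain ⟨a, -, rfl⟩ := h𝒜 A hA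
  exact isOpen_ne_fun (continuous_form a) continuous_const

/-- A vector space is the product of the kernel of a form with a complementary line. -/
def kerProdHomeomorph (a : V →ₗ[ℍ[ℝ]] ℍ[ℝ]) {v : V} (hv : a v = 1) :
    ℍ[ℝ] × LinearMap.ker a ≃ₜ V where
  toFun p := p.2 + p.1 • v
  invFun w := (a w, ⟨w - a w • v, by
    rw [LinearMap.mem_ker, map_sub, map_smul, hv, smul_eq_mul, mul_one, sub_self]⟩)
  left_inv p := by
    have h : a (p.2 + p.1 • v) = p.1 := by
      rw [map_add, map_smul, hv, LinearMap.mem_ker.1 p.2.2, zero_add, smul_eq_mul, mul_one]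
    refine Prod.ext h (Subtype.ext ?_)
    show (p.2 : V) + p.1 • v - a (p.2 + p.1 • v) • v = p.2
    rw [h, add_sub_cancel_right]
  right_inv w := sub_add_cancel _ _
  continuous_toFun := by fun_prop
  continuous_invFun := by
    have := continuous_form a
    exact this.prodMk ((continuous_id.sub (this.smul continuous_const)).subtype_mk _)

theorem continuous_tubeRadius :
    Continuous (tubeRadius h𝒜 v : HyperplaneComplement (restriction 𝒜 H) → ℝ) := by
  refine Continuous.inv₀ ?_ fun x => (one_add_sum_pos h𝒜 v x).ne'
  refine continuous_const.add (continuous_finsetSum _ fun A _ => ?_)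
  refine continuous_const.div ?_ fun x => norm_ne_zero_iff.2 (form_ne_zero_of_restriction h𝒜 A x)
  exact ((continuous_form (form h𝒜 A)).comp
    (continuous_subtype_val.comp continuous_subtype_val)).norm

/-- The fibrewise scaling by the radius of the tube. -/
def tubeScaling : ℍ[ℝ] × HyperplaneComplement (restriction 𝒜 H) ≃ₜ
    ℍ[ℝ] × HyperplaneComplement (restriction 𝒜 H) where
  toFun p := (tubeRadius h𝒜 v p.2 • p.1, p.2)
  invFun p := ((tubeRadius h𝒜 v p.2)⁻¹ • p.1, p.2)
  left_inv p := Prod.ext (inv_smul_smul₀ (tubeRadius_pos h𝒜 v p.2).ne' _) rfl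
  right_inv p := Prod.ext (smul_inv_smul₀ (tubeRadius_pos h𝒜 v p.2).ne' _) rfl
  continuous_toFun := (((continuous_tubeRadius h𝒜 v).comp continuous_snd).smul
    continuous_fst).prodMk continuous_snd
  continuous_invFun := ((((continuous_tubeRadius h𝒜 v).comp continuous_snd).inv₀
    fun p => (tubeRadius_pos h𝒜 v p.2).ne').smul continuous_fst).prodMk continuous_snd

/-- The tube factors as shrinking to the unit ball, fibrewise scaling, inclusion of an open subset
of the hyperplane, and the splitting of `V` along `v`. -/
theorem isOpenEmbedding_tube {a : V →ₗ[ℍ[ℝ]] ℍ[ℝ]} {v : V} (hv : a v = 1)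
    (hn : LinearMap.ker a ∉ 𝒜) : Topology.IsOpenEmbedding
      (tube h𝒜 v : ℍ[ℝ] × HyperplaneComplement (restriction 𝒜 (LinearMap.ker a)) → V) := by
  have ha : IsHyperplane (LinearMap.ker a) := ⟨a, by rintro rfl; simp at hv, rfl⟩
  have h1 : Topology.IsOpenEmbedding fun q : ℍ[ℝ] => (Homeomorph.unitBall q : ℍ[ℝ]) :=
    (Metric.isOpen_ball.isOpenEmbedding_subtypeVal).comp Homeomorph.unitBall.isOpenEmbedding
  have h2 : Topology.IsOpenEmbedding
      (Subtype.val : HyperplaneComplement (restriction 𝒜 (LinearMap.ker a)) → _) :=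
    (isOpen_complement (isHyperplane_restriction h𝒜 ha hn)).isOpenEmbedding_subtypeVal
  exact (kerProdHomeomorph a hv).isOpenEmbedding.comp
    ((Topology.IsOpenEmbedding.id.prodMap h2).comp
      ((tubeScaling h𝒜 v).isOpenEmbedding.comp (h1.prodMap Topology.IsOpenEmbedding.id)))

end Tube

/-! ### The square of a deletion and its maps on cohomology -/

section Square

variable {V : Type u} [AddCommGroup V] [Module ℍ[ℝ] V] [TopologicalSpace V]
  [IsTopologicalAddGroup V] [ContinuousSMul ℍ[ℝ] V] [T2Space V] [Module.Finite ℍ[ℝ] V]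
  {𝒜 𝒜' : Finset (Submodule ℍ[ℝ] V)} {a : V →ₗ[ℍ[ℝ]] ℍ[ℝ]} {v : V}

namespace IsDeletion

/-- The complement of an arrangement is contained in the complement of a deletion. -/
def inclComplement {H : Submodule ℍ[ℝ] V} (h : IsDeletion 𝒜 𝒜' H) :
    C(HyperplaneComplement 𝒜, HyperplaneComplement 𝒜') :=
  subtypeIncl fun _ hv A hA => hv A (h.subset hA)

variable (h : IsDeletion 𝒜 𝒜' (LinearMap.ker a)) (h𝒜 : ∀ A ∈ 𝒜, IsHyperplane A)
  (h𝒜' : ∀ A ∈ 𝒜', IsHyperplane A) (hv : a v = 1)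

/-- The cover of the complement of the deletion by the complement of the arrangement and a tube
around the complement of the restriction. -/
def square : OpenSquare
    (ℍ[ℝ]ˣ × HyperplaneComplement (restriction 𝒜' (LinearMap.ker a))) (HyperplaneComplement 𝒜)
    (ℍ[ℝ] × HyperplaneComplement (restriction 𝒜' (LinearMap.ker a))) (HyperplaneComplement 𝒜') where
  iA := ⟨fun p => ⟨tube h𝒜' v ((p.1 : ℍ[ℝ]), p.2), h.notMem_of_notMem
      (fun hp => p.1.ne_zero ((form_tube_eq_zero_iff h𝒜' hv _).1 hp)) (tube_notMem h𝒜' v _)⟩,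
    ((isOpenEmbedding_tube h𝒜' hv h.notMem).continuous.comp
      (Units.continuous_val.prodMap continuous_id)).subtype_mk _⟩
  iB := ⟨Prod.map Units.val id, Units.continuous_val.prodMap continuous_id⟩
  jA := h.inclComplement
  jB := ⟨fun p => ⟨tube h𝒜' v p, tube_notMem h𝒜' v p⟩,
    (isOpenEmbedding_tube h𝒜' hv h.notMem).continuous.subtype_mk _⟩
  comm := rfl
  isEmbedding_iA := by
    refine Topology.IsEmbedding.of_comp (ContinuousMap.continuous _) continuous_subtype_val ?_
    exact (isOpenEmbedding_tube h𝒜' hv h.notMem).isEmbedding.comp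
      (Units.isEmbedding_val₀.prodMap Topology.IsEmbedding.id)
  isOpenEmbedding_jA := isOpenEmbedding_subtypeIncl _ (isOpen_complement h𝒜)
  isOpenEmbedding_jB := Topology.IsOpenEmbedding.of_comp _
    (isOpen_complement h𝒜').isOpenEmbedding_subtypeVal (isOpenEmbedding_tube h𝒜' hv h.notMem)
  cover x := by
    -- Points of `X'` on `H` are the zero section of the tube; the other points lie in `X`.
    by_cases hx : a x.1 = 0
    · refine Or.inr ⟨(0, ⟨⟨x.1, hx⟩, fun B hB hxB => ?_⟩), Subtype.ext (tube_zero h𝒜' v _)⟩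
      obtain ⟨A, hA⟩ := toRestriction_surjective 𝒜' (LinearMap.ker a) ⟨B, hB⟩
      obtain rfl : Submodule.comap (LinearMap.ker a).subtype A.1 = B := congrArg Subtype.val hA
      exact x.2 A.1 A.2 hxB
    · exact Or.inl ⟨⟨x.1, h.notMem_of_notMem hx x.2⟩, rfl⟩
  exists_of_eq x p hxp := by
    have hxp' : (x : V) = tube h𝒜' v p := congrArg Subtype.val hxp
    have hp : p.1 ≠ 0 := fun hp => x.2 _ h.mem (by
      rw [LinearMap.mem_ker, hxp']
      exact (form_tube_eq_zero_iff h𝒜' hv p).2 hp)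
    exact ⟨(Units.mk0 p.1 hp, p.2), Subtype.ext hxp'.symm, rfl⟩

variable {s : Cohomology ℍ[ℝ]ˣ 3} (hs : IsGenerator s)

theorem pull_inclComplement {H : Submodule ℍ[ℝ] V} (h : IsDeletion 𝒜 𝒜' H) (y : E 𝒜') :
    pull h.inclComplement (toCohomology hs h𝒜' y) = toCohomology hs h𝒜 (E.map h.incl y) := by
  induction y using E.induction with
  | zero => simp
  | one => simp
  | add x y hx hy => simp only [map_add, hx, hy]
  | neg x hx => simp only [map_neg, hx]
  | gen_mul A x hx =>
    rw [map_mul, map_mul, map_mul, map_mul, hx, E.map_gen, toCohomology_gen, toCohomology_gen]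
    congr 1
    have hA : LinearMap.ker (form h𝒜' A) ∈ 𝒜 := by
      rw [ker_form]
      exact h.subset A.2
    have h1 : h.incl A = ⟨LinearMap.ker (form h𝒜' A), hA⟩ := Subtype.ext (ker_form h𝒜' A).symm
    rw [h1, ← pull_formMap hs h𝒜, hypClass, ← pull_comp]
    rfl

end IsDeletion

/-- The inclusion of the complement of the restriction. -/
def restrictionIncl (𝒜 : Finset (Submodule ℍ[ℝ] V)) (H : Submodule ℍ[ℝ] V) :
    C(HyperplaneComplement (restriction 𝒜 H), HyperplaneComplement 𝒜) :=
  ⟨fun x => ⟨x.1.1, fun A hA hx => x.2 _ (toRestriction 𝒜 H ⟨A, hA⟩).2 hx⟩,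
    (continuous_subtype_val.comp continuous_subtype_val).subtype_mk _⟩

theorem pull_restrictionIncl {s : Cohomology ℍ[ℝ]ˣ 3} (hs : IsGenerator s)
    {H : Submodule ℍ[ℝ] V} (h𝒜 : ∀ A ∈ 𝒜, IsHyperplane A)
    (hr : ∀ B ∈ restriction 𝒜 H, IsHyperplane B) (y : E 𝒜) :
    pull (restrictionIncl 𝒜 H) (toCohomology hs h𝒜 y) =
      toCohomology hs hr (E.map (toRestriction 𝒜 H) y) := by
  induction y using E.induction with
  | zero => simp
  | one => simp
  | add x y hx hy => simp only [map_add, hx, hy]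
  | neg x hx => simp only [map_neg, hx]
  | gen_mul A x hx =>
    rw [map_mul, map_mul, map_mul, map_mul, hx, E.map_gen, toCohomology_gen, toCohomology_gen]
    congr 1
    have hk : LinearMap.ker ((form h𝒜 A).comp H.subtype) = (toRestriction 𝒜 H A).1 := by
      rw [LinearMap.ker_comp, ker_form]
      rfl
    have hA : LinearMap.ker ((form h𝒜 A).comp H.subtype) ∈ restriction 𝒜 H := by
      rw [hk]
      exact (toRestriction 𝒜 H A).2
    have h1 : toRestriction 𝒜 H A = ⟨_, hA⟩ := Subtype.ext hk.symm
    rw [h1, ← pull_formMap hs hr, hypClass, ← pull_comp]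
    rfl

/-- Multiplication by the constant `-1` leaves the class unchanged and reduces to negative real
part. -/
theorem pull_ringClass_eq_zero_of_re_pos {X : Type u} [TopologicalSpace X]
    {s : Cohomology ℍ[ℝ]ˣ 3} (hs : IsGenerator s) (f : C(X, ℍ[ℝ]ˣ))
    (hf : ∀ x, 0 < (f x : ℍ[ℝ]).re) : pull f (ringClass s) = 0 := by
  have h : f = (f * ContinuousMap.const X (-1)) * ContinuousMap.const X (-1) := by
    ext1 x
    simp
  rw [h, pull_mul_ringClass hs, pull_const_ringClass, add_zero]
  refine pull_ringClass_eq_zero_of_re_neg _ fun x => ?_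
  simpa using hf x

namespace IsDeletion

variable (h : IsDeletion 𝒜 𝒜' (LinearMap.ker a)) (h𝒜 : ∀ A ∈ 𝒜, IsHyperplane A)
  (h𝒜' : ∀ A ∈ 𝒜', IsHyperplane A) (hv : a v = 1)

/-- The tube contracts to its zero section, so a class on it is determined by its restriction to
`X''`. -/
theorem pull_jB (x : CohomologyRing (HyperplaneComplement 𝒜')) :
    pull (h.square h𝒜 h𝒜' hv).jB x =
      pull ContinuousMap.snd (pull (restrictionIncl 𝒜' (LinearMap.ker a)) x) := by
  let z : C(HyperplaneComplement (restriction 𝒜' (LinearMap.ker a)),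
      ℍ[ℝ] × HyperplaneComplement (restriction 𝒜' (LinearMap.ker a))) :=
    (ContinuousMap.const _ 0).prodMk (ContinuousMap.id _)
  have : ContractibleSpace ℍ[ℝ] := RealTopologicalVectorSpace.contractibleSpace
  obtain ⟨y, hy⟩ := (pull_snd_bijective (X := ℍ[ℝ])
    (Y := HyperplaneComplement (restriction 𝒜' (LinearMap.ker a)))).2
      (pull (h.square h𝒜 h𝒜' hv).jB x)
  have h1 : ((h.square h𝒜 h𝒜' hv).jB).comp z = restrictionIncl 𝒜' (LinearMap.ker a) := by
    ext1 w
    exact Subtype.ext (tube_zero h𝒜' v w)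
  have h2 : (ContinuousMap.snd : C(ℍ[ℝ] × HyperplaneComplement (restriction 𝒜' (LinearMap.ker a)),
      _)).comp z = ContinuousMap.id _ := rfl
  rw [← hy, ← h1, pull_comp, ← hy, ← pull_comp z, h2, pull_id]

/-- Along the tube, `a` is the coordinate in `ℍˣ` times a positive real function, and the latter
contributes zero. -/
theorem pull_iA_hypClass {s : Cohomology ℍ[ℝ]ˣ 3} (hs : IsGenerator s) :
    pull (h.square h𝒜 h𝒜' hv).iA (hypClass h𝒜 s ⟨LinearMap.ker a, h.mem⟩) =
      pull ContinuousMap.fst (ringClass s) := by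
  rw [← pull_formMap hs h𝒜 a h.mem, ← pull_comp]
  let r : ℍ[ℝ]ˣ × HyperplaneComplement (restriction 𝒜' (LinearMap.ker a)) → ℝ :=
    fun p => tubeRadius h𝒜' v p.2 * (√(1 + ‖(p.1 : ℍ[ℝ])‖ ^ 2))⁻¹
  have hr : ∀ p, 0 < r p := fun p => mul_pos (tubeRadius_pos h𝒜' v p.2) (by positivity)
  have hrc : Continuous r := by
    refine ((continuous_tubeRadius h𝒜' v).comp continuous_snd).mul (Continuous.inv₀ ?_ fun p => ?_)
    · exact (continuous_const.add
        ((Units.continuous_val.comp continuous_fst).norm.pow 2)).sqrt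
    · positivity
  let g : C(ℍ[ℝ]ˣ × HyperplaneComplement (restriction 𝒜' (LinearMap.ker a)), ℍ[ℝ]ˣ) :=
    ⟨fun p => Units.mk0 (r p : ℍ[ℝ]) (fun h0 => (hr p).ne' (by simpa using congrArg QuaternionAlgebra.re h0)), by
      rw [Units.isEmbedding_val₀.continuous_iff]
      exact Quaternion.continuous_coe.comp hrc⟩
  have hg : pull g (ringClass s) = 0 :=
    pull_ringClass_eq_zero_of_re_pos hs g fun p => by simpa [g] using hr p
  have : (formMap 𝒜 a h.mem).comp (h.square h𝒜 h𝒜' hv).iA = g * ContinuousMap.fst := by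
    ext1 p
    refine Units.ext ((form_tube h𝒜' hv _).trans ?_)
    rw [Homeomorph.unitBall_apply_coe, OpenPartialHomeomorph.univUnitBall_apply, smul_smul]
    exact (Quaternion.coe_mul_eq_smul _ _).symm
  rw [this, pull_mul_ringClass hs, hg, zero_add]

end IsDeletion

end Square

end QuaternionicArrangement
end

noncomputable section

namespace QuaternionicArrangement

open SingularCohomology

universe u

/-! ### The Orlik–Solomon presentation -/

section Presentation

variable {s : Cohomology ℍ[ℝ]ˣ 3} (hs : IsGenerator s)

/-- The map from the exterior algebra to cohomology is surjective with kernel in the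
Orlik–Solomon ideal. -/
def IsPresentation {V : Type u} [AddCommGroup V] [Module ℍ[ℝ] V] [TopologicalSpace V]
    [IsTopologicalAddGroup V] [ContinuousSMul ℍ[ℝ] V] [T2Space V] [Module.Finite ℍ[ℝ] V]
    {𝒜 : Finset (Submodule ℍ[ℝ] V)} (h𝒜 : ∀ A ∈ 𝒜, IsHyperplane A) : Prop :=
  Function.Surjective (toCohomology hs h𝒜) ∧ ∀ x, toCohomology hs h𝒜 x = 0 → x ∈ osIdeal 𝒜

theorem E.exists_intCast {V : Type u} [AddCommGroup V] [Module ℍ[ℝ] V]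
    (x : E (∅ : Finset (Submodule ℍ[ℝ] V))) : ∃ k : ℤ, x = k := by
  induction x using E.induction with
  | zero => exact ⟨0, by simp⟩
  | one => exact ⟨1, by simp⟩
  | add x y hx hy =>
    obtain ⟨k, rfl⟩ := hx
    obtain ⟨l, rfl⟩ := hy
    exact ⟨k + l, by simp⟩
  | neg x hx =>
    obtain ⟨k, rfl⟩ := hx
    exact ⟨-k, by simp⟩
  | gen_mul A x hx => exact absurd A.2 (Finset.notMem_empty _)

theorem E.map_surjective {V W : Type*} [AddCommGroup V] [Module ℍ[ℝ] V] [AddCommGroup W]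
    [Module ℍ[ℝ] W] {𝒜 : Finset (Submodule ℍ[ℝ] V)} {ℬ : Finset (Submodule ℍ[ℝ] W)} {f : 𝒜 → ℬ}
    (hf : Function.Surjective f) : Function.Surjective (E.map f) := by
  intro x
  induction x using E.induction with
  | zero => exact ⟨0, map_zero _⟩
  | one => exact ⟨1, map_one _⟩
  | add x y hx hy =>
    obtain ⟨x, rfl⟩ := hx
    obtain ⟨y, rfl⟩ := hy
    exact ⟨x + y, map_add _ _ _⟩
  | neg x hx =>
    obtain ⟨x, rfl⟩ := hx
    exact ⟨-x, map_neg _ _⟩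
  | gen_mul B x hx =>
    obtain ⟨x, rfl⟩ := hx
    obtain ⟨A, rfl⟩ := hf B
    exact ⟨E.gen 𝒜 A * x, by rw [map_mul, E.map_gen]⟩

theorem contractibleSpace_complement_empty {V : Type u} [AddCommGroup V] [Module ℍ[ℝ] V]
    [TopologicalSpace V] [IsTopologicalAddGroup V] [ContinuousSMul ℍ[ℝ] V] :
    ContractibleSpace (HyperplaneComplement (∅ : Finset (Submodule ℍ[ℝ] V))) := by
  have hc : ContractibleSpace V := by
    let _ : Module ℝ V := Module.compHom V (algebraMap ℝ ℍ[ℝ])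
    have : ContinuousSMul ℝ V := ⟨by
      show Continuous fun p : ℝ × V => (algebraMap ℝ ℍ[ℝ] p.1) • p.2
      exact ((continuous_algebraMap ℝ ℍ[ℝ]).comp continuous_fst).smul continuous_snd⟩
    exact RealTopologicalVectorSpace.contractibleSpace
  have he : {v : V | ∀ A ∈ (∅ : Finset (Submodule ℍ[ℝ] V)), v ∉ A} = Set.univ := by
    ext v
    simp
  exact ((Homeomorph.setCongr he).trans (Homeomorph.Set.univ V)).contractibleSpace

variable {V : Type u} [AddCommGroup V] [Module ℍ[ℝ] V] [TopologicalSpace V]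
  [IsTopologicalAddGroup V] [ContinuousSMul ℍ[ℝ] V] [T2Space V] [Module.Finite ℍ[ℝ] V]

theorem isPresentation_empty
    (h𝒜 : ∀ A ∈ (∅ : Finset (Submodule ℍ[ℝ] V)), IsHyperplane A) : IsPresentation hs h𝒜 := by
  have := contractibleSpace_complement_empty (V := V)
  refine ⟨fun x => ?_, fun x hx => ?_⟩
  · obtain ⟨k, rfl⟩ := exists_intCast_of_contractible x
    exact ⟨k, map_intCast _ k⟩
  · obtain ⟨k, rfl⟩ := E.exists_intCast x
    rw [map_intCast] at hx
    rw [intCast_eq_zero hx, Int.cast_zero]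
    exact zero_mem _

namespace IsDeletion

variable {𝒜 𝒜' : Finset (Submodule ℍ[ℝ] V)} {a : V →ₗ[ℍ[ℝ]] ℍ[ℝ]}

/-- Classes from the deletion extend over the tube, so on `ℍˣ × X''` they have the form `1 × y` with
no `s` component. -/
theorem pull_iA_map
    (h : IsDeletion 𝒜 𝒜' (LinearMap.ker a)) (h𝒜 : ∀ A ∈ 𝒜, IsHyperplane A)
    (h𝒜' : ∀ A ∈ 𝒜', IsHyperplane A) {v : V} (hv : a v = 1)
    (hr : ∀ B ∈ restriction 𝒜' (LinearMap.ker a), IsHyperplane B) (y : E 𝒜') :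
    pull (h.square h𝒜 h𝒜' hv).iA (toCohomology hs h𝒜 (E.map h.incl y)) =
      pull ContinuousMap.snd (toCohomology hs hr (E.map (toRestriction 𝒜' (LinearMap.ker a)) y)) := by
  have h1 : toCohomology hs h𝒜 (E.map h.incl y) =
      pull (h.square h𝒜 h𝒜' hv).jA (toCohomology hs h𝒜' y) :=
    (pull_inclComplement h𝒜 h𝒜' hs h y).symm
  rw [h1, ← pull_comp, (h.square h𝒜 h𝒜' hv).comm, pull_comp, h.pull_jB,
    pull_restrictionIncl hs h𝒜' hr, ← pull_comp]
  rfl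

theorem pull_iA_gen_mul_map
    (h : IsDeletion 𝒜 𝒜' (LinearMap.ker a)) (h𝒜 : ∀ A ∈ 𝒜, IsHyperplane A)
    (h𝒜' : ∀ A ∈ 𝒜', IsHyperplane A) {v : V} (hv : a v = 1)
    (hr : ∀ B ∈ restriction 𝒜' (LinearMap.ker a), IsHyperplane B) (z : E 𝒜') :
    pull (h.square h𝒜 h𝒜' hv).iA
        (toCohomology hs h𝒜 (E.gen 𝒜 ⟨LinearMap.ker a, h.mem⟩ * E.map h.incl z)) =
      pull ContinuousMap.fst (ringClass s) * pull ContinuousMap.snd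
        (toCohomology hs hr (E.map (toRestriction 𝒜' (LinearMap.ker a)) z)) := by
  rw [map_mul, map_mul, toCohomology_gen, h.pull_iA_hypClass h𝒜 h𝒜' hv hs,
    h.pull_iA_map hs h𝒜 h𝒜' hv hr]

/-- The complement of an arrangement determines the cohomology of a deletion. -/
theorem pull_inclComplement_injective
    (h : IsDeletion 𝒜 𝒜' (LinearMap.ker a)) (h𝒜 : ∀ A ∈ 𝒜, IsHyperplane A)
    (h𝒜' : ∀ A ∈ 𝒜', IsHyperplane A)
    (hr : ∀ B ∈ restriction 𝒜' (LinearMap.ker a), IsHyperplane B)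
    (hp : IsPresentation hs hr) :
    Function.Injective (pull h.inclComplement) := by
  obtain ⟨v, hv⟩ := exists_form_eq_one (form_ne_zero_of_mem h𝒜 h.mem)
  rw [injective_iff_map_eq_zero]
  intro x hx
  let T := h.square h𝒜 h𝒜' hv
  have hC : pull T.iB (pull T.jB x) = 0 := by
    rw [← pull_comp, ← T.comm, pull_comp]
    exact (congrArg (pull T.iA) hx).trans (map_zero _)
  -- A class on the tube is pulled back from `X''` and is therefore detected on `ℍˣ × X''`.
  have hB : pull T.jB x = 0 := by
    rw [h.pull_jB h𝒜 h𝒜' hv] at hC ⊢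
    rw [← pull_comp] at hC
    have h0 := (isSphereClass_of_isGenerator hs).eq_zero
      (y := pull (restrictionIncl 𝒜' (LinearMap.ker a)) x) (z := 0)
      (by rw [map_zero, mul_zero, add_zero]; exact hC)
    rw [h0.1, map_zero]
  obtain ⟨w, rfl⟩ := T.exists_delta_eq hx hB
  obtain ⟨y, z, rfl⟩ := (isSphereClass_of_isGenerator hs).exists_eq w
  obtain ⟨z, rfl⟩ := hp.1 z
  obtain ⟨z, rfl⟩ := E.map_surjective (toRestriction_surjective 𝒜' (LinearMap.ker a)) z
  -- `1 × y` extends to the tube, and `s × z` extends to `X` as `e_H` times a lift of `z`; the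
  -- connecting map kills both.
  have h1 : pull (ContinuousMap.snd : C(ℍ[ℝ]ˣ × HyperplaneComplement _, _)) y =
      pull T.iB (pull ContinuousMap.snd y) := by
    rw [← pull_comp]
    rfl
  rw [map_add, ← h.pull_iA_gen_mul_map hs h𝒜 h𝒜' hv hr, T.delta_pull_iA, h1, T.delta_pull_iB,
    add_zero]

/-- The `s` component of a class on `ℍˣ × X''` is removed by subtracting `e_H z`. The remainder is
`1 × y`, so it glues with a class on the tube and comes from `X'`. -/
theorem toCohomology_surjective
    (h : IsDeletion 𝒜 𝒜' (LinearMap.ker a)) (h𝒜 : ∀ A ∈ 𝒜, IsHyperplane A)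
    (h𝒜' : ∀ A ∈ 𝒜', IsHyperplane A)
    (hr : ∀ B ∈ restriction 𝒜' (LinearMap.ker a), IsHyperplane B)
    (hp' : IsPresentation hs h𝒜') (hp : IsPresentation hs hr) :
    Function.Surjective (toCohomology hs h𝒜) := by
  obtain ⟨v, hv⟩ := exists_form_eq_one (form_ne_zero_of_mem h𝒜 h.mem)
  intro x
  let T := h.square h𝒜 h𝒜' hv
  obtain ⟨y, z, hx⟩ := (isSphereClass_of_isGenerator hs).exists_eq (pull T.iA x)
  obtain ⟨z, rfl⟩ := hp.1 z
  obtain ⟨z, rfl⟩ := E.map_surjective (toRestriction_surjective 𝒜' (LinearMap.ker a)) z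
  rw [← h.pull_iA_gen_mul_map hs h𝒜 h𝒜' hv hr, ← sub_eq_iff_eq_add, ← map_sub] at hx
  obtain ⟨x', hx', -⟩ := T.exists_glue_pull (v := pull ContinuousMap.snd y)
    (hx.trans (by rw [← pull_comp]; rfl))
  obtain ⟨w, rfl⟩ := hp'.1 x'
  have h1 : toCohomology hs h𝒜 (E.map h.incl w) = _ :=
    (pull_inclComplement h𝒜 h𝒜' hs h w).symm.trans hx'
  exact ⟨E.map h.incl w + E.gen 𝒜 ⟨LinearMap.ker a, h.mem⟩ * E.map h.incl z, by
    rw [map_add, h1, sub_add_cancel]⟩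

/-- The `s` component on `ℍˣ × X''` shows that `z` is a relation on `H`. Then `e_H z` can be
replaced by an element of `E(𝒜')` modulo the ideal, and injectivity finishes the argument in the
deletion. -/
theorem mem_osIdeal_of_toCohomology_eq_zero
    (h : IsDeletion 𝒜 𝒜' (LinearMap.ker a)) (h𝒜 : ∀ A ∈ 𝒜, IsHyperplane A)
    (h𝒜' : ∀ A ∈ 𝒜', IsHyperplane A)
    (hr : ∀ B ∈ restriction 𝒜' (LinearMap.ker a), IsHyperplane B)
    (hp' : IsPresentation hs h𝒜')
    (hp : IsPresentation hs hr) {x : E 𝒜} (hx : toCohomology hs h𝒜 x = 0) : x ∈ osIdeal 𝒜 := by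
  obtain ⟨v, hv⟩ := exists_form_eq_one (form_ne_zero_of_mem h𝒜 h.mem)
  obtain ⟨y, z, rfl⟩ := h.exists_eq_add x
  have h0 := congrArg (pull (h.square h𝒜 h𝒜' hv).iA) hx
  rw [map_add, map_add, h.pull_iA_map hs h𝒜 h𝒜' hv hr, h.pull_iA_gen_mul_map hs h𝒜 h𝒜' hv hr,
    map_zero] at h0
  obtain ⟨w, hw⟩ := h.liftable_of_map_mem (h𝒜 _ h.mem) h𝒜'
    (hp.2 _ ((isSphereClass_of_isGenerator hs).eq_zero h0).2)
  have hyw : E.map h.incl y + E.gen 𝒜 ⟨LinearMap.ker a, h.mem⟩ * E.map h.incl z =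
      E.map h.incl (y + w) +
        (E.gen 𝒜 ⟨LinearMap.ker a, h.mem⟩ * E.map h.incl z - E.map h.incl w) := by
    rw [map_add]
    abel
  rw [hyw] at hx ⊢
  refine add_mem (h.map_mem_osIdeal (hp'.2 _ ?_)) hw
  apply h.pull_inclComplement_injective hs h𝒜 h𝒜' hr hp
  rwa [map_add, toCohomology_eq_zero_of_mem hs h𝒜 hw, add_zero,
    ← pull_inclComplement h𝒜 h𝒜' hs h, ← map_zero (pull h.inclComplement)] at hx

end IsDeletion

/-- The induction is strong and quantifies over `V`, since the restriction lives on `H` and may have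
fewer members than the deletion when traces coincide. -/
theorem isPresentation (n : ℕ) : ∀ {V : Type u} [AddCommGroup V] [Module ℍ[ℝ] V]
    [TopologicalSpace V] [IsTopologicalAddGroup V] [ContinuousSMul ℍ[ℝ] V] [T2Space V]
    [Module.Finite ℍ[ℝ] V] {𝒜 : Finset (Submodule ℍ[ℝ] V)} (h𝒜 : ∀ A ∈ 𝒜, IsHyperplane A)
    (_ : 𝒜.card = n), IsPresentation hs h𝒜 := by
  classical
  induction n using Nat.strong_induction_on with
  | _ n ih =>
    intro V _ _ _ _ _ _ _ 𝒜 h𝒜 hn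
    rcases 𝒜.eq_empty_or_nonempty with rfl | ⟨H, hH⟩
    · exact isPresentation_empty hs h𝒜
    obtain ⟨a, ha, rfl⟩ := h𝒜 H hH
    have h : IsDeletion 𝒜 (𝒜.erase (LinearMap.ker a)) (LinearMap.ker a) :=
      { mem := hH
        notMem := Finset.notMem_erase _ _
        subset := Finset.erase_subset _ _
        eq_or_mem := fun A hA => or_iff_not_imp_left.2 fun hne => Finset.mem_erase.2 ⟨hne, hA⟩ }
    have hcard : (𝒜.erase (LinearMap.ker a)).card < n := by
      rw [← hn]
      exact Finset.card_erase_lt_of_mem hH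
    have h𝒜' : ∀ A ∈ 𝒜.erase (LinearMap.ker a), IsHyperplane A := fun A hA => h𝒜 A (h.subset hA)
    have hr := isHyperplane_restriction h𝒜' (h𝒜 _ hH) h.notMem
    have hp' := ih _ hcard h𝒜' rfl
    have hp := ih _ (Finset.card_image_le.trans_lt hcard) hr rfl
    exact ⟨h.toCohomology_surjective hs h𝒜 h𝒜' hr hp' hp,
      fun x => h.mem_osIdeal_of_toCohomology_eq_zero hs h𝒜 h𝒜' hr hp' hp⟩

end Presentation

end QuaternionicArrangement
end

noncomputable section

/-! ### Transport of gradings and differentials -/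

section Transport

theorem isInternal_map {ι R S : Type*} [DecidableEq ι] [AddCommGroup R] [AddCommGroup S]
    {gr : ι → AddSubgroup R} (h : DirectSum.IsInternal gr) (e : R ≃+ S) :
    DirectSum.IsInternal fun n => (gr n).map e.toAddMonoidHom := by
  let f : ∀ n, gr n →+ (gr n).map e.toAddMonoidHom := fun n => (e.addSubgroupMap (gr n)).toAddMonoidHom
  have hc : (DirectSum.coeAddMonoidHom fun n => (gr n).map e.toAddMonoidHom).comp
      (DirectSum.map f) = e.toAddMonoidHom.comp (DirectSum.coeAddMonoidHom gr) := by
    refine DirectSum.addHom_ext fun n x => ?_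
    rw [AddMonoidHom.comp_apply, AddMonoidHom.comp_apply, DirectSum.map_of,
      DirectSum.coeAddMonoidHom_of, DirectSum.coeAddMonoidHom_of]
    rfl
  have hf : Function.Bijective (DirectSum.map f) :=
    ⟨(DirectSum.map_injective f).2 fun n => (e.addSubgroupMap (gr n)).injective,
      (DirectSum.map_surjective f).2 fun n => (e.addSubgroupMap (gr n)).surjective⟩
  refine (Function.Bijective.of_comp_iff _ hf).1 ?_
  rw [← AddMonoidHom.coe_comp, hc]
  exact e.bijective.comp h

theorem IsCGDA.map {R S : Type*} [Ring R] [Ring S] {gr : ℕ → AddSubgroup R} {D : R →+ R}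
    (h : IsCGDA gr D) (e : R ≃+* S) {gr' : ℕ → AddSubgroup S}
    (hgr : ∀ n, (gr n).map e.toAddMonoidHom = gr' n) {D' : S →+ S} (hD : ∀ x, e (D x) = D' (e x)) :
    IsCGDA gr' D' := by
  obtain rfl : (fun n => (gr n).map e.toAddMonoidHom) = gr' := funext hgr
  refine ⟨isInternal_map h.isInternal e.toAddEquiv, ⟨1, h.one_mem, map_one e⟩, ?_, ?_, ?_, ?_, ?_, ?_⟩
  · rintro m n _ _ ⟨x, hx, rfl⟩ ⟨y, hy, rfl⟩
    exact ⟨x * y, h.mul_mem hx hy, map_mul e x y⟩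
  · rintro m n _ _ ⟨x, hx, rfl⟩ ⟨y, hy, rfl⟩
    show e x * e y = (-1) ^ (m * n) * (e y * e x)
    rw [← map_mul, h.graded_comm hx hy]
    simp
  · rintro n _ ⟨x, hx, rfl⟩
    exact ⟨D x, h.degree hx, hD x⟩
  · rintro n _ hn ⟨x, hx, rfl⟩
    exact (hD x).symm.trans (by rw [h.degree_lt hn hx, map_zero])
  · intro x
    obtain ⟨x, rfl⟩ := e.surjective x
    rw [← hD, ← hD, h.square_zero, map_zero]
  · rintro n _ y ⟨x, hx, rfl⟩
    obtain ⟨y, rfl⟩ := e.surjective y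
    show D' (e x * e y) = D' (e x) * e y + (-1) ^ n * (e x * D' (e y))
    rw [← map_mul, ← hD, ← hD, ← hD, h.leibniz hx]
    simp

end Transport

namespace SingularCohomology

universe u

theorem isInternal_degreePart (X : Type u) [TopologicalSpace X] :
    DirectSum.IsInternal (degreePart X) := by
  let f : ∀ n, Cohomology X n →+ degreePart X n := fun n => (DirectSum.of (Cohomology X) n).rangeRestrict
  have h1 : (DirectSum.coeAddMonoidHom (degreePart X)).comp (DirectSum.map f) =
      AddMonoidHom.id (CohomologyRing X) := by
    refine DirectSum.addHom_ext fun n x => ?_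
    rw [AddMonoidHom.comp_apply, DirectSum.map_of, DirectSum.coeAddMonoidHom_of]
    rfl
  have h2 : Function.Surjective (DirectSum.map f) :=
    (DirectSum.map_surjective f).2 fun n => AddMonoidHom.rangeRestrict_surjective _
  have h3 : Function.Bijective (DirectSum.coeAddMonoidHom (degreePart X) ∘ DirectSum.map f) := by
    rw [← AddMonoidHom.coe_comp, h1]
    exact Function.bijective_id
  exact (Function.Bijective.of_comp_iff _ ⟨h3.1.of_comp, h2⟩).1 h3

/-- Take any preimage and keep its components of degree `n`. Only spanning by the graded pieces is
used, so directness of the source grading can be deduced afterwards. -/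
theorem map_eq_degreePart {X : Type u} [TopologicalSpace X] {R : Type*} [AddCommGroup R]
    {gr : ℕ → AddSubgroup R} (hgr : ∀ x, x ∈ ⨆ n, gr n) {f : R →+ CohomologyRing X}
    (hf : Function.Surjective f) (hfg : ∀ n, ∀ x ∈ gr n, f x ∈ degreePart X n) (n : ℕ) :
    (gr n).map f = degreePart X n := by
  refine le_antisymm (by rintro _ ⟨x, hx, rfl⟩; exact hfg n x hx) ?_
  have key : ∀ x, DirectSum.of (Cohomology X) n (f x n) ∈ (gr n).map f := by
    intro x
    refine AddSubgroup.iSup_induction gr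
      (C := fun x => DirectSum.of (Cohomology X) n (f x n) ∈ (gr n).map f) (hgr x) ?_ ?_ ?_
    · intro m x hx
      obtain ⟨y, hy⟩ := hfg m x hx
      by_cases hmn : m = n
      · subst hmn
        rw [← hy, DirectSum.of_eq_same, hy]
        exact ⟨x, hx, rfl⟩
      · rw [← hy, DirectSum.of_eq_of_ne _ _ _ (Ne.symm hmn), map_zero]
        exact zero_mem _
    · rw [map_zero, DirectSum.zero_apply, map_zero]
      exact zero_mem _
    · intro x y hx hy
      rw [map_add, DirectSum.add_apply, map_add]
      exact add_mem hx hy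
  rintro _ ⟨y, rfl⟩
  obtain ⟨x, hx⟩ := hf (DirectSum.of (Cohomology X) n y)
  have := key x
  rwa [hx, DirectSum.of_eq_same] at this

end SingularCohomology

namespace QuaternionicArrangement

open SingularCohomology

universe u

/-! ### The grading of the Orlik–Solomon algebra -/

section Grading

variable {V : Type u} [AddCommGroup V] [Module ℍ[ℝ] V] {𝒜 : Finset (Submodule ℍ[ℝ] V)}

theorem E.exteriorPower_induction {p : ℕ → E 𝒜 → Prop} (intCast : ∀ r : ℤ, p 0 r)
    (add : ∀ k x y, p k x → p k y → p k (x + y))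
    (ι_mul : ∀ k v x, x ∈ ⋀[ℤ]^k (𝒜 →₀ ℤ) → p k x → p (k + 1) (ExteriorAlgebra.ι ℤ v * x)) {k : ℕ}
    {x : E 𝒜} (hx : x ∈ ⋀[ℤ]^k (𝒜 →₀ ℤ)) : p k x := by
  refine Submodule.pow_induction_on_left' _ (C := fun k x _ => p k x) ?_ ?_ ?_ hx
  · intro r
    rw [eq_intCast]
    exact intCast r
  · intro x y k _ _ hx hy
    exact add k x y hx hy
  · rintro _ ⟨v, rfl⟩ k x hxk hx
    exact ι_mul k v x hxk hx

theorem E.involute_of_mem {k : ℕ} {x : E 𝒜} (hx : x ∈ ⋀[ℤ]^k (𝒜 →₀ ℤ)) :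
    CliffordAlgebra.involute x = (-1) ^ k * x := by
  refine E.exteriorPower_induction (p := fun k x => CliffordAlgebra.involute x = (-1) ^ k * x)
    ?_ ?_ ?_ hx
  · intro r
    simp
  · intro k x y hx hy
    rw [map_add, hx, hy, mul_add]
  · intro k v x _ hx
    rw [map_mul, hx, ExteriorAlgebra.ι, CliffordAlgebra.involute_ι, pow_succ]
    have h : Commute (CliffordAlgebra.ι (0 : QuadraticForm ℤ (𝒜 →₀ ℤ)) v) ((-1 : E 𝒜) ^ k) :=
      (Commute.neg_one_right _).pow_right k
    rw [neg_mul, ← mul_assoc, h.eq, mul_neg_one, neg_mul, mul_assoc]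

theorem E.ι_mul_comm (v : 𝒜 →₀ ℤ) (x : E 𝒜) :
    ExteriorAlgebra.ι ℤ v * x = CliffordAlgebra.involute x * ExteriorAlgebra.ι ℤ v := by
  induction x using E.induction with
  | zero => simp
  | one => simp
  | add x y hx hy => simp only [map_add, add_mul, mul_add, hx, hy]
  | neg x hx => simp only [map_neg, neg_mul, mul_neg, hx]
  | gen_mul A x hx =>
    have h : ExteriorAlgebra.ι ℤ v * E.gen 𝒜 A = -(E.gen 𝒜 A * ExteriorAlgebra.ι ℤ v) :=
      eq_neg_of_add_eq_zero_left (ExteriorAlgebra.ι_add_mul_swap _ _)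
    rw [← mul_assoc, h, map_mul, E.involute_gen, neg_mul, neg_mul, neg_mul, mul_assoc, hx,
      mul_assoc]

theorem E.mul_comm_of_mem {k l : ℕ} {x y : E 𝒜} (hx : x ∈ ⋀[ℤ]^k (𝒜 →₀ ℤ))
    (hy : y ∈ ⋀[ℤ]^l (𝒜 →₀ ℤ)) : x * y = (-1) ^ (k * l) * (y * x) := by
  refine E.exteriorPower_induction (p := fun k x => x * y = (-1) ^ (k * l) * (y * x)) ?_ ?_ ?_ hx
  · intro r
    rw [zero_mul, pow_zero, one_mul, (Int.cast_commute r y).eq]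
  · intro k x x' hx hx'
    rw [add_mul, mul_add, mul_add, hx, hx']
  · intro k v x _ hx
    have h : Commute (ExteriorAlgebra.ι ℤ v : E 𝒜) ((-1) ^ (k * l)) :=
      (Commute.neg_one_right _).pow_right _
    rw [mul_assoc, hx, ← mul_assoc, h.eq, mul_assoc, ← mul_assoc _ y x, E.ι_mul_comm,
      E.involute_of_mem hy, add_mul, one_mul, pow_add]
    simp only [mul_assoc]

theorem E.intCast_mem (r : ℤ) : (r : E 𝒜) ∈ ⋀[ℤ]^0 (𝒜 →₀ ℤ) := by
  rw [ExteriorAlgebra.exteriorPower, pow_zero]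
  exact Submodule.mem_one.2 ⟨r, eq_intCast _ r⟩

theorem E.diff_of_mem_zero {x : E 𝒜} (hx : x ∈ ⋀[ℤ]^0 (𝒜 →₀ ℤ)) : E.diff 𝒜 x = 0 := by
  rw [ExteriorAlgebra.exteriorPower, pow_zero] at hx
  obtain ⟨r, rfl⟩ := Submodule.mem_one.1 hx
  rw [E.diff, CliffordAlgebra.contractLeft_algebraMap]

theorem E.diff_mem {k : ℕ} {x : E 𝒜} (hx : x ∈ ⋀[ℤ]^(k + 1) (𝒜 →₀ ℤ)) :
    E.diff 𝒜 x ∈ ⋀[ℤ]^k (𝒜 →₀ ℤ) := by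
  suffices h : ∀ j, j = k + 1 → ∀ x : E 𝒜, x ∈ ⋀[ℤ]^j (𝒜 →₀ ℤ) → E.diff 𝒜 x ∈ ⋀[ℤ]^(j - 1) (𝒜 →₀ ℤ) from
    h _ rfl x hx
  intro j _ x hx
  refine E.exteriorPower_induction (p := fun j x => E.diff 𝒜 x ∈ ⋀[ℤ]^(j - 1) (𝒜 →₀ ℤ)) ?_ ?_ ?_ hx
  · intro r
    rw [E.diff_of_mem_zero (E.intCast_mem r)]
    exact zero_mem _
  · intro k x y hx hy
    rw [map_add]
    exact add_mem hx hy
  · intro k v x hxk hx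
    rw [E.diff] at hx ⊢
    rw [ExteriorAlgebra.ι, CliffordAlgebra.contractLeft_ι_mul]
    refine sub_mem (Submodule.smul_mem _ _ hxk) ?_
    cases k with
    | zero =>
      have := E.diff_of_mem_zero hxk
      rw [E.diff] at this
      rw [this, mul_zero]
      exact zero_mem _
    | succ k =>
      rw [Nat.add_sub_cancel, ExteriorAlgebra.exteriorPower, pow_succ']
      exact Submodule.mul_mem_mul ⟨v, rfl⟩ hx

theorem OS.mk_mem_degreePart {k : ℕ} {x : E 𝒜} (hx : x ∈ ⋀[ℤ]^k (𝒜 →₀ ℤ)) :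
    Ideal.Quotient.mk (osIdeal 𝒜) x ∈ OS.degreePart 𝒜 (3 * k) :=
  (le_iSup₂_of_le k rfl le_rfl :
    (⋀[ℤ]^k (𝒜 →₀ ℤ)).toAddSubgroup.map (Ideal.Quotient.mk (osIdeal 𝒜)).toAddMonoidHom ≤
      OS.degreePart 𝒜 (3 * k)) ⟨x, hx, rfl⟩

theorem OS.eq_zero_or_exists {n : ℕ} {x : OS 𝒜} (hx : x ∈ OS.degreePart 𝒜 n) :
    x = 0 ∨ ∃ k, 3 * k = n ∧ ∃ y ∈ ⋀[ℤ]^k (𝒜 →₀ ℤ), Ideal.Quotient.mk (osIdeal 𝒜) y = x := by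
  by_cases hn : ∃ k, 3 * k = n
  · obtain ⟨k, rfl⟩ := hn
    have hle : OS.degreePart 𝒜 (3 * k) ≤
        (⋀[ℤ]^k (𝒜 →₀ ℤ)).toAddSubgroup.map (Ideal.Quotient.mk (osIdeal 𝒜)).toAddMonoidHom := by
      refine iSup₂_le fun l hl => ?_
      obtain rfl : l = k := by omega
      exact le_rfl
    obtain ⟨y, hy, rfl⟩ := hle hx
    exact Or.inr ⟨k, rfl, y, hy, rfl⟩
  · have hle : OS.degreePart 𝒜 n ≤ ⊥ := iSup₂_le fun k hk => absurd ⟨k, hk⟩ hn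
    exact Or.inl (AddSubgroup.mem_bot.1 (hle hx))

theorem OS.mem_iSup_degreePart (x : OS 𝒜) : x ∈ ⨆ n, OS.degreePart 𝒜 n := by
  classical
  obtain ⟨x, rfl⟩ := Ideal.Quotient.mk_surjective x
  rw [← DirectSum.sum_support_decompose (fun k => ⋀[ℤ]^k (𝒜 →₀ ℤ)) x, map_sum]
  exact sum_mem fun k _ => le_iSup (OS.degreePart 𝒜) (3 * k) (OS.mk_mem_degreePart (SetLike.coe_mem _))

theorem neg_one_pow_three_mul {R : Type*} [Ring R] (k : ℕ) : (-1 : R) ^ (3 * k) = (-1) ^ k := by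
  rw [pow_mul]
  norm_num

/-- Directness is a hypothesis here; it is supplied by the isomorphism with cohomology instead of a
proof that the ideal is homogeneous. -/
theorem OS.isCGDA (hi : DirectSum.IsInternal (OS.degreePart 𝒜)) :
    IsCGDA (OS.degreePart 𝒜) (OS.diff 𝒜) := by
  refine ⟨hi, ?_, ?_, ?_, ?_, ?_, ?_, ?_⟩
  · exact OS.mk_mem_degreePart (k := 0) (by exact_mod_cast E.intCast_mem 1)
  · intro m n x y hx hy
    obtain rfl | ⟨k, rfl, x, hx', rfl⟩ := OS.eq_zero_or_exists hx
    · rw [zero_mul]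
      exact zero_mem _
    obtain rfl | ⟨l, rfl, y, hy', rfl⟩ := OS.eq_zero_or_exists hy
    · rw [mul_zero]
      exact zero_mem _
    rw [← mul_add, ← map_mul]
    refine OS.mk_mem_degreePart ?_
    rw [ExteriorAlgebra.exteriorPower, pow_add]
    exact Submodule.mul_mem_mul hx' hy'
  · intro m n x y hx hy
    obtain rfl | ⟨k, rfl, x, hx', rfl⟩ := OS.eq_zero_or_exists hx
    · simp
    obtain rfl | ⟨l, rfl, y, hy', rfl⟩ := OS.eq_zero_or_exists hy
    · simp
    -- Tripling the degrees multiplies the exponent `k l` by nine, which does not change the sign.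
    rw [mul_assoc, neg_one_pow_three_mul, mul_left_comm, neg_one_pow_three_mul, ← map_mul,
      E.mul_comm_of_mem hx' hy']
    simp
  · intro n x hx
    obtain rfl | ⟨k, hk, x, hx', rfl⟩ := OS.eq_zero_or_exists hx
    · rw [map_zero]
      exact zero_mem _
    obtain ⟨k, rfl⟩ : ∃ l, k = l + 1 := ⟨k - 1, by omega⟩
    obtain rfl : 3 * k = n := by omega
    exact OS.mk_mem_degreePart (E.diff_mem hx')
  · intro n x hn hx
    obtain rfl | ⟨k, hk, x, hx', rfl⟩ := OS.eq_zero_or_exists hx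
    · rw [map_zero]
    obtain rfl : k = 0 := by omega
    rw [OS.diff_mk, E.diff_of_mem_zero hx', map_zero]
  · intro x
    obtain ⟨x, rfl⟩ := Ideal.Quotient.mk_surjective x
    rw [OS.diff_mk, OS.diff_mk, E.diff_diff, map_zero]
  · intro n x y hx
    obtain rfl | ⟨k, rfl, x, hx', rfl⟩ := OS.eq_zero_or_exists hx
    · simp
    obtain ⟨y, rfl⟩ := Ideal.Quotient.mk_surjective y
    rw [← map_mul, OS.diff_mk, OS.diff_mk, OS.diff_mk, E.diff_mul, E.involute_of_mem hx',
      neg_one_pow_three_mul]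
    simp [mul_assoc]

end Grading

/-! ### The isomorphism and the action -/

section Action

theorem IsActionDifferential.unique {V : Type u} [AddCommGroup V] [Module ℍ[ℝ] V]
    [TopologicalSpace V] [ContinuousSMul ℍ[ℝ] V] {𝒜 : Finset (Submodule ℍ[ℝ] V)}
    {s : Cohomology ℍ[ℝ]ˣ 3} (hs : IsGenerator s)
    {D D' : CohomologyRing (HyperplaneComplement 𝒜) →+ CohomologyRing (HyperplaneComplement 𝒜)}
    (hD : IsActionDifferential 𝒜 s D) (hD' : IsActionDifferential 𝒜 s D') : D = D' := by
  refine DFunLike.ext _ _ fun x => ?_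
  have h := (hD x).symm.trans (hD' x)
  rw [add_right_inj, ← sub_eq_zero, ← mul_sub, ← map_sub] at h
  refine sub_eq_zero.1 ((isSphereClass_of_isGenerator hs).eq_zero (y := 0) ?_).2
  rw [map_zero, zero_add]
  exact h

variable {V : Type u} [AddCommGroup V] [Module ℍ[ℝ] V] [TopologicalSpace V]
  [IsTopologicalAddGroup V] [ContinuousSMul ℍ[ℝ] V] [T2Space V] [Module.Finite ℍ[ℝ] V]
  {𝒜 : Finset (Submodule ℍ[ℝ] V)} {s : Cohomology ℍ[ℝ]ˣ 3}

theorem toCohomology_mem_degreePart (hs : IsGenerator s) (h𝒜 : ∀ A ∈ 𝒜, IsHyperplane A) {k : ℕ}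
    {x : E 𝒜} (hx : x ∈ ⋀[ℤ]^k (𝒜 →₀ ℤ)) :
    toCohomology hs h𝒜 x ∈ degreePart (HyperplaneComplement 𝒜) (3 * k) := by
  refine E.exteriorPower_induction (p := fun k x =>
    toCohomology hs h𝒜 x ∈ degreePart (HyperplaneComplement 𝒜) (3 * k)) ?_ ?_ ?_ hx
  · intro r
    rw [map_intCast]
    exact intCast_mem_degreePart r
  · intro k x y hx hy
    rw [map_add]
    exact add_mem hx hy
  · intro k v x _ hx
    rw [map_mul, mul_add, add_comm, mul_one]
    refine mul_mem_degreePart ?_ hx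
    have h : toCohomology hs h𝒜 (ExteriorAlgebra.ι ℤ v) =
        Finsupp.linearCombination ℤ (hypClass h𝒜 s) v := ExteriorAlgebra.lift_ι_apply ℤ _ _ _
    rw [h, Finsupp.linearCombination_apply]
    exact sum_mem fun A _ => zsmul_mem (pull_mem_degreePart _ (of_mem_degreePart 3 s)) _

/-- The isomorphism from the Orlik–Solomon algebra to the cohomology ring. -/
def osEquiv (hs : IsGenerator s) (h𝒜 : ∀ A ∈ 𝒜, IsHyperplane A) :
    OS 𝒜 ≃+* CohomologyRing (HyperplaneComplement 𝒜) :=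
  RingEquiv.ofBijective (Ideal.Quotient.lift (osIdeal 𝒜) (toCohomology hs h𝒜)
    fun _ hx => toCohomology_eq_zero_of_mem hs h𝒜 hx) (by
      have h := isPresentation hs _ h𝒜 rfl
      refine ⟨?_, Ideal.Quotient.lift_surjective_of_surjective _ _ h.1⟩
      rw [injective_iff_map_eq_zero]
      intro x hx
      obtain ⟨x, rfl⟩ := Ideal.Quotient.mk_surjective x
      exact Ideal.Quotient.eq_zero_iff_mem.2 (h.2 x hx))

theorem map_osEquiv_degreePart (hs : IsGenerator s) (h𝒜 : ∀ A ∈ 𝒜, IsHyperplane A) (n : ℕ) :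
    (OS.degreePart 𝒜 n).map (osEquiv hs h𝒜).toAddMonoidHom =
      degreePart (HyperplaneComplement 𝒜) n := by
  refine map_eq_degreePart OS.mem_iSup_degreePart (osEquiv hs h𝒜).surjective ?_ n
  intro n x hx
  obtain rfl | ⟨k, rfl, x, hx', rfl⟩ := OS.eq_zero_or_exists hx
  · exact (map_zero (osEquiv hs h𝒜)).symm ▸ zero_mem _
  · exact toCohomology_mem_degreePart hs h𝒜 hx'

/-- Left linearity gives `a(qx) = q a(x)`, and additivity splits the class of this product. -/
theorem pull_action_hypClass (hs : IsGenerator s) (h𝒜 : ∀ A ∈ 𝒜, IsHyperplane A) (A : 𝒜) :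
    pull (action 𝒜) (hypClass h𝒜 s A) =
      pull ContinuousMap.snd (hypClass h𝒜 s A) + pull ContinuousMap.fst (ringClass s) := by
  have h : (hypMap h𝒜 A).comp (action 𝒜) =
      ContinuousMap.fst * (hypMap h𝒜 A).comp ContinuousMap.snd := by
    ext1 p
    exact Units.ext (map_smul (form h𝒜 A) _ _)
  rw [hypClass, ← pull_comp, h, pull_mul_ringClass hs, pull_comp, add_comm]

/-- Induct on products of generators: `(1 × e + s × 1)(1 × x + s × ∂x) = 1 × ex + s × (x - e ∂x)`,
by `s² = 0` and anticommutation of `e` with `s`; the last factor is `∂(ex)`. -/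
theorem pull_action_toCohomology (hs : IsGenerator s) (h𝒜 : ∀ A ∈ 𝒜, IsHyperplane A) (x : E 𝒜) :
    pull (action 𝒜) (toCohomology hs h𝒜 x) =
      pull ContinuousMap.snd (toCohomology hs h𝒜 x) + pull ContinuousMap.fst (ringClass s) *
        pull ContinuousMap.snd (toCohomology hs h𝒜 (E.diff 𝒜 x)) := by
  induction x using E.induction with
  | zero => simp
  | one => simp [E.diff_one]
  | add x y hx hy =>
    simp only [map_add, hx, hy, mul_add]
    abel
  | neg x hx =>
    simp only [map_neg, hx, mul_neg]
    abel
  | gen_mul A x hx =>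
    have h1 : pull (ContinuousMap.snd : C(ℍ[ℝ]ˣ × HyperplaneComplement 𝒜, _)) (hypClass h𝒜 s A) *
        pull ContinuousMap.fst (ringClass s) =
        -(pull ContinuousMap.fst (ringClass s) * pull ContinuousMap.snd (hypClass h𝒜 s A)) := by
      rw [hypClass, ← pull_comp]
      exact pull_ringClass_anticomm hs _ _
    have h2 := pull_ringClass_mul_self hs
      (ContinuousMap.fst : C(ℍ[ℝ]ˣ × HyperplaneComplement 𝒜, ℍ[ℝ]ˣ))
    rw [E.diff_gen_mul, map_sub, map_mul, map_mul, map_mul, map_mul, map_sub, map_mul, hx,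
      toCohomology_gen, pull_action_hypClass hs, add_mul, mul_add, mul_add, ← mul_assoc _ _
      (pull ContinuousMap.snd (toCohomology hs h𝒜 (E.diff 𝒜 x))), h1, ← mul_assoc (pull
      ContinuousMap.fst (ringClass s)) (pull ContinuousMap.fst (ringClass s)), h2, zero_mul,
      add_zero, mul_sub, neg_mul, mul_assoc]
    abel

end Action

end QuaternionicArrangement
end

theorem mainTheorem1 {V : Type*} [AddCommGroup V] [Module ℍ[ℝ] V] [Module.Finite ℍ[ℝ] V]
    [TopologicalSpace V] [IsTopologicalAddGroup V] [ContinuousSMul ℍ[ℝ] V] [T2Space V]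
    (𝒜 : Finset (Submodule ℍ[ℝ] V)) (h𝒜 : ∀ A ∈ 𝒜, IsHyperplane A) :
    (∃ s : Cohomology ℍ[ℝ]ˣ 3, IsGenerator s) ∧
    ∀ s : Cohomology ℍ[ℝ]ˣ 3, IsGenerator s →
      ∃ D : CohomologyRing (HyperplaneComplement 𝒜) →+ CohomologyRing (HyperplaneComplement 𝒜),
        (∀ D' : CohomologyRing (HyperplaneComplement 𝒜) →+ CohomologyRing (HyperplaneComplement 𝒜),
          IsActionDifferential 𝒜 s D' ↔ D' = D) ∧
        IsCGDA (degreePart (HyperplaneComplement 𝒜)) D ∧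
        IsCGDA (OS.degreePart 𝒜) (OS.diff 𝒜) ∧
        ∃ φ : OS 𝒜 ≃+* CohomologyRing (HyperplaneComplement 𝒜),
          (∀ (a : V →ₗ[ℍ[ℝ]] ℍ[ℝ]) (ha : LinearMap.ker a ∈ 𝒜),
            φ (OS.gen 𝒜 ⟨LinearMap.ker a, ha⟩) =
              pull (formMap 𝒜 a ha) (DirectSum.of (Cohomology ℍ[ℝ]ˣ) 3 s)) ∧
          (∀ n, (OS.degreePart 𝒜 n).map φ.toAddMonoidHom = degreePart (HyperplaneComplement 𝒜) n) ∧
          (∀ x, φ (OS.diff 𝒜 x) = D (φ x)) := by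
  refine ⟨exists_isGenerator, fun s hs => ?_⟩
  let φ := osEquiv hs h𝒜
  -- The differential is defined by transport, so compatibility with `φ` is automatic and the action
  -- formula becomes the statement to check.
  let D : CohomologyRing (HyperplaneComplement 𝒜) →+ CohomologyRing (HyperplaneComplement 𝒜) :=
    (φ.toAddMonoidHom.comp (OS.diff 𝒜)).comp φ.symm.toAddMonoidHom
  have hφD : ∀ x, φ (OS.diff 𝒜 x) = D (φ x) := fun x =>
    congrArg (fun y => φ (OS.diff 𝒜 y)) (φ.symm_apply_apply x).symm
  have hD : IsActionDifferential 𝒜 s D := by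
    intro x
    obtain ⟨x, rfl⟩ := φ.surjective x
    rw [← hφD]
    obtain ⟨x, rfl⟩ := Ideal.Quotient.mk_surjective x
    exact pull_action_toCohomology hs h𝒜 x
  have hφ := map_osEquiv_degreePart hs h𝒜
  -- Directness of the grading passes from cohomology to the Orlik–Solomon algebra; the other axioms
  -- then travel in the opposite direction.
  have hi : DirectSum.IsInternal (OS.degreePart 𝒜) := by
    have h : (fun n => (degreePart (HyperplaneComplement 𝒜) n).map
        φ.symm.toAddEquiv.toAddMonoidHom) = OS.degreePart 𝒜 := by
      funext n
      rw [← hφ n, AddSubgroup.map_map]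
      ext x
      constructor
      · rintro ⟨y, hy, rfl⟩
        exact (φ.symm_apply_apply y).symm ▸ hy
      · exact fun hx => ⟨x, hx, φ.symm_apply_apply x⟩
    exact h ▸ isInternal_map (isInternal_degreePart (HyperplaneComplement 𝒜)) φ.symm.toAddEquiv
  exact ⟨D, fun D' => ⟨fun hD' => hD'.unique hs hD, fun h => h ▸ hD⟩,
    (OS.isCGDA hi).map φ hφ hφD, OS.isCGDA hi, φ,
    fun a ha => (toCohomology_gen hs h𝒜 _).trans (pull_formMap hs h𝒜 a ha).symm, hφ, hφD⟩
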